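/- Let $N\in\{2,3\}$, let $X\subset\mathbb R^N$ be a compact set with $C^1$ boundary (locally on one side of it), and let $f$ be a vector field that is Lipschitz on $X$ with $f(0)=0$, such that for every $x\in X$ the equation $\dot x=f(x)$ has a solution $\phi_t(x)$, $t\ge 0$, starting at $x$ and staying in $X$; if $N=3$, assume also that $f$ has no zero on $\partial X$. Let $\delta>0$ be such that the closed ball $\bar B_\delta$ around $0$ lies in the interior of $X$, and put $D=\operatorname{int}X\setminus\bar B_\delta$. Let $\eta$ be the outward unit normal of $D$, let $$\Gamma_o=\{x\in\partial D: f(x)\cdot\eta(x)>0\}$$ be the outflow part of $\partial D$, and let $\mathcal A_K v=f\cdot\nabla v$ with domain $$\mathcal D(\mathcal A_K)=\{v\in H^1(D): v|_{\Gamma_o}=0\},$$ with weak derivatives and boundary values in the sense of traces. Assume that $0$ is a local attractor, that is, $0$ is Lyapunov stable and $\phi_t(x)\to0$ as $t\to\infty$ for all $x\in\bar B_\delta$, and that $\partial B_\delta\subseteq\Gamma_o$. Then $0$ is globally asymptotically stable on $X$ (Lyapunov stable, and $\phi_t(x)\to0$ as $t\to\infty$ for every $x\in X$) if and only if for every $v_0\in\mathcal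 D(\mathcal A_K)$ with $v_0>0$ almost everywhere on $D$ there is $v\in\mathcal D(\mathcal A_K)$ with $v>0$ almost everywhere on $D$ such that $$\mathcal A_K v=f\cdot\nabla v=-v_0\quad\text{a.e. on }D,\qquad v|_{\Gamma_o}=0 .$$ -/

import Mathlib

open Set Filter Topology MeasureTheory
open scoped NNReal ENNReal ContDiff

/-- `γ : [0, ∞) → X` is a solution of `γ' = f(γ)` that stays in `X`
(a one-sided derivative at time `0`). -/
def IsTrajectory {N : ℕ}
    (f : EuclideanSpace ℝ (Fin N) → EuclideanSpace ℝ (Fin N))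
    (X : Set (EuclideanSpace ℝ (Fin N))) (γ : ℝ → EuclideanSpace ℝ (Fin N)) : Prop :=
  ∀ t : ℝ, 0 ≤ t → γ t ∈ X ∧ HasDerivWithinAt γ (f (γ t)) (Ici 0) t

/-- Stability of `0` in the sense of Lyapunov, for the trajectories in `X`. -/
def LyapunovStable {N : ℕ}
    (f : EuclideanSpace ℝ (Fin N) → EuclideanSpace ℝ (Fin N))
    (X : Set (EuclideanSpace ℝ (Fin N))) : Prop :=
  ∀ ε : ℝ, 0 < ε → ∃ r : ℝ, 0 < r ∧ ∀ γ, IsTrajectory f X γ → ‖γ 0‖ < r →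
    ∀ t : ℝ, 0 ≤ t → ‖γ t‖ < ε

/-- `0` attracts all trajectories in `X` that start in `S`. -/
def Attracts {N : ℕ}
    (f : EuclideanSpace ℝ (Fin N) → EuclideanSpace ℝ (Fin N))
    (X S : Set (EuclideanSpace ℝ (Fin N))) : Prop :=
  ∀ γ, IsTrajectory f X γ → γ 0 ∈ S → Tendsto γ atTop (𝓝 0)

/-- `0` is globally asymptotically stable on `X`: it is Lyapunov stable and every
trajectory in `X` converges to it. -/
def GloballyAsymptoticallyStable {N : ℕ}
    (f : EuclideanSpace ℝ (Fin N) → EuclideanSpace ℝ (Fin N))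
    (X : Set (EuclideanSpace ℝ (Fin N))) : Prop :=
  LyapunovStable f X ∧ Attracts f X X

/-- `n` is the outward unit normal of `S` at the boundary point `p`, near which `S` is one
side of a `C¹` hypersurface: `S` is, up to points of `{g = 0}`, equal to `{g < 0}` near `p`,
where `g` is `C¹`, `g(p) = 0`, and the gradient of `g` at `p` is a positive multiple of `n`. -/
def IsOutwardNormal {N : ℕ} (S : Set (EuclideanSpace ℝ (Fin N)))
    (p n : EuclideanSpace ℝ (Fin N)) : Prop :=
  ‖n‖ = 1 ∧ ∃ g : EuclideanSpace ℝ (Fin N) → ℝ, ContDiffAt ℝ 1 g p ∧ g p = 0 ∧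
    (∃ c : ℝ, 0 < c ∧ gradient g p = c • n) ∧
    ∀ᶠ x in 𝓝 p, (g x < 0 → x ∈ S) ∧ (0 < g x → x ∉ S)

/-- `S` has a `C¹` boundary and lies locally on one side of it. -/
def HasC1Boundary {N : ℕ} (S : Set (EuclideanSpace ℝ (Fin N))) : Prop :=
  ∀ p ∈ frontier S, ∃ n, IsOutwardNormal S p n

/-- The outflow portion `Γ_o` of the boundary of `D`: the boundary points where `f · η > 0`,
with `η` the outward unit normal of `D`. -/
def outflowBoundary {N : ℕ}
    (f : EuclideanSpace ℝ (Fin N) → EuclideanSpace ℝ (Fin N))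
    (D : Set (EuclideanSpace ℝ (Fin N))) : Set (EuclideanSpace ℝ (Fin N)) :=
  {p | p ∈ frontier D ∧ ∃ n, IsOutwardNormal D p n ∧ 0 < inner ℝ (f p) n}

/-- Integration by parts on `D` without a boundary term, for the function `v` with gradient `G`
against the test function `φ`: `∫_D v ∂ᵢφ = - ∫_D Gᵢ φ` for all `i`. -/
def IntegratesByParts {N : ℕ} (D : Set (EuclideanSpace ℝ (Fin N)))
    (v : EuclideanSpace ℝ (Fin N) → ℝ)
    (G : EuclideanSpace ℝ (Fin N) → EuclideanSpace ℝ (Fin N))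
    (φ : EuclideanSpace ℝ (Fin N) → ℝ) : Prop :=
  ∀ i : Fin N, ∫ x in D, v x * fderiv ℝ φ x (EuclideanSpace.single i 1) =
    - ∫ x in D, G x i * φ x

/-- `v ∈ H¹(D)` (`D` open), with weak gradient `G`. -/
def IsH1With {N : ℕ} (D : Set (EuclideanSpace ℝ (Fin N)))
    (v : EuclideanSpace ℝ (Fin N) → ℝ)
    (G : EuclideanSpace ℝ (Fin N) → EuclideanSpace ℝ (Fin N)) : Prop :=
  MemLp v 2 (volume.restrict D) ∧ MemLp G 2 (volume.restrict D) ∧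
    ∀ φ : EuclideanSpace ℝ (Fin N) → ℝ, ContDiff ℝ ∞ φ → HasCompactSupport φ →
      tsupport φ ⊆ D → IntegratesByParts D v G φ

/-- The trace of `v ∈ H¹(D)` (with weak gradient `G`) is zero on the relatively open part `Γ` of
the boundary of `D`. For a bounded domain with `C¹` boundary, the trace `Tv ∈ L²(∂D)` is
characterised by the Gauss-Green formula `∫_D v ∂ᵢφ + ∫_D Gᵢ φ = ∫_{∂D} (Tv) φ ηᵢ dS`; that `Tv`
is zero almost everywhere on `Γ` says exactly that the right-hand side is zero for all
test functions `φ` whose support meets `∂D` only in `Γ`. -/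
def HasZeroTraceOn {N : ℕ} (D Γ : Set (EuclideanSpace ℝ (Fin N)))
    (v : EuclideanSpace ℝ (Fin N) → ℝ)
    (G : EuclideanSpace ℝ (Fin N) → EuclideanSpace ℝ (Fin N)) : Prop :=
  ∀ φ : EuclideanSpace ℝ (Fin N) → ℝ, ContDiff ℝ ∞ φ → HasCompactSupport φ →
    tsupport φ ∩ frontier D ⊆ Γ → IntegratesByParts D v G φ

/-- `v` is in the domain `{v ∈ H¹(D) : v = 0 on Γ_o}` of the Koopman generator
`A_K v = f · ∇v` on `L²(D)`. -/
def MemKoopmanDomain {N : ℕ}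
    (f : EuclideanSpace ℝ (Fin N) → EuclideanSpace ℝ (Fin N))
    (D : Set (EuclideanSpace ℝ (Fin N))) (v : EuclideanSpace ℝ (Fin N) → ℝ) : Prop :=
  ∃ G, IsH1With D v G ∧ HasZeroTraceOn D (outflowBoundary f D) v G

/-- `v` is in the domain of the Koopman generator and `A_K v = f · ∇v = w` almost everywhere
on `D`. -/
def SolvesKoopman {N : ℕ}
    (f : EuclideanSpace ℝ (Fin N) → EuclideanSpace ℝ (Fin N))
    (D : Set (EuclideanSpace ℝ (Fin N))) (v w : EuclideanSpace ℝ (Fin N) → ℝ) : Prop :=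
  ∃ G, IsH1With D v G ∧ HasZeroTraceOn D (outflowBoundary f D) v G ∧
    ∀ᵐ x ∂(volume.restrict D), inner ℝ (f x) (G x) = w x

/-! Since X is forward invariant, f may be replaced by a bounded Lipschitz extension F on the whole
space. Its flow φ consists of bi-Lipschitz homeomorphisms, which distort volume by bounded factors
and preserve X and int X. Mollification gives the tool used in both directions: a function v with
weak gradient G satisfies, for almost every x, v(φ_t x) - v(x) = ∫ F·G along the trajectory, as long
as this stays in the domain (`IsFlow.ae_sub_eq_integral`).

If 0 attracts X, Lyapunov stability and compactness give one time T after which all trajectories are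
in the ball. Extend v₀ by zero into the ball to w, which keeps a weak gradient because the sphere is
in the outflow part, and put v(x) = ∫₀ᵀ w(φ_s x) ds. Pulling gradients back through the flow shows
that v is in H¹. Shifting the window of integration shows that v decreases along trajectories at the
rate w, which is the equation. On the sphere f points into the ball, so the ball is forward
invariant and v vanishes in it: the trace on the sphere is zero. The rest of the boundary contains
no outflow point, since trajectories cannot leave X. This is `IsInvariantFlow.exists_solvesKoopman`.

Conversely, solve with v₀ = max(‖x‖ - δ, 0) and suppose that the set S of points of X that are not
attracted is nonempty. It is compact, forward invariant and at positive distance from the ball. It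
meets ∂X: otherwise some φ_T maps the boundary into the ball, hence also the interior, because the
exterior of a ball is connected (`IsInvariantFlow.nonattracted_inter_frontier_nonempty`). A
trajectory that starts at distance d from S stays near S for a time of order log(1/d), and v > 0
falls at a rate bounded below meanwhile, so v grows at least like log(1/d) near S.

Such growth contradicts finite Dirichlet energy if S contains a set of codimension two, reachable
from D through a cone: a point when N = 2, an arc of a trajectory when N = 3, where f must not
vanish at the boundary point. The contradiction is `HasWeakGradient.false_of_log_growth`. Average v
over cones of size 1/s with vertices distributed by a measure ν on this set, with ν(B(x,r)) ≤ C
r^(N-2). The averages grow at least like b log s. Their derivative in s is a radial flux of G,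
bounded by Young's inequality by 1/s times an arbitrarily small quantity, since the energy seen by ν
at scale 1/s tends to zero. -/

/-! ### The global flow of a bounded Lipschitz vector field -/

/-- `φ` is the global flow of the vector field `F`. -/
structure IsFlow {N : ℕ} (F : EuclideanSpace ℝ (Fin N) → EuclideanSpace ℝ (Fin N))
    (φ : ℝ → EuclideanSpace ℝ (Fin N) → EuclideanSpace ℝ (Fin N)) : Prop where
  zero : ∀ x, φ 0 x = x
  deriv : ∀ x t, HasDerivAt (fun s => φ s x) (F (φ t x)) t

/-- Picard–Lindelöf on every interval [-n, n], glued by uniqueness. -/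
theorem exists_isFlow {N : ℕ} {F : EuclideanSpace ℝ (Fin N) → EuclideanSpace ℝ (Fin N)}
    {K M : ℝ≥0} (hF : LipschitzWith K F) (hM : ∀ x, ‖F x‖ ≤ M) : ∃ φ, IsFlow F φ := by
  have local_sol : ∀ (x : EuclideanSpace ℝ (Fin N)) (n : ℕ), ∃ α : ℝ → EuclideanSpace ℝ (Fin N),
      α 0 = x ∧ ∀ t ∈ Icc (-(n:ℝ)) n, HasDerivWithinAt α (F (α t)) (Icc (-(n:ℝ)) n) t := by
    intro x n
    have h0 : (0:ℝ) ∈ Icc (-(n:ℝ)) n := by constructor <;> simp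
    -- A curve of speed at most M moves at most M * n in time n, so a ball of this radius never
    -- obstructs the solution.
    have := IsPicardLindelof.of_time_independent (f := F) (tmin := -(n:ℝ)) (tmax := n)
      (t₀ := ⟨0, h0⟩) (x₀ := x) (a := M * n) (r := 0) (L := M) (K := K)
      (fun y _ => hM y) hF.lipschitzOnWith (by simp)
    exact this.exists_eq_forall_mem_Icc_hasDerivWithinAt₀
  choose α hα0 hα using local_sol
  have hαd : ∀ x (n : ℕ), ∀ t ∈ Ioo (-(n:ℝ)) n, HasDerivAt (α x n) (F (α x n t)) t := fun x n t ht =>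
    (hα x n t (Ioo_subset_Icc_self ht)).hasDerivAt (Icc_mem_nhds ht.1 ht.2)
  have agree : ∀ x (m n : ℕ), m ≤ n → ∀ t ∈ Ioo (-(m:ℝ)) m, α x m t = α x n t := by
    intro x m n hmn t ht
    have hmn' : (m:ℝ) ≤ n := by exact_mod_cast hmn
    have hm : (0:ℝ) < m := by linarith [ht.1, ht.2]
    refine ODE_solution_unique_of_mem_Ioo (v := fun _ => F) (s := fun _ => univ) (K := K)
      (fun t _ => hF.lipschitzOnWith) (t₀ := 0) ⟨by linarith, hm⟩
      (fun t ht => ⟨hαd x m t ht, trivial⟩)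
      (fun t ht => ⟨hαd x n t ⟨by linarith [ht.1], by linarith [ht.2]⟩, trivial⟩)
      (by rw [hα0, hα0]) ht
  -- The summand 1 puts t inside the open interval of its solution. With n = ⌈|t|⌉₊ + 2 a single
  -- solution then serves all times near t.
  refine ⟨fun t x => α x (⌈|t|⌉₊ + 1) t, fun x => hα0 _ _, fun x t => ?_⟩
  set n := ⌈|t|⌉₊ + 2 with hn
  have ht : |t| < (n:ℝ) - 1 := by
    have := Nat.le_ceil |t|
    push_cast [hn]; linarith
  have hmem : t ∈ Ioo (-(n:ℝ)) n := by
    rw [abs_lt] at ht; constructor <;> linarith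
  have key : ∀ s, |s| < (n:ℝ) - 1 → α x (⌈|s|⌉₊ + 1) s = α x n s := by
    intro s hs
    refine agree x _ _ ?_ s ?_
    · have : ⌈|s|⌉₊ ≤ n - 1 := Nat.ceil_le.2 (by
        rw [Nat.cast_sub (by omega)]; push_cast; linarith)
      omega
    · have := Nat.le_ceil |s|
      have h2 := abs_le.1 this
      push_cast; constructor <;> linarith
  have hev : (fun s => α x (⌈|s|⌉₊ + 1) s) =ᶠ[𝓝 t] α x n := by
    filter_upwards [(continuous_abs.tendsto t).eventually (gt_mem_nhds ht)] with s hs using key s hs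
  show HasDerivAt (fun s => α x (⌈|s|⌉₊ + 1) s) (F (α x (⌈|t|⌉₊ + 1) t)) t
  rw [key t ht]
  exact (hαd x n t hmem).congr_of_eventuallyEq hev

namespace IsFlow

variable {N : ℕ} {F : EuclideanSpace ℝ (Fin N) → EuclideanSpace ℝ (Fin N)}
  {φ : ℝ → EuclideanSpace ℝ (Fin N) → EuclideanSpace ℝ (Fin N)} {K M : ℝ≥0}

theorem neg (h : IsFlow F φ) : IsFlow (fun x => - F x) (fun t => φ (-t)) where
  zero x := by simp [h.zero]
  deriv x t := by
    have := (h.deriv x (-t)).scomp t (hasDerivAt_neg t)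
    rw [neg_one_smul] at this
    exact this

theorem continuous_left (h : IsFlow F φ) (x : EuclideanSpace ℝ (Fin N)) :
    Continuous fun t => φ t x :=
  continuous_iff_continuousAt.2 fun t => (h.deriv x t).continuousAt

theorem eq_of_isIntegralCurve (h : IsFlow F φ) (hF : LipschitzWith K F)
    {γ : ℝ → EuclideanSpace ℝ (Fin N)} {x : EuclideanSpace ℝ (Fin N)} (h0 : γ 0 = x)
    (hγ : ∀ t, 0 ≤ t → HasDerivWithinAt γ (F (γ t)) (Ici 0) t) {t : ℝ} (ht : 0 ≤ t) :
    γ t = φ t x := by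
  refine ODE_solution_unique (v := fun _ => F) (K := K) (a := 0) (b := t) (fun _ => hF)
    (fun s hs => ((hγ s hs.1).mono Icc_subset_Ici_self).continuousWithinAt)
    (fun s hs => (hγ s hs.1).mono (Ici_subset_Ici.2 hs.1))
    (h.continuous_left x).continuousOn (fun s _ => (h.deriv x s).hasDerivWithinAt)
    (by rw [h0, h.zero]) (right_mem_Icc.2 ht)

theorem add (h : IsFlow F φ) (hF : LipschitzWith K F) (s t : ℝ) (x : EuclideanSpace ℝ (Fin N)) :
    φ (s + t) x = φ s (φ t x) := by
  have := ODE_solution_unique_univ (v := fun _ => F) (s := fun _ => univ) (K := K)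
    (f := fun s => φ (s + t) x) (g := fun s => φ s (φ t x)) (t₀ := 0)
    (fun _ => hF.lipschitzOnWith) (fun s => ⟨(h.deriv x (s + t)).comp_add_const s t, trivial⟩)
    (fun s => ⟨h.deriv _ s, trivial⟩) (by simp [h.zero])
  exact congrFun this s

theorem neg_apply (h : IsFlow F φ) (hF : LipschitzWith K F) (t : ℝ)
    (x : EuclideanSpace ℝ (Fin N)) : φ (-t) (φ t x) = x := by
  rw [← h.add hF, neg_add_cancel, h.zero]

theorem apply_neg (h : IsFlow F φ) (hF : LipschitzWith K F) (t : ℝ)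
    (x : EuclideanSpace ℝ (Fin N)) : φ t (φ (-t) x) = x := by
  rw [← h.add hF, add_neg_cancel, h.zero]

theorem dist_le_of_nonneg (h : IsFlow F φ) (hF : LipschitzWith K F) {t : ℝ} (ht : 0 ≤ t)
    (x y : EuclideanSpace ℝ (Fin N)) : dist (φ t x) (φ t y) ≤ Real.exp (K * t) * dist x y := by
  have := dist_le_of_trajectories_ODE (v := fun _ => F) (K := K) (a := 0) (b := t) (fun _ => hF)
    (h.continuous_left x).continuousOn (fun s _ => (h.deriv x s).hasDerivWithinAt)
    (h.continuous_left y).continuousOn (fun s _ => (h.deriv y s).hasDerivWithinAt)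
    (by rw [h.zero, h.zero]) t (right_mem_Icc.2 ht)
  rwa [sub_zero, mul_comm] at this

/-- Grönwall's estimate; for negative times it is applied to the flow of -F. -/
theorem lipschitzWith (h : IsFlow F φ) (hF : LipschitzWith K F) (t : ℝ) :
    LipschitzWith (Real.exp (K * |t|)).toNNReal (φ t) := by
  refine LipschitzWith.of_dist_le_mul fun x y => ?_
  rw [Real.coe_toNNReal _ (Real.exp_pos _).le]
  rcases le_total 0 t with ht | ht
  · rw [abs_of_nonneg ht]; exact h.dist_le_of_nonneg hF ht x y
  · rw [abs_of_nonpos ht]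
    have hF' : LipschitzWith K (fun x => - F x) := hF.neg
    simpa using h.neg.dist_le_of_nonneg hF' (neg_nonneg.2 ht) x y

theorem continuous_right (h : IsFlow F φ) (hF : LipschitzWith K F) (t : ℝ) : Continuous (φ t) :=
  (h.lipschitzWith hF t).continuous

theorem lipschitzWith_left (h : IsFlow F φ) (hM : ∀ x, ‖F x‖ ≤ M) (x : EuclideanSpace ℝ (Fin N)) :
    LipschitzWith M fun t => φ t x :=
  lipschitzWith_of_nnnorm_deriv_le (fun t => (h.deriv x t).differentiableAt)
    fun t => by rw [(h.deriv x t).deriv]; exact hM _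

theorem continuous_uncurry (h : IsFlow F φ) (hF : LipschitzWith K F) (hM : ∀ x, ‖F x‖ ≤ M) :
    Continuous fun p : ℝ × EuclideanSpace ℝ (Fin N) => φ p.1 p.2 :=
  continuous_prod_of_continuous_lipschitzWith (fun p : ℝ × EuclideanSpace ℝ (Fin N) => φ p.1 p.2) M
    (fun t => h.continuous_right hF t) (fun x => h.lipschitzWith_left hM x)

/-- The time-`t` map of the flow as a homeomorphism. -/
noncomputable def homeomorph (h : IsFlow F φ) (hF : LipschitzWith K F) (t : ℝ) :
    EuclideanSpace ℝ (Fin N) ≃ₜ EuclideanSpace ℝ (Fin N) where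
  toFun := φ t
  invFun := φ (-t)
  left_inv := h.neg_apply hF t
  right_inv := h.apply_neg hF t
  continuous_toFun := h.continuous_right hF t
  continuous_invFun := h.continuous_right hF (-t)

end IsFlow

/-! ### Volume distortion under the flow -/

/-- The volume is a constant multiple of N-dimensional Hausdorff measure, which a Lipschitz map
expands by at most L^N. -/
theorem LipschitzWith.volume_image_le {N : ℕ} {L : ℝ≥0}
    {g : EuclideanSpace ℝ (Fin N) → EuclideanSpace ℝ (Fin N)} (hg : LipschitzWith L g)
    (s : Set (EuclideanSpace ℝ (Fin N))) : volume (g '' s) ≤ (L : ℝ≥0∞) ^ N * volume s := by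
  have h := hg.hausdorffMeasure_image_le (d := N) (by positivity) s
  rw [← EuclideanSpace.euclideanHausdorffMeasure_eq_volume, Measure.euclideanHausdorffMeasure_def]
  simp only [Measure.smul_apply]
  rw [ENNReal.rpow_natCast] at h
  simp only [ENNReal.smul_def, smul_eq_mul]
  calc _ ≤ _ * ((L : ℝ≥0∞) ^ N * μH[(N:ℝ)] s) := by gcongr
    _ = _ := by ring

namespace IsFlow

variable {N : ℕ} {F : EuclideanSpace ℝ (Fin N) → EuclideanSpace ℝ (Fin N)}
  {φ : ℝ → EuclideanSpace ℝ (Fin N) → EuclideanSpace ℝ (Fin N)} {K M : ℝ≥0}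

/-- A preimage under φ_t is an image under the Lipschitz map φ_{-t}. This bound takes the place of a
change of variables with Jacobian. -/
theorem volume_preimage_le (h : IsFlow F φ) (hF : LipschitzWith K F) (t : ℝ)
    (s : Set (EuclideanSpace ℝ (Fin N))) :
    volume (φ t ⁻¹' s) ≤ ((Real.exp (K * |t|)).toNNReal : ℝ≥0∞) ^ N * volume s := by
  have := (h.lipschitzWith hF (-t)).volume_image_le s
  rw [abs_neg] at this
  convert this using 2
  ext x
  constructor
  · intro hx; exact ⟨φ t x, hx, h.neg_apply hF t x⟩
  · rintro ⟨y, hy, rfl⟩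
    simpa [h.apply_neg hF] using hy

theorem map_volume_le (h : IsFlow F φ) (hF : LipschitzWith K F) (t : ℝ) :
    volume.map (φ t) ≤ (((Real.exp (K * |t|)).toNNReal : ℝ≥0∞) ^ N) •
      (volume : Measure (EuclideanSpace ℝ (Fin N))) := by
  refine Measure.le_iff.2 fun s hs => ?_
  rw [Measure.map_apply (h.continuous_right hF t).measurable hs]
  exact h.volume_preimage_le hF t s

theorem quasiMeasurePreserving (h : IsFlow F φ) (hF : LipschitzWith K F) (t : ℝ) :
    Measure.QuasiMeasurePreserving (φ t) volume volume :=
  ⟨(h.continuous_right hF t).measurable, (Measure.absolutelyContinuous_of_le_smul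
    (h.map_volume_le hF t))⟩

theorem lintegral_comp_le (h : IsFlow F φ) (hF : LipschitzWith K F) (t : ℝ)
    {g : EuclideanSpace ℝ (Fin N) → ℝ≥0∞} (hg : Measurable g) :
    ∫⁻ x, g (φ t x) ≤ ((Real.exp (K * |t|)).toNNReal : ℝ≥0∞) ^ N * ∫⁻ x, g x := by
  rw [← lintegral_map hg (h.continuous_right hF t).measurable, ← smul_eq_mul,
    ← lintegral_smul_measure]
  exact lintegral_mono' (h.map_volume_le hF t) le_rfl

theorem setLIntegral_comp_le (h : IsFlow F φ) (hF : LipschitzWith K F) {t T : ℝ} (hT : |t| ≤ T)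
    {g : EuclideanSpace ℝ (Fin N) → ℝ≥0∞} (hg : Measurable g)
    {A B : Set (EuclideanSpace ℝ (Fin N))} (hB : MeasurableSet B)
    (hAB : MapsTo (φ t) A B) :
    ∫⁻ x in A, g (φ t x) ≤ ((Real.exp (K * T)).toNNReal : ℝ≥0∞) ^ N * ∫⁻ x in B, g x := by
  calc ∫⁻ x in A, g (φ t x) ≤ ∫⁻ x in φ t ⁻¹' B, g (φ t x) := lintegral_mono_set hAB
    _ = ∫⁻ x, (B.indicator g) (φ t x) := by
      rw [← lintegral_indicator ((h.continuous_right hF t).measurable hB)]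
      rfl
    _ ≤ _ := h.lintegral_comp_le hF t (hg.indicator hB)
    _ = ((Real.exp (K * |t|)).toNNReal : ℝ≥0∞) ^ N * ∫⁻ x in B, g x := by
      rw [lintegral_indicator hB]
    _ ≤ _ := by gcongr

end IsFlow

/-! ### Extension of the vector field -/

/-- Each coordinate extends as a Lipschitz function. Truncation at a bound for f on X changes
nothing on X and makes the extension bounded, so that its flow is global. -/
theorem exists_bounded_lipschitz_extension {N : ℕ} {X : Set (EuclideanSpace ℝ (Fin N))}
    (hX : IsCompact X) {f : EuclideanSpace ℝ (Fin N) → EuclideanSpace ℝ (Fin N)} {K : ℝ≥0}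
    (hf : LipschitzOnWith K f X) :
    ∃ (F : EuclideanSpace ℝ (Fin N) → EuclideanSpace ℝ (Fin N)) (K' M : ℝ≥0),
      LipschitzWith K' F ∧ (∀ x, ‖F x‖ ≤ M) ∧ EqOn F f X := by
  obtain ⟨C, hC⟩ := hX.exists_bound_of_continuousOn hf.continuousOn
  have hext : ∀ i : Fin N, ∃ g : EuclideanSpace ℝ (Fin N) → ℝ,
      LipschitzWith K g ∧ EqOn (fun x => f x i) g X := by
    intro i
    refine LipschitzOnWith.extend_real ?_
    refine LipschitzOnWith.of_dist_le_mul fun x hx y hy => le_trans ?_ (hf.dist_le_mul x hx y hy)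
    rw [dist_eq_norm, dist_eq_norm]
    exact PiLp.norm_apply_le (f x - f y) i
  choose g hg hgf using hext
  -- If X is empty the bound C may be negative.
  set A : ℝ := |C|
  let G : EuclideanSpace ℝ (Fin N) → (Fin N → ℝ) := fun x i => max (-A) (min A (g i x))
  have hG : LipschitzWith K G := by
    refine LipschitzWith.of_dist_le_mul fun x y => ?_
    refine (dist_pi_le_iff (by positivity)).2 fun i => ?_
    exact ((((hg i).const_min A).const_max (-A)).dist_le_mul x y)
  obtain ⟨L, hL⟩ : ∃ L : ℝ≥0, LipschitzWith L (fun y : Fin N → ℝ => (WithLp.toLp 2 y : EuclideanSpace ℝ (Fin N))) :=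
    ⟨_, PiLp.lipschitzWith_toLp 2 (fun _ : Fin N => ℝ)⟩
  refine ⟨fun x => WithLp.toLp 2 (G x), L * K, L * A.toNNReal, hL.comp hG, fun x => ?_, fun x hx => ?_⟩
  · have h1 := hL.dist_le_mul (G x) 0
    rw [dist_eq_norm, dist_eq_norm, sub_zero, WithLp.toLp_zero, sub_zero] at h1
    refine h1.trans ?_
    push_cast
    gcongr
    rw [Real.coe_toNNReal _ (abs_nonneg C)]
    refine (pi_norm_le_iff_of_nonneg (abs_nonneg C)).2 fun i => ?_
    rw [Real.norm_eq_abs, abs_le]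
    exact ⟨le_max_left _ _, max_le (by linarith [abs_nonneg C]) (min_le_left _ _)⟩
  · ext i
    have h1 : |f x i| ≤ A := (PiLp.norm_apply_le (f x) i).trans ((hC x hx).trans (le_abs_self C))
    rw [abs_le] at h1
    show max (-A) (min A (g i x)) = f x i
    rw [← hgf i hx, min_eq_right h1.2, max_eq_right h1.1]

/-! ### Mollification and smooth approximation of weak gradients -/

/-- Continuity of translations in L¹, read off from the continuous action of the additive group on
`Lp`. -/
theorem exists_lintegral_translate_sub_le {E H : Type*} [NormedAddCommGroup E] [NormedSpace ℝ E]
    [FiniteDimensional ℝ E] [MeasurableSpace E] [BorelSpace E] {μ : Measure E} [μ.IsAddHaarMeasure]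
    [NormedAddCommGroup H] {f : E → H} (hf : Integrable f μ) {ε : ℝ≥0∞} (hε : 0 < ε) :
    ∃ r : ℝ, 0 < r ∧ ∀ y : E, ‖y‖ < r → ∫⁻ x, ‖f (y + x) - f x‖ₑ ∂μ ≤ ε := by
  have hf1 : MemLp f 1 μ := memLp_one_iff_integrable.2 hf
  have hcont : Continuous fun c : Eᵈᵃᵃ => c +ᵥ hf1.toLp f := by
    have : Fact ((1 : ℝ≥0∞) ≠ ⊤) := ⟨ENNReal.one_ne_top⟩
    exact continuous_id.vadd continuous_const
  have h0 := (hcont.comp (DomAddAct.continuous_mk (M := E))).tendsto 0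
  have h1 := h0.eventually (Metric.eball_mem_nhds _ hε)
  obtain ⟨r, hr, hball⟩ := Metric.eventually_nhds_iff.1 h1
  refine ⟨r, hr, fun y hy => ?_⟩
  have h2 := hball (y := y) (by simpa using hy)
  simp only [Function.comp, DomAddAct.mk_zero, zero_vadd] at h2
  rw [DomAddAct.mk_vadd_toLp, Lp.edist_toLp_toLp, eLpNorm_one_eq_lintegral_enorm] at h2
  exact h2.le

/-- Mollification of an integrable function by a normalized bump function is close to it in `L¹`. -/
theorem lintegral_mollify_sub_le {E H : Type*} [NormedAddCommGroup E] [NormedSpace ℝ E]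
    [FiniteDimensional ℝ E] [MeasurableSpace E] [BorelSpace E] {μ : Measure E} [μ.IsAddHaarMeasure]
    [NormedAddCommGroup H] [NormedSpace ℝ H] [CompleteSpace H]
    {f : E → H} (hf : Integrable f μ) {ε : ℝ≥0∞}
    {r : ℝ} (hr : ∀ y : E, ‖y‖ < r → ∫⁻ x, ‖f (y + x) - f x‖ₑ ∂μ ≤ ε)
    (ρ : ContDiffBump (0 : E)) (hρ : ρ.rOut ≤ r) :
    ∫⁻ x, ‖(∫ t, ρ.normed μ (x - t) • f t ∂μ) - f x‖ₑ ∂μ ≤ ε := by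
  have hmeas : AEMeasurable (fun p : E × E => ‖ρ.normed μ p.2‖ₑ * ‖f (-p.2 + p.1) - f p.1‖ₑ)
      (μ.prod μ) := by
    refine AEMeasurable.mul (ρ.continuous_normed.measurable.comp measurable_snd).enorm.aemeasurable ?_
    refine AEStronglyMeasurable.enorm (AEStronglyMeasurable.sub ?_ hf.1.comp_fst)
    have := (quasiMeasurePreserving_sub_of_right_invariant μ μ)
    have h2 := hf.1.comp_quasiMeasurePreserving this
    refine h2.congr (Eventually.of_forall fun p => ?_)
    simp [sub_eq_neg_add]
  calc ∫⁻ x, ‖(∫ t, ρ.normed μ (x - t) • f t ∂μ) - f x‖ₑ ∂μ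
      ≤ ∫⁻ x, ∫⁻ y, ‖ρ.normed μ y‖ₑ * ‖f (-y + x) - f x‖ₑ ∂μ ∂μ := by
        refine lintegral_mono fun x => ?_
        have h1 : ∫ t, ρ.normed μ (x - t) • f t ∂μ = ∫ y, ρ.normed μ y • f (-y + x) ∂μ := by
          rw [← integral_sub_left_eq_self _ μ x]
          congr 1; ext y; congr 2 <;> abel
        have hint : Integrable (fun y => ρ.normed μ y • f (-y + x)) μ := by
          have : Integrable (fun y => f (-y + x)) μ := by
            have := (integrable_comp_sub_left f x (μ := μ)).2 hf
            refine this.congr (Eventually.of_forall fun y => ?_)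
            show f (x - y) = f (-y + x)
            rw [sub_eq_neg_add]
          obtain ⟨C, hC⟩ := ρ.hasCompactSupport_normed (μ := μ) |>.exists_bound_of_continuous
            ρ.continuous_normed
          exact this.bdd_smul C ρ.continuous_normed.aestronglyMeasurable
            (Eventually.of_forall hC)
        have h2 : f x = ∫ y, ρ.normed μ y • f x ∂μ := by
          rw [integral_smul_const, ρ.integral_normed, one_smul]
        have h3 : Integrable (fun y => ρ.normed μ y • f x) μ := ρ.integrable_normed.smul_const _
        have h4 : (∫ t, ρ.normed μ (x - t) • f t ∂μ) - f x =
            ∫ y, (ρ.normed μ y • f (-y + x) - ρ.normed μ y • f x) ∂μ := by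
          rw [integral_sub hint h3, ← h2, h1]
        rw [h4]
        refine (enorm_integral_le_lintegral_enorm _).trans_eq ?_
        refine lintegral_congr fun y => ?_
        rw [← smul_sub, enorm_smul]
    _ = ∫⁻ y, ∫⁻ x, ‖ρ.normed μ y‖ₑ * ‖f (-y + x) - f x‖ₑ ∂μ ∂μ := lintegral_lintegral_swap hmeas
    _ = ∫⁻ y, ‖ρ.normed μ y‖ₑ * ∫⁻ x, ‖f (-y + x) - f x‖ₑ ∂μ ∂μ := by
        refine lintegral_congr fun y => lintegral_const_mul' _ _ enorm_ne_top
    _ ≤ ∫⁻ y, ‖ρ.normed μ y‖ₑ * ε ∂μ := by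
        refine lintegral_mono fun y => ?_
        by_cases hy : ‖y‖ < ρ.rOut
        · gcongr; exact hr _ (by rw [norm_neg]; linarith)
        · have : ρ.normed μ y = 0 := by
            rw [← Function.notMem_support, ρ.support_normed_eq]; simpa using hy
          simp [this]
    _ = ε := by
        rw [lintegral_mul_const _ ρ.continuous_normed.measurable.enorm]
        have : ∫⁻ y, ‖ρ.normed μ y‖ₑ ∂μ = 1 := by
          have h1 : ∀ y, ‖ρ.normed μ y‖ₑ = ENNReal.ofReal (ρ.normed μ y) := fun y =>
            Real.enorm_of_nonneg (ρ.nonneg_normed y)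
          simp_rw [h1]
          rw [← ofReal_integral_eq_lintegral_ofReal ρ.integrable_normed
            (Eventually.of_forall ρ.nonneg_normed), ρ.integral_normed, ENNReal.ofReal_one]
        rw [this, one_mul]

section
variable {N : ℕ}

/-- `G` is a weak gradient of `v` on `U`. -/
def HasWeakGradient (U : Set (EuclideanSpace ℝ (Fin N))) (v : EuclideanSpace ℝ (Fin N) → ℝ) (G : EuclideanSpace ℝ (Fin N) → EuclideanSpace ℝ (Fin N)) : Prop :=
  ∀ φ : EuclideanSpace ℝ (Fin N) → ℝ, ContDiff ℝ ∞ φ → HasCompactSupport φ → tsupport φ ⊆ U → IntegratesByParts U v G φ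

theorem gradient_apply {u : EuclideanSpace ℝ (Fin N) → ℝ} (x : EuclideanSpace ℝ (Fin N)) (i : Fin N) :
    gradient u x i = fderiv ℝ u x (EuclideanSpace.single i 1) := by
  rw [← inner_gradient_left (𝕜 := ℝ), EuclideanSpace.inner_single_right]
  simp

/-- The gradient of a mollification is the mollification of the weak gradient. -/
theorem HasWeakGradient.gradient_convolution {U : Set (EuclideanSpace ℝ (Fin N))} (hU : IsOpen U)
    {v : EuclideanSpace ℝ (Fin N) → ℝ} {G : EuclideanSpace ℝ (Fin N) → EuclideanSpace ℝ (Fin N)} (hw : HasWeakGradient U v G) (hv : IntegrableOn v U)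
    (hG : IntegrableOn G U) {η : EuclideanSpace ℝ (Fin N) → ℝ} (hηs : ContDiff ℝ ∞ η) (hηc : HasCompactSupport η)
    {r : ℝ} (hηr : Function.support η ⊆ Metric.ball 0 r)
    {x : EuclideanSpace ℝ (Fin N)} (hx : Metric.closedBall x r ⊆ U) :
    gradient (MeasureTheory.convolution (U.indicator v) η (ContinuousLinearMap.mul ℝ ℝ) volume) x =
      ∫ t, η (x - t) • U.indicator G t := by
  set v' := U.indicator v with hv'def
  set G' := U.indicator G with hG'def
  have hv' : Integrable v' := (integrable_indicator_iff hU.measurableSet).2 hv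
  have hG' : Integrable G' := (integrable_indicator_iff hU.measurableSet).2 hG
  set u : EuclideanSpace ℝ (Fin N) → ℝ := MeasureTheory.convolution v' η (ContinuousLinearMap.mul ℝ ℝ) volume with hu
  have hint : Integrable (fun t => η (x - t) • G' t) := by
    obtain ⟨C, hC⟩ := hηc.exists_bound_of_continuous hηs.continuous
    exact hG'.bdd_smul C (hηs.continuous.comp (by fun_prop)).aestronglyMeasurable
      (Eventually.of_forall fun t => hC _)
  ext i
  have hd := hηc.hasFDerivAt_convolution_right (ContinuousLinearMap.mul ℝ ℝ) hv'.locallyIntegrable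
    (hηs.of_le (by simp)) x
  have e1 := gradient_apply (u := u) x i
  have e2 : fderiv ℝ u x (EuclideanSpace.single i 1) =
      ∫ t, v' t * fderiv ℝ η (x - t) (EuclideanSpace.single i 1) := by
    rw [hu, hd.fderiv, convolution_precompR_apply _ hv'.locallyIntegrable (hηc.fderiv ℝ)
      (hηs.continuous_fderiv (by simp)), convolution_def]
    rfl
  -- The reflected mollifier centred at x is the test function; its support is in the ball about x,
  -- hence in U.
  set ψ : EuclideanSpace ℝ (Fin N) → ℝ := fun t => η (x - t) with hψ
  have hψs : ContDiff ℝ ∞ ψ := hηs.comp (contDiff_const.sub contDiff_id)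
  have hψsupp : tsupport ψ ⊆ Metric.closedBall x r := by
    refine closure_minimal (fun t ht => ?_) Metric.isClosed_closedBall
    have : x - t ∈ Function.support η := ht
    replace this := hηr this
    simp only [Metric.mem_ball, dist_zero_right] at this
    rw [Metric.mem_closedBall, dist_comm, dist_eq_norm]
    exact this.le
  have hψc : HasCompactSupport ψ :=
    HasCompactSupport.of_support_subset_isCompact (isCompact_closedBall x r)
      (subset_closure.trans hψsupp)
  have hψU : tsupport ψ ⊆ U := hψsupp.trans hx
  have hibp := hw ψ hψs hψc hψU i
  have hfd : ∀ t, fderiv ℝ ψ t (EuclideanSpace.single i 1) =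
      - fderiv ℝ η (x - t) (EuclideanSpace.single i 1) := by
    intro t
    have h1 : HasFDerivAt (fun t : EuclideanSpace ℝ (Fin N) => x - t) (-ContinuousLinearMap.id ℝ (EuclideanSpace ℝ (Fin N))) t :=
      (hasFDerivAt_id t).const_sub x
    have h2 := ((hηs.differentiable (by simp)) (x - t)).hasFDerivAt.comp t h1
    have h3 : fderiv ℝ ψ t = _ := h2.fderiv
    rw [h3]; simp
  have e3 : (∫ t, η (x - t) • G' t) i = ∫ t, η (x - t) * G' t i := by
    have := (EuclideanSpace.proj (𝕜 := ℝ) i : EuclideanSpace ℝ (Fin N) →L[ℝ] ℝ).integral_comp_comm hint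
    simpa using this.symm
  rw [e1, e2, e3]
  have e4 : ∫ t, v' t * fderiv ℝ η (x - t) (EuclideanSpace.single i 1) =
      ∫ t in U, v t * fderiv ℝ η (x - t) (EuclideanSpace.single i 1) := by
    rw [← integral_indicator hU.measurableSet]
    congr 1; ext t
    by_cases ht : t ∈ U <;> simp [hv'def, ht]
  have e5 : ∫ t, η (x - t) * G' t i = ∫ t in U, G t i * η (x - t) := by
    rw [← integral_indicator hU.measurableSet]
    congr 1; ext t
    by_cases ht : t ∈ U <;> simp [hG'def, ht, mul_comm]
  rw [e4, e5]
  simp_rw [hfd, mul_neg, integral_neg] at hibp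
  exact neg_injective hibp

/-- Meyers–Serrin on compact subsets: a function with a weak gradient is approximated in `W^{1,1}`
by smooth functions. -/
theorem HasWeakGradient.exists_approx {U : Set (EuclideanSpace ℝ (Fin N))} (hU : IsOpen U) (hUb : Bornology.IsBounded U)
    {v : EuclideanSpace ℝ (Fin N) → ℝ} {G : EuclideanSpace ℝ (Fin N) → EuclideanSpace ℝ (Fin N)} (hw : HasWeakGradient U v G) (hv : IntegrableOn v U)
    (hG : IntegrableOn G U) {K : Set (EuclideanSpace ℝ (Fin N))} (hK : IsCompact K) (hKU : K ⊆ U) {ε : ℝ≥0∞} (hε : 0 < ε) :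
    ∃ u : EuclideanSpace ℝ (Fin N) → ℝ, ContDiff ℝ ∞ u ∧ HasCompactSupport u ∧ ∫⁻ x in K, ‖u x - v x‖ₑ ≤ ε ∧
      ∫⁻ x in K, ‖gradient u x - G x‖ₑ ≤ ε := by
  set v' := U.indicator v with hv'def
  set G' := U.indicator G with hG'def
  have hv' : Integrable v' := (integrable_indicator_iff hU.measurableSet).2 hv
  have hG' : Integrable G' := (integrable_indicator_iff hU.measurableSet).2 hG
  obtain ⟨r₁, hr₁, h₁⟩ := exists_lintegral_translate_sub_le hv' hε
  obtain ⟨r₂, hr₂, h₂⟩ := exists_lintegral_translate_sub_le hG' hε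
  obtain ⟨r₃, hr₃, h₃⟩ := hK.exists_cthickening_subset_open hU hKU
  -- The first two radii control translations of v' and G'. The third keeps the balls about points
  -- of K inside U, where the derivative may be moved onto the mollifier.
  set r := min r₁ (min r₂ r₃) with hr
  have hrpos : 0 < r := by positivity
  let ρ : ContDiffBump (0 : EuclideanSpace ℝ (Fin N)) := ⟨r / 2, r, by positivity, by linarith⟩
  set η : EuclideanSpace ℝ (Fin N) → ℝ := ρ.normed volume with hη
  have hηs : ContDiff ℝ ∞ η := ρ.contDiff_normed
  have hηc : HasCompactSupport η := ρ.hasCompactSupport_normed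
  set u : EuclideanSpace ℝ (Fin N) → ℝ := MeasureTheory.convolution v' η (ContinuousLinearMap.mul ℝ ℝ) volume with hu
  have hu_eq : ∀ x, u x = ∫ t, η (x - t) • v' t := by
    intro x
    rw [hu, convolution_def]
    refine integral_congr_ae (Eventually.of_forall fun t => ?_)
    simp [mul_comm]
  have hus : ContDiff ℝ ∞ u :=
    hηc.contDiff_convolution_right _ hv'.locallyIntegrable hηs
  have hv'c : HasCompactSupport v' := by
    refine HasCompactSupport.of_support_subset_isCompact hUb.isCompact_closure ?_
    exact (support_indicator_subset).trans subset_closure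
  have huc : HasCompactSupport u := hv'c.convolution _ hηc
  have hgrad : ∀ x ∈ K, gradient u x = ∫ t, η (x - t) • G' t := by
    intro x hx
    exact hw.gradient_convolution hU hv hG hηs hηc (r := r) (by rw [hη, ρ.support_normed_eq])
      (fun t ht => h₃ (by
        refine Metric.mem_cthickening_of_dist_le t x r₃ K hx (ht.trans ?_)
        exact (min_le_right _ _).trans (min_le_right _ _)))
  refine ⟨u, hus, huc, ?_, ?_⟩
  · calc ∫⁻ x in K, ‖u x - v x‖ₑ = ∫⁻ x in K, ‖(∫ t, η (x - t) • v' t) - v' x‖ₑ := by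
          refine setLIntegral_congr_fun hK.measurableSet fun x hx => ?_
          simp only [hu_eq, hv'def, indicator_of_mem (hKU hx)]
      _ ≤ ∫⁻ x, ‖(∫ t, η (x - t) • v' t) - v' x‖ₑ := setLIntegral_le_lintegral _ _
      _ ≤ ε := lintegral_mollify_sub_le hv' h₁ ρ (min_le_left _ _)
  · calc ∫⁻ x in K, ‖gradient u x - G x‖ₑ = ∫⁻ x in K, ‖(∫ t, η (x - t) • G' t) - G' x‖ₑ := by
          refine setLIntegral_congr_fun hK.measurableSet fun x hx => ?_
          simp only [hgrad x hx, hG'def, indicator_of_mem (hKU hx)]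
      _ ≤ ∫⁻ x, ‖(∫ t, η (x - t) • G' t) - G' x‖ₑ := setLIntegral_le_lintegral _ _
      _ ≤ ε := lintegral_mollify_sub_le hG' h₂ ρ ((min_le_right _ _).trans (min_le_left _ _))

end

/-! ### Sobolev functions along trajectories -/

section
variable {N : ℕ}

namespace IsFlow
variable {F : EuclideanSpace ℝ (Fin N) → EuclideanSpace ℝ (Fin N)} {φ : ℝ → EuclideanSpace ℝ (Fin N) → EuclideanSpace ℝ (Fin N)} {K M : ℝ≥0}

/-- Tonelli's theorem and the volume distortion at each single time. -/
theorem setLIntegral_lintegral_comp_le (h : IsFlow F φ) (hF : LipschitzWith K F)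
    (hM : ∀ x, ‖F x‖ ≤ M) {t : ℝ} {g : EuclideanSpace ℝ (Fin N) → ℝ≥0∞} (hg : Measurable g)
    {A B : Set (EuclideanSpace ℝ (Fin N))} (hB : MeasurableSet B) (hAB : ∀ s ∈ Icc 0 t, MapsTo (φ s) A B) :
    ∫⁻ x in A, ∫⁻ s in Ioc 0 t, g (φ s x) ≤
      ENNReal.ofReal t * (((Real.exp (K * t)).toNNReal : ℝ≥0∞) ^ N * ∫⁻ x in B, g x) := by
  have hm : Measurable fun p : EuclideanSpace ℝ (Fin N) × ℝ => g (φ p.2 p.1) :=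
    hg.comp ((h.continuous_uncurry hF hM).comp continuous_swap).measurable
  rw [lintegral_lintegral_swap hm.aemeasurable]
  calc ∫⁻ s in Ioc 0 t, ∫⁻ x in A, g (φ s x)
      ≤ ∫⁻ s in Ioc 0 t, ((Real.exp (K * t)).toNNReal : ℝ≥0∞) ^ N * ∫⁻ x in B, g x := by
        refine setLIntegral_mono measurable_const fun s hs => ?_
        exact h.setLIntegral_comp_le hF (T := t) (by rw [abs_of_nonneg hs.1.le]; exact hs.2) hg hB
          (hAB s ⟨hs.1.le, hs.2⟩)
    _ = _ := by simp [mul_comm]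

/-- Along the flow, a Sobolev function changes by the integral of its derivative along the vector
field. -/
theorem ae_sub_eq_integral_of_isCompact (h : IsFlow F φ) (hF : LipschitzWith K F)
    (hM : ∀ x, ‖F x‖ ≤ M) {U : Set (EuclideanSpace ℝ (Fin N))} (hU : IsOpen U) (hUb : Bornology.IsBounded U)
    {v : EuclideanSpace ℝ (Fin N) → ℝ} {G : EuclideanSpace ℝ (Fin N) → EuclideanSpace ℝ (Fin N)} (hvm : Measurable v) (hGm : Measurable G)
    (hw : HasWeakGradient U v G) (hv : IntegrableOn v U) (hG : IntegrableOn G U)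
    {t : ℝ} (ht : 0 ≤ t) {A : Set (EuclideanSpace ℝ (Fin N))} (hA : IsCompact A) (hAU : ∀ s ∈ Icc 0 t, MapsTo (φ s) A U) :
    ∀ᵐ x ∂(volume.restrict A), IntegrableOn (fun s => G (φ s x)) (Ioc 0 t) ∧
      v (φ t x) - v x = ∫ s in Ioc 0 t, inner ℝ (F (φ s x)) (G (φ s x)) := by
  have hφc := h.continuous_uncurry hF hM
  -- The compact tube swept out by A up to time t; smooth approximation is needed only there.
  set B : Set (EuclideanSpace ℝ (Fin N)) := (fun p : ℝ × EuclideanSpace ℝ (Fin N) => φ p.1 p.2) '' (Icc 0 t ×ˢ A) with hBdef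
  have hB : IsCompact B := (isCompact_Icc.prod hA).image hφc
  have hBU : B ⊆ U := by
    rintro _ ⟨⟨s, x⟩, ⟨hs, hx⟩, rfl⟩; exact hAU s hs hx
  have hAB : ∀ s ∈ Icc 0 t, MapsTo (φ s) A B := fun s hs x hx => ⟨(s, x), ⟨hs, hx⟩, rfl⟩
  set C : ℝ≥0∞ := ((Real.exp (K * t)).toNNReal : ℝ≥0∞) ^ N with hC
  have hCtop : C ≠ ⊤ := by simp [hC]
  have hcx : ∀ x, Continuous fun s => φ s x := h.continuous_left
  have hfin : ∀ᵐ x ∂(volume.restrict A), ∫⁻ s in Ioc 0 t, ‖G (φ s x)‖ₑ < ⊤ := by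
    have hm : Measurable fun p : EuclideanSpace ℝ (Fin N) × ℝ => ‖G (φ p.2 p.1)‖ₑ :=
      (hGm.comp (hφc.comp continuous_swap).measurable).enorm
    refine ae_lt_top hm.lintegral_prod_right' (ne_of_lt ?_)
    refine (h.setLIntegral_lintegral_comp_le hF hM hGm.enorm hB.measurableSet hAB).trans_lt ?_
    refine ENNReal.mul_lt_top ENNReal.ofReal_lt_top (ENNReal.mul_lt_top hCtop.lt_top ?_)
    exact (hG.mono_set hBU).2
  have hint : ∀ᵐ x ∂(volume.restrict A), IntegrableOn (fun s => G (φ s x)) (Ioc 0 t) := by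
    filter_upwards [hfin] with x hx
    exact ⟨(hGm.comp (hcx x).measurable).aestronglyMeasurable, hx⟩
  set err : EuclideanSpace ℝ (Fin N) → ℝ := fun x => v (φ t x) - v x -
    ∫ s in Ioc 0 t, inner ℝ (F (φ s x)) (G (φ s x)) with herr
  have herrm : Measurable err := by
    refine ((hvm.comp (h.continuous_right hF t).measurable).sub hvm).sub ?_
    have : Measurable fun p : EuclideanSpace ℝ (Fin N) × ℝ => (inner ℝ (F (φ p.2 p.1)) (G (φ p.2 p.1)) : ℝ) :=
      (hF.continuous.comp (hφc.comp continuous_swap)).measurable.inner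
        (hGm.comp (hφc.comp continuous_swap).measurable)
    exact this.stronglyMeasurable.integral_prod_right'.measurable
  -- For a smooth u the identity is the fundamental theorem of calculus. The defect of v is
  -- therefore bounded by u - v at both ends and by the difference of the gradients along the tube;
  -- volume distortion turns these into L¹ norms over B.
  have hbound : ∀ ε : ℝ≥0∞, 0 < ε → ∫⁻ x in A, ‖err x‖ₑ ≤
      (C + 1 + M * (ENNReal.ofReal t * C)) * ε := by
    intro ε hε
    obtain ⟨u, hus, -, huv, huG⟩ := hw.exists_approx hU hUb hv hG hB hBU hε
    have hugc : Continuous (gradient u) := by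
      exact (InnerProductSpace.toDual ℝ (EuclideanSpace ℝ (Fin N))).symm.continuous.comp (hus.continuous_fderiv (by simp))
    have hAB0 : A ⊆ B := fun x hx => by
      have := hAB 0 ⟨le_rfl, ht⟩ hx
      rwa [h.zero] at this
    have hpt : ∀ᵐ x ∂(volume.restrict A), ‖err x‖ₑ ≤ ‖u (φ t x) - v (φ t x)‖ₑ + ‖u x - v x‖ₑ +
        M * ∫⁻ s in Ioc 0 t, ‖gradient u (φ s x) - G (φ s x)‖ₑ := by
      filter_upwards [hint] with x hx
      have hFx : Continuous fun s => F (φ s x) := hF.continuous.comp (hcx x)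
      have hgx : Continuous fun s => gradient u (φ s x) := hugc.comp (hcx x)
      have hi1 : IntegrableOn (fun s => (inner ℝ (F (φ s x)) (gradient u (φ s x)) : ℝ)) (Ioc 0 t) :=
        ((hFx.inner hgx).integrableOn_Icc).mono_set Ioc_subset_Icc_self
      have hdiff : IntegrableOn (fun s => gradient u (φ s x) - G (φ s x)) (Ioc 0 t) :=
        ((hgx.integrableOn_Icc).mono_set Ioc_subset_Icc_self).sub hx
      have hi3 : IntegrableOn (fun s => (inner ℝ (F (φ s x)) (G (φ s x)) : ℝ)) (Ioc 0 t) := by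
        refine (hx.norm.const_mul (M : ℝ)).mono' (hFx.measurable.inner
          (hGm.comp (hcx x).measurable)).aestronglyMeasurable (Eventually.of_forall fun s => ?_)
        refine (norm_inner_le_norm _ _).trans ?_
        gcongr; exact hM _
      have hftc : u (φ t x) - u x = ∫ s in Ioc 0 t, inner ℝ (F (φ s x)) (gradient u (φ s x)) := by
        rw [← intervalIntegral.integral_of_le ht]
        have hd : ∀ s, HasDerivAt (fun s => u (φ s x)) (inner ℝ (F (φ s x)) (gradient u (φ s x))) s := by
          intro s
          have := (hus.differentiable (by simp) (φ s x)).hasFDerivAt.comp_hasDerivAt s (h.deriv x s)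
          rwa [← inner_gradient_left, real_inner_comm] at this
        rw [intervalIntegral.integral_eq_sub_of_hasDerivAt (fun s _ => hd s)
          ((hFx.inner hgx).intervalIntegrable _ _), h.zero]
      have herreq : err x = - (u (φ t x) - v (φ t x)) + (u x - v x) +
          ∫ s in Ioc 0 t, inner ℝ (F (φ s x)) (gradient u (φ s x) - G (φ s x)) := by
        simp_rw [inner_sub_right]
        rw [integral_sub hi1 hi3, ← hftc, herr]; ring
      rw [herreq]
      refine (enorm_add_le _ _).trans (add_le_add ((enorm_add_le _ _).trans (by rw [enorm_neg])) ?_)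
      refine (enorm_integral_le_lintegral_enorm _).trans ?_
      rw [← lintegral_const_mul' _ _ ENNReal.coe_ne_top]
      refine lintegral_mono fun s => ?_
      have h1 : ‖(inner ℝ (F (φ s x)) (gradient u (φ s x) - G (φ s x)) : ℝ)‖₊ ≤
          M * ‖gradient u (φ s x) - G (φ s x)‖₊ := by
        refine (nnnorm_inner_le_nnnorm _ _).trans ?_
        gcongr; exact hM _
      rw [enorm_eq_nnnorm, enorm_eq_nnnorm, ← ENNReal.coe_mul]
      exact ENNReal.coe_le_coe.2 h1
    have hm1 : Measurable fun x => ‖u x - v x‖ₑ := (hus.continuous.measurable.sub hvm).enorm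
    have hm2 : Measurable fun x => ‖gradient u x - G x‖ₑ := (hugc.measurable.sub hGm).enorm
    calc ∫⁻ x in A, ‖err x‖ₑ ≤ ∫⁻ x in A, (‖u (φ t x) - v (φ t x)‖ₑ + ‖u x - v x‖ₑ +
        M * ∫⁻ s in Ioc 0 t, ‖gradient u (φ s x) - G (φ s x)‖ₑ) := lintegral_mono_ae hpt
      _ = (∫⁻ x in A, ‖u (φ t x) - v (φ t x)‖ₑ) + (∫⁻ x in A, ‖u x - v x‖ₑ) +
          M * ∫⁻ x in A, ∫⁻ s in Ioc 0 t, ‖gradient u (φ s x) - G (φ s x)‖ₑ := by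
        have hm1' : Measurable fun x => ‖u (φ t x) - v (φ t x)‖ₑ :=
          hm1.comp (h.continuous_right hF t).measurable
        rw [lintegral_add_left (by exact hm1'.add hm1), lintegral_add_left hm1',
          lintegral_const_mul' _ _ ENNReal.coe_ne_top]
      _ ≤ C * ε + ε + M * (ENNReal.ofReal t * (C * ε)) := by
        gcongr
        · refine (h.setLIntegral_comp_le hF (abs_of_nonneg ht).le hm1 hB.measurableSet
            (hAB t ⟨ht, le_rfl⟩)).trans ?_
          gcongr
        · exact (lintegral_mono_set hAB0).trans huv
        · refine (h.setLIntegral_lintegral_comp_le hF hM hm2 hB.measurableSet hAB).trans ?_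
          gcongr
      _ = _ := by ring
  have hzero : ∫⁻ x in A, ‖err x‖ₑ = 0 := by
    set D := C + 1 + M * (ENNReal.ofReal t * C) with hD
    have hDtop : D ≠ ⊤ := by
      simp [hD, ENNReal.mul_eq_top, hCtop]
    refine le_antisymm (le_of_forall_pos_le_add fun ε hε => ?_) bot_le
    rw [zero_add]
    rcases eq_or_ne ε ⊤ with rfl | hεt
    · exact le_top
    have hD0 : D ≠ 0 := by simp [hD]
    refine (hbound (ε / D) (ENNReal.div_pos hε.ne' hDtop)).trans ?_
    rw [ENNReal.mul_div_cancel hD0 hDtop]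
  rw [lintegral_eq_zero_iff herrm.enorm] at hzero
  filter_upwards [hint, hzero] with x hx1 hx2
  refine ⟨hx1, ?_⟩
  have : err x = 0 := by simpa using hx2
  rw [herr] at this
  linarith

/-- The starting points whose trajectory stays in U up to time t form an open set, because [0, t] is
compact. Countably many compact sets exhaust it. -/
theorem ae_sub_eq_integral (h : IsFlow F φ) (hF : LipschitzWith K F)
    (hM : ∀ x, ‖F x‖ ≤ M) {U : Set (EuclideanSpace ℝ (Fin N))} (hU : IsOpen U) (hUb : Bornology.IsBounded U)
    {v : EuclideanSpace ℝ (Fin N) → ℝ} {G : EuclideanSpace ℝ (Fin N) → EuclideanSpace ℝ (Fin N)} (hvm : Measurable v) (hGm : Measurable G)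
    (hw : HasWeakGradient U v G) (hv : IntegrableOn v U) (hG : IntegrableOn G U)
    {t : ℝ} (ht : 0 ≤ t) :
    ∀ᵐ x, (∀ s ∈ Icc 0 t, φ s x ∈ U) → IntegrableOn (fun s => G (φ s x)) (Ioc 0 t) ∧
      v (φ t x) - v x = ∫ s in Ioc 0 t, inner ℝ (F (φ s x)) (G (φ s x)) := by
  set O : Set (EuclideanSpace ℝ (Fin N)) := {x | ∀ s ∈ Icc 0 t, φ s x ∈ U} with hO
  have hOo : IsOpen O := by
    have hc : IsClosed ((fun p : Icc 0 t × EuclideanSpace ℝ (Fin N) => φ p.1 p.2) ⁻¹' Uᶜ) :=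
      hU.isClosed_compl.preimage ((h.continuous_uncurry hF hM).comp
        (continuous_subtype_val.prodMap continuous_id))
    have := isClosedMap_snd_of_compactSpace _ hc
    rw [← isOpen_compl_iff] at this
    convert this using 1
    ext x
    simp [hO]
  obtain ⟨S, hS, hSO⟩ : ∃ S : ℕ → Set (EuclideanSpace ℝ (Fin N)), (∀ n, IsCompact (S n)) ∧ ⋃ n, S n = O := by
    have : SigmaCompactSpace O := by
      have := hOo.locallyCompactSpace
      infer_instance
    exact isSigmaCompact_iff_sigmaCompactSpace.2 this
  have key : ∀ n, ∀ᵐ x ∂(volume.restrict (S n)), IntegrableOn (fun s => G (φ s x)) (Ioc 0 t) ∧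
      v (φ t x) - v x = ∫ s in Ioc 0 t, inner ℝ (F (φ s x)) (G (φ s x)) := fun n =>
    h.ae_sub_eq_integral_of_isCompact hF hM hU hUb hvm hGm hw hv hG ht (hS n)
      fun s hs x hx => (hSO.subset (mem_iUnion_of_mem n hx) : x ∈ O) s hs
  have := (ae_restrict_iUnion_iff S _).2 key
  rw [hSO, ae_restrict_iff' hOo.measurableSet] at this
  exact this

end IsFlow
end

/-! ### Geometry of the boundary -/

section
variable {N : ℕ}

theorem fderiv_apply_of_gradient_eq {g : EuclideanSpace ℝ (Fin N) → ℝ}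
    {p n : EuclideanSpace ℝ (Fin N)} {c : ℝ} (h : gradient g p = c • n)
    (y : EuclideanSpace ℝ (Fin N)) : fderiv ℝ g p y = c * inner ℝ n y := by
  rw [← inner_gradient_left (𝕜 := ℝ), h, real_inner_smul_left]

/-- Uniform interior cone condition at a `C¹` boundary point. -/
theorem IsOutwardNormal.exists_cone {X : Set (EuclideanSpace ℝ (Fin N))}
    {p n : EuclideanSpace ℝ (Fin N)} (h : IsOutwardNormal X p n) :
    ∃ ρ : ℝ, 0 < ρ ∧ ∀ q ∈ X, dist q p < ρ → ∀ τ : ℝ, 0 < τ → τ < ρ →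
      ∀ y ∈ Metric.closedBall (-n) (1 / 4), q + τ • y ∈ interior X := by
  obtain ⟨hn, g, hg, hgp, ⟨c, hc, hgrad⟩, hside⟩ := h
  have hA := fderiv_apply_of_gradient_eq hgrad
  have hstrict := hg.hasStrictFDerivAt (by simp)
  have hlit := hstrict.isLittleO.def (c := c / 4) (by positivity)
  have hcont : ∀ᶠ x in 𝓝 p, ContinuousAt g x :=
    (hg.eventually (by simp)).mono fun x hx => hx.continuousAt
  have hside' := eventually_eventually_nhds.2 hside
  obtain ⟨r₁, hr₁, h₁⟩ := Metric.eventually_nhds_iff.1 ((hcont.and hside).and hside')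
  rw [nhds_prod_eq, eventually_prod_iff] at hlit
  obtain ⟨pa, hpa, pb, hpb, hlit⟩ := hlit
  obtain ⟨r₂, hr₂, h₂⟩ := Metric.eventually_nhds_iff.1 (hpa.and hpb)
  set r := min r₁ r₂ with hr
  have hr0 : 0 < r := lt_min hr₁ hr₂
  refine ⟨r / 4, by positivity, fun q hq hqp τ hτ hτr y hy => ?_⟩
  rw [Metric.mem_closedBall, dist_eq_norm, sub_neg_eq_add] at hy
  have hynorm : ‖y‖ ≤ 5 / 4 := by
    calc ‖y‖ = ‖(y + n) - n‖ := by simp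
      _ ≤ ‖y + n‖ + ‖n‖ := norm_sub_le _ _
      _ ≤ 5 / 4 := by rw [hn]; linarith
  have hinner : inner ℝ n y ≤ -(3 / 4) := by
    have h1 : inner ℝ n y = inner ℝ n (y + n) - 1 := by
      rw [inner_add_right, real_inner_self_eq_norm_sq, hn]; ring
    have h2 : inner ℝ n (y + n) ≤ ‖n‖ * ‖y + n‖ := real_inner_le_norm _ _
    rw [hn, one_mul] at h2
    linarith
  have hnτ : ‖τ • y‖ ≤ τ * (5 / 4) := by
    rw [norm_smul, Real.norm_of_nonneg hτ.le]; gcongr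
  have hxq : dist (q + τ • y) p < r := by
    calc dist (q + τ • y) p ≤ dist (q + τ • y) q + dist q p := dist_triangle _ _ _
      _ < r := by rw [dist_eq_norm, add_sub_cancel_left]; linarith
  have hqr : dist q p < r := by linarith
  have hgq : g q ≤ 0 := by
    by_contra! hcon
    exact (h₁ (hqr.trans_le (min_le_left _ _))).1.2.2 hcon hq
  have hl := hlit (h₂ (hxq.trans_le (min_le_right _ _))).1
    (h₂ (hqr.trans_le (min_le_right _ _))).2
  simp only [add_sub_cancel_left, hA] at hl
  have hgx : g (q + τ • y) < 0 := by
    rw [Real.norm_eq_abs, real_inner_smul_right] at hl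
    have h3 := (abs_le.1 hl).2
    have h4 : τ * (c * inner ℝ n y) ≤ τ * (c * -(3 / 4)) := by gcongr
    have h5 : c / 4 * ‖τ • y‖ ≤ c / 4 * (τ * (5 / 4)) := by gcongr
    have h6 : 0 < τ * c := by positivity
    nlinarith
  have h7 := h₁ (hxq.trans_le (min_le_left _ _))
  rw [mem_interior_iff_mem_nhds]
  filter_upwards [h7.1.1.eventually_lt continuousAt_const hgx, h7.2] with z hz1 hz2
  exact hz2.1 hz1

/-- A boundary point of X is the limit of interior points along the axis of its cone. -/
theorem HasC1Boundary.subset_closure_interior {X : Set (EuclideanSpace ℝ (Fin N))}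
    (hX : HasC1Boundary X) : X ⊆ closure (interior X) := by
  intro p hp
  by_cases hpi : p ∈ interior X
  · exact subset_closure hpi
  obtain ⟨n, hn⟩ := hX p ⟨subset_closure hp, hpi⟩
  obtain ⟨ρ, hρ, hcone⟩ := hn.exists_cone
  refine mem_closure_of_tendsto (f := fun τ : ℝ => p + τ • (-n)) (b := 𝓝[>] 0) ?_ ?_
  · have : Continuous fun τ : ℝ => p + τ • (-n) := by fun_prop
    have h := this.tendsto 0
    rw [zero_smul, add_zero] at h
    exact h.mono_left nhdsWithin_le_nhds
  · filter_upwards [Ioo_mem_nhdsGT hρ] with τ hτ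
    exact hcone p hp (by simpa using hρ) τ hτ.1 hτ.2 _ (Metric.mem_closedBall_self (by norm_num))

theorem frontier_diff_closedBall_subset {U : Set (EuclideanSpace ℝ (Fin N))} {δ : ℝ} (hδ : δ ≠ 0) :
    frontier (U \ Metric.closedBall 0 δ) ⊆ frontier U ∪ Metric.sphere 0 δ := by
  intro x hx
  rw [sdiff_eq] at hx
  rcases frontier_inter_subset _ _ hx with h | h
  · exact Or.inl h.1
  · rw [frontier_compl, frontier_closedBall _ hδ] at h
    exact Or.inr h.2

theorem frontier_subset_frontier_diff {U B : Set (EuclideanSpace ℝ (Fin N))} (hU : IsOpen U)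
    (hB : IsClosed B) (hBU : B ⊆ U) : frontier U ⊆ frontier (U \ B) := by
  intro x hx
  rw [hU.frontier_eq] at hx
  rw [(hU.sdiff hB).frontier_eq]
  refine ⟨?_, fun h => hx.2 h.1⟩
  have hxB : x ∈ Bᶜ := fun h => hx.2 (hBU h)
  have := hB.isOpen_compl.inter_closure (t := U) ⟨hxB, hx.1⟩
  rwa [inter_comm, ← sdiff_eq] at this

/-- A half-space test for the normal at a point of the boundary of a ball which is removed. -/
theorem inner_neg_of_isOutwardNormal_diff_closedBall {U : Set (EuclideanSpace ℝ (Fin N))} {δ : ℝ}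
    (hδ : 0 < δ) {p n w : EuclideanSpace ℝ (Fin N)} (hp : p ∈ Metric.sphere 0 δ)
    (hn : IsOutwardNormal (U \ Metric.closedBall 0 δ) p n) (hw : 0 < inner ℝ w n) :
    inner ℝ w p < 0 := by
  obtain ⟨hn1, g, hg, hgp, ⟨c, hc, hgrad⟩, hside⟩ := hn
  have hA := fderiv_apply_of_gradient_eq hgrad
  have hpn : ‖p‖ = δ := by simpa using hp
  -- A direction with ⟨n, u⟩ < 0 enters the domain, hence leaves the ball: ‖p + tu‖ > δ for small t
  -- > 0. To first order this says ⟨p, u⟩ ≥ 0.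
  have claim : ∀ u : EuclideanSpace ℝ (Fin N), inner ℝ n u < 0 → 0 ≤ inner ℝ p u := by
    intro u hu
    have hline : HasDerivAt (fun t : ℝ => p + t • u) u 0 := by
      simpa using ((hasDerivAt_id (0 : ℝ)).smul_const u).const_add p
    have hgd : HasFDerivAt g (fderiv ℝ g p) (p + (0 : ℝ) • u) := by
      simpa using (hg.differentiableAt (by simp)).hasFDerivAt
    have hd : HasDerivAt (fun t : ℝ => g (p + t • u)) (c * inner ℝ n u) 0 := by
      have := hgd.comp_hasDerivAt (0 : ℝ) hline
      rwa [hA] at this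
    have hneg : ∀ᶠ t in 𝓝[>] (0 : ℝ), g (p + t • u) < 0 := by
      have h1 := hd.hasDerivWithinAt (s := Ioi 0)
      have h2 := hasDerivWithinAt_iff_tendsto_slope.1 h1
      have h3 : ∀ᶠ t in 𝓝[Ioi 0 \ {0}] (0 : ℝ), slope (fun t : ℝ => g (p + t • u)) 0 t < 0 :=
        h2.eventually (gt_mem_nhds (mul_neg_of_pos_of_neg hc hu))
      rw [sdiff_singleton_eq_self (by simp)] at h3
      filter_upwards [h3, self_mem_nhdsWithin] with t ht ht0
      rw [slope_def_field] at ht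
      simp only [zero_smul, add_zero, hgp, sub_zero] at ht
      by_contra! hcon
      exact absurd ht (not_lt.2 (div_nonneg hcon (le_of_lt ht0)))
    have hin : ∀ᶠ t in 𝓝[>] (0 : ℝ), 0 ≤ 2 * inner ℝ p u + t * ‖u‖ ^ 2 := by
      have h1 : Tendsto (fun t : ℝ => p + t • u) (𝓝[>] 0) (𝓝 p) := by
        have := hline.continuousAt.tendsto
        rw [zero_smul, add_zero] at this
        exact this.mono_left nhdsWithin_le_nhds
      filter_upwards [hneg, h1.eventually hside, self_mem_nhdsWithin] with t ht1 ht2 ht0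
      have h3 := (ht2.1 ht1).2
      have ht0' : 0 < t := ht0
      rw [mem_closedBall_zero_iff, not_le] at h3
      have h4 : δ ^ 2 < ‖p + t • u‖ ^ 2 := by gcongr
      rw [norm_add_sq_real, hpn, real_inner_smul_right, norm_smul, Real.norm_of_nonneg ht0'.le] at h4
      by_contra! hcon
      nlinarith [mul_neg_of_pos_of_neg ht0' hcon]
    have hlim : Tendsto (fun t : ℝ => 2 * inner ℝ p u + t * ‖u‖ ^ 2) (𝓝[>] 0) (𝓝 (2 * inner ℝ p u)) := by
      have : Continuous fun t : ℝ => 2 * inner ℝ p u + t * ‖u‖ ^ 2 := by fun_prop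
      have h := this.tendsto 0
      rw [zero_mul, add_zero] at h
      exact h.mono_left nhdsWithin_le_nhds
    have := ge_of_tendsto hlim hin
    linarith
  -- Split p = a n + q with q orthogonal to n. The directions -n - kq, with k any real number, are
  -- admissible in `claim`; this forces q = 0 and a ≤ 0, so n is the inward radial direction.
  set a : ℝ := inner ℝ p n with ha
  set q := p - a • n with hq
  have hqn : inner ℝ n q = 0 := by
    rw [hq, inner_sub_right, real_inner_smul_right, real_inner_self_eq_norm_sq, hn1,
      real_inner_comm, ← ha]; ring
  have hpq : inner ℝ p q = ‖q‖ ^ 2 := by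
    have : p = q + a • n := by rw [hq]; abel
    rw [this, inner_add_left, real_inner_smul_left, hqn, real_inner_self_eq_norm_sq]; ring
  have hk : ∀ k : ℝ, 0 ≤ - a - k * ‖q‖ ^ 2 := by
    intro k
    have := claim (-n - k • q) (by
      rw [inner_sub_right, inner_neg_right, real_inner_smul_right, hqn,
        real_inner_self_eq_norm_sq, hn1]; norm_num)
    rwa [inner_sub_right, inner_neg_right, real_inner_smul_right, hpq, ← ha] at this
  have hq0 : q = 0 := by
    by_contra hne
    have hpos : 0 < ‖q‖ ^ 2 := by positivity
    have := hk ((-a + 1) / ‖q‖ ^ 2)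
    rw [div_mul_cancel₀ _ hpos.ne'] at this
    linarith
  have hpan : p = a • n := by rw [← sub_eq_zero]; exact hq0
  have ha0 : a ≤ 0 := by have := hk 0; linarith
  have hane : a ≠ 0 := by
    intro h0
    rw [h0, zero_smul] at hpan
    rw [hpan, norm_zero] at hpn
    exact hδ.ne hpn
  rw [hpan, real_inner_smul_right]
  exact mul_neg_of_neg_of_pos (lt_of_le_of_ne ha0 hane) hw

/-- If f·n > 0 at p, the trajectory from p enters {g > 0} at once. Near such points there is no
interior point of X, whereas the trajectory stays in X, which lies in the closure of its interior.
-/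
theorem notMem_outflowBoundary_of_mem_frontier {X : Set (EuclideanSpace ℝ (Fin N))}
    (hXc : IsClosed X) (hX : HasC1Boundary X)
    {f : EuclideanSpace ℝ (Fin N) → EuclideanSpace ℝ (Fin N)}
    (hflow : ∀ x ∈ X, ∃ γ, IsTrajectory f X γ ∧ γ 0 = x) {δ : ℝ}
    (hδX : Metric.closedBall 0 δ ⊆ interior X) {p : EuclideanSpace ℝ (Fin N)}
    (hp : p ∈ frontier (interior X)) : p ∉ outflowBoundary f (interior X \ Metric.closedBall 0 δ) := by
  rintro ⟨-, n, ⟨hn1, g, hg, hgp, ⟨c, hc, hgrad⟩, hside⟩, hfn⟩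
  have hA := fderiv_apply_of_gradient_eq hgrad
  rw [isOpen_interior.frontier_eq] at hp
  have hpX : p ∈ X := by
    have := closure_mono interior_subset hp.1
    rwa [hXc.closure_eq] at this
  obtain ⟨γ, hγ, hγ0⟩ := hflow p hpX
  have h0 := (hγ 0 le_rfl).2
  have hgd : HasFDerivAt g (fderiv ℝ g p) (γ 0) := by
    rw [hγ0]; exact (hg.differentiableAt (by simp)).hasFDerivAt
  have hd : HasDerivWithinAt (fun t => g (γ t)) (c * inner ℝ n (f p)) (Ici 0) 0 := by
    have := hgd.comp_hasDerivWithinAt (0 : ℝ) h0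
    rwa [hA, hγ0] at this
  have hpos : ∀ᶠ t in 𝓝[>] (0 : ℝ), 0 < g (γ t) := by
    have h2 := hasDerivWithinAt_iff_tendsto_slope.1 (hd.mono Ioi_subset_Ici_self)
    rw [sdiff_singleton_eq_self (by simp)] at h2
    have h3 := h2.eventually (lt_mem_nhds (mul_pos hc (by rwa [real_inner_comm])))
    filter_upwards [h3, self_mem_nhdsWithin] with t ht ht0
    rw [slope_def_field, hγ0, hgp, sub_zero, sub_zero] at ht
    by_contra! hcon
    exact absurd ht (not_lt.2 (div_nonpos_of_nonpos_of_nonneg hcon (le_of_lt ht0)))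
  have hγt : Tendsto γ (𝓝[>] 0) (𝓝 p) := by
    have := h0.continuousWithinAt.tendsto
    rw [hγ0] at this
    exact this.mono_left (nhdsWithin_mono _ Ioi_subset_Ici_self)
  have hB : ∀ᶠ x in 𝓝 p, x ∈ (Metric.closedBall (0 : EuclideanSpace ℝ (Fin N)) δ)ᶜ :=
    Metric.isClosed_closedBall.isOpen_compl.mem_nhds fun h => hp.2 (hδX h)
  have hcont : ∀ᶠ x in 𝓝 p, ContinuousAt g x :=
    (hg.eventually (by simp)).mono fun x hx => hx.continuousAt
  have hev := hcont.and (eventually_eventually_nhds.2 (hside.and hB))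
  obtain ⟨t, ht1, ⟨ht2, ht3⟩, ht0⟩ := (hpos.and ((hγt.eventually hev).and self_mem_nhdsWithin)).exists
  have hcl := hX.subset_closure_interior (hγ t (le_of_lt ht0)).1
  have hnhds : ∀ᶠ x in 𝓝 (γ t), x ∉ interior X := by
    filter_upwards [continuousAt_const.eventually_lt ht2 ht1, ht3] with x hx1 hx2 hx3
    exact hx2.1.2 hx1 ⟨hx3, hx2.2⟩
  obtain ⟨x, hx1, hx2⟩ := mem_closure_iff_nhds.1 hcl _ hnhds
  exact hx1 hx2

/-- In polar coordinates the exterior is the image of the unit sphere times (δ, ∞), and the sphere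
is connected when N ≥ 2. -/
theorem isPreconnected_compl_closedBall (hN : 2 ≤ N) {δ : ℝ} (hδ : 0 ≤ δ) :
    IsPreconnected (Metric.closedBall (0 : EuclideanSpace ℝ (Fin N)) δ)ᶜ := by
  have hrank : 1 < Module.rank ℝ (EuclideanSpace ℝ (Fin N)) := by
    rw [← Module.finrank_eq_rank, finrank_euclideanSpace_fin]
    exact_mod_cast hN
  have h1 := (isPreconnected_sphere hrank (0 : EuclideanSpace ℝ (Fin N)) 1).prod
    (isPreconnected_Ioi (a := δ))
  have h2 := h1.image (fun p : EuclideanSpace ℝ (Fin N) × ℝ => p.2 • p.1) (by fun_prop)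
  convert h2 using 1
  ext x
  simp only [mem_compl_iff, mem_closedBall_zero_iff, not_le, mem_image, mem_prod,
    mem_sphere_zero_iff_norm, mem_Ioi, Prod.exists]
  constructor
  · intro hx
    have hx0 : 0 < ‖x‖ := hδ.trans_lt hx
    refine ⟨‖x‖⁻¹ • x, ‖x‖, ⟨?_, hx⟩, ?_⟩
    · rw [norm_smul, norm_inv, norm_norm, inv_mul_cancel₀ hx0.ne']
    · rw [smul_inv_smul₀ hx0.ne']
  · rintro ⟨a, b, ⟨ha, hb⟩, rfl⟩
    rw [norm_smul, ha, mul_one]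
    exact hb.trans_le (le_abs_self b)

/-- A bounded open set whose boundary lies in a ball is contained in that ball. -/
theorem subset_closedBall_of_frontier_subset (hN : 2 ≤ N) {δ : ℝ} (hδ : 0 ≤ δ)
    {O : Set (EuclideanSpace ℝ (Fin N))} (hO : IsOpen O) (hOb : Bornology.IsBounded O)
    (hfr : frontier O ⊆ Metric.closedBall 0 δ) : O ⊆ Metric.closedBall 0 δ := by
  by_contra hcon
  obtain ⟨q, hqO, hq⟩ := not_subset.1 hcon
  -- The connected exterior of the ball avoids the boundary of O; as it meets O, it lies in O, which
  -- is then unbounded.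
  have hsub : (Metric.closedBall (0 : EuclideanSpace ℝ (Fin N)) δ)ᶜ ⊆ O := by
    refine (isPreconnected_compl_closedBall hN hδ).subset_left_of_subset_union hO
      (v := (closure O)ᶜ) isClosed_closure.isOpen_compl
      (disjoint_compl_right.mono_left subset_closure) (fun x hx => ?_) ⟨q, hq, hqO⟩
    by_contra hx2
    simp only [mem_union, mem_compl_iff, not_or, not_not] at hx2
    exact hx (hfr (by rw [hO.frontier_eq]; exact ⟨hx2.2, hx2.1⟩))
  obtain ⟨R, hR⟩ := hOb.subset_closedBall 0
  have : Nontrivial (EuclideanSpace ℝ (Fin N)) := by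
    have : Nonempty (Fin N) := ⟨⟨0, by omega⟩⟩
    infer_instance
  obtain ⟨x, hx⟩ := NormedSpace.exists_lt_norm ℝ (EuclideanSpace ℝ (Fin N)) (max R δ)
  have h1 : x ∈ O := hsub (by simpa using (le_max_right _ _).trans_lt hx)
  have h2 := hR h1
  rw [mem_closedBall_zero_iff] at h2
  exact absurd h2 (not_le.2 ((le_max_left _ _).trans_lt hx))
end

/-! ### Invariance and attraction -/

/-- The global flow `φ` of the bounded Lipschitz vector field `F` leaves the compact set `X`
forward invariant. -/
structure IsInvariantFlow {N : ℕ} (X : Set (EuclideanSpace ℝ (Fin N)))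
    (F : EuclideanSpace ℝ (Fin N) → EuclideanSpace ℝ (Fin N))
    (φ : ℝ → EuclideanSpace ℝ (Fin N) → EuclideanSpace ℝ (Fin N)) (K M : ℝ≥0) : Prop where
  isCompact : IsCompact X
  isFlow : IsFlow F φ
  lipschitz : LipschitzWith K F
  bound : ∀ x, ‖F x‖ ≤ M
  mapsTo : ∀ t, 0 ≤ t → MapsTo (φ t) X X

/-- The points of `X` that are not attracted to `0`. -/
def nonattracted {N : ℕ} (X : Set (EuclideanSpace ℝ (Fin N)))
    (φ : ℝ → EuclideanSpace ℝ (Fin N) → EuclideanSpace ℝ (Fin N)) :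
    Set (EuclideanSpace ℝ (Fin N)) :=
  {x | x ∈ X ∧ ¬ Tendsto (fun t => φ t x) atTop (𝓝 0)}

section
variable {N : ℕ} {X : Set (EuclideanSpace ℝ (Fin N))}
  {f F : EuclideanSpace ℝ (Fin N) → EuclideanSpace ℝ (Fin N)}
  {φ : ℝ → EuclideanSpace ℝ (Fin N) → EuclideanSpace ℝ (Fin N)} {K M : ℝ≥0}

/-- The given trajectories in X solve the equation for the extension F too, so by uniqueness its
flow follows them and stays in X. -/
theorem exists_isInvariantFlow (hXc : IsCompact X) {L : ℝ≥0} (hf : LipschitzOnWith L f X)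
    (hflow : ∀ x ∈ X, ∃ γ, IsTrajectory f X γ ∧ γ 0 = x) :
    ∃ F φ K M, IsInvariantFlow X F φ K M ∧ EqOn F f X := by
  obtain ⟨F, K, M, hF, hM, hFf⟩ := exists_bounded_lipschitz_extension hXc hf
  obtain ⟨φ, hφ⟩ := exists_isFlow hF hM
  refine ⟨F, φ, K, M, ⟨hXc, hφ, hF, hM, fun t ht x hx => ?_⟩, hFf⟩
  obtain ⟨γ, hγ, hγ0⟩ := hflow x hx
  have := hφ.eq_of_isIntegralCurve hF hγ0 (fun s hs => by rw [hFf (hγ s hs).1]; exact (hγ s hs).2) ht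
  rw [← this]
  exact (hγ t ht).1

namespace IsInvariantFlow

theorem isTrajectory (h : IsInvariantFlow X F φ K M) (hFf : EqOn F f X)
    {x : EuclideanSpace ℝ (Fin N)} (hx : x ∈ X) : IsTrajectory f X fun t => φ t x := by
  refine fun t ht => ⟨h.mapsTo t ht hx, ?_⟩
  rw [← hFf (h.mapsTo t ht hx)]
  exact (h.isFlow.deriv x t).hasDerivWithinAt

theorem eq_of_isTrajectory (h : IsInvariantFlow X F φ K M) (hFf : EqOn F f X)
    {γ : ℝ → EuclideanSpace ℝ (Fin N)} (hγ : IsTrajectory f X γ) {t : ℝ} (ht : 0 ≤ t) :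
    γ t = φ t (γ 0) :=
  h.isFlow.eq_of_isIntegralCurve h.lipschitz rfl
    (fun s hs => by rw [hFf (hγ s hs).1]; exact (hγ s hs).2) ht

theorem attracts_iff (h : IsInvariantFlow X F φ K M) (hFf : EqOn F f X)
    {S : Set (EuclideanSpace ℝ (Fin N))} :
    Attracts f X S ↔ ∀ x ∈ X, x ∈ S → Tendsto (fun t => φ t x) atTop (𝓝 0) := by
  constructor
  · intro hA x hx hxS
    exact hA _ (h.isTrajectory hFf hx) (by rwa [h.isFlow.zero])
  · intro hA γ hγ hγS
    refine (hA _ (hγ 0 le_rfl).1 hγS).congr' ?_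
    filter_upwards [eventually_ge_atTop 0] with t ht
    exact (h.eq_of_isTrajectory hFf hγ ht).symm

theorem stable (h : IsInvariantFlow X F φ K M) (hFf : EqOn F f X) (hs : LyapunovStable f X)
    {ε : ℝ} (hε : 0 < ε) : ∃ r, 0 < r ∧ ∀ x ∈ X, ‖x‖ < r → ∀ t, 0 ≤ t → ‖φ t x‖ < ε := by
  obtain ⟨r, hr, hr'⟩ := hs ε hε
  exact ⟨r, hr, fun x hx hxr t ht => hr' _ (h.isTrajectory hFf hx) (by rwa [h.isFlow.zero]) t ht⟩

/-- φ_t is a homeomorphism, so it maps the interior to an open subset of X. -/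
theorem mapsTo_interior (h : IsInvariantFlow X F φ K M) {t : ℝ} (ht : 0 ≤ t) :
    MapsTo (φ t) (interior X) (interior X) := by
  intro x hx
  have hopen : IsOpen (φ t '' interior X) :=
    (h.isFlow.homeomorph h.lipschitz t).isOpenMap _ isOpen_interior
  exact interior_maximal ((image_mono interior_subset).trans (h.mapsTo t ht).image_subset) hopen
    (mem_image_of_mem _ hx)

theorem isOpen_setOf_norm_lt (h : IsInvariantFlow X F φ K M) (t r : ℝ) :
    IsOpen {x | ‖φ t x‖ < r} :=
  isOpen_lt (h.isFlow.continuous_right h.lipschitz t).norm continuous_const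

/-- A compact set of attracted points is attracted uniformly. -/
theorem exists_uniform_time (h : IsInvariantFlow X F φ K M) (hFf : EqOn F f X)
    (hs : LyapunovStable f X) {C : Set (EuclideanSpace ℝ (Fin N))} (hC : IsCompact C) (hCX : C ⊆ X)
    (hat : ∀ x ∈ C, Tendsto (fun t => φ t x) atTop (𝓝 0)) {ε : ℝ} (hε : 0 < ε) :
    ∃ T, 0 ≤ T ∧ ∀ x ∈ C, ∀ t, T ≤ t → ‖φ t x‖ < ε := by
  obtain ⟨r, hr, hr'⟩ := h.stable hFf hs hε
  have hev : ∀ x ∈ C, ∃ n : ℕ, ‖φ n x‖ < r := by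
    intro x hx
    have h1 := ((hat x hx).norm).eventually (gt_mem_nhds (by rwa [norm_zero] : ‖(0 : EuclideanSpace ℝ (Fin N))‖ < r))
    exact (tendsto_natCast_atTop_atTop.eventually h1).exists
  -- Stability keeps a trajectory in the ε-ball once it has entered the r-ball, so the largest of
  -- finitely many entrance times serves all points.
  obtain ⟨s, hs⟩ := hC.elim_finite_subcover (fun n : ℕ => {x | ‖φ n x‖ < r})
    (fun n => h.isOpen_setOf_norm_lt n r) (fun x hx => mem_iUnion.2 (hev x hx))
  refine ⟨((s.sup id : ℕ) : ℝ), by positivity, fun x hx t ht => ?_⟩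
  obtain ⟨n, hn, hxn⟩ := mem_iUnion₂.1 (hs hx)
  have hnt : (n : ℝ) ≤ t := le_trans (by exact_mod_cast Finset.le_sup (f := id) hn) ht
  have := hr' _ (h.mapsTo n (by positivity) (hCX hx)) hxn (t - n) (by linarith)
  rwa [← h.isFlow.add h.lipschitz, sub_add_cancel] at this

theorem tendsto_iff (h : IsInvariantFlow X F φ K M) (s : ℝ) (x : EuclideanSpace ℝ (Fin N)) :
    Tendsto (fun t => φ t (φ s x)) atTop (𝓝 0) ↔ Tendsto (fun t => φ t x) atTop (𝓝 0) := by
  simp_rw [← h.isFlow.add h.lipschitz]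
  constructor
  · intro h1
    simpa [Function.comp_def] using h1.comp (tendsto_atTop_add_const_right atTop (-s) tendsto_id)
  · intro h1
    exact h1.comp (tendsto_atTop_add_const_right atTop s tendsto_id)

theorem mapsTo_nonattracted (h : IsInvariantFlow X F φ K M) {t : ℝ} (ht : 0 ≤ t) :
    MapsTo (φ t) (nonattracted X φ) (nonattracted X φ) :=
  fun x hx => ⟨h.mapsTo t ht hx.1, fun hcon => hx.2 ((h.tendsto_iff t x).1 hcon)⟩

/-- A point of X is attracted exactly if it is in the open δ-ball at some integer time, which is an
open condition. Compactness later gives a gap between these points and the ball. -/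
theorem isCompact_nonattracted (h : IsInvariantFlow X F φ K M) {δ : ℝ} (hδ : 0 < δ)
    (hat : ∀ x ∈ X, x ∈ Metric.closedBall 0 δ → Tendsto (fun t => φ t x) atTop (𝓝 0)) :
    IsCompact (nonattracted X φ) := by
  have : nonattracted X φ = X ∩ (⋃ n : ℕ, {x | ‖φ n x‖ < δ})ᶜ := by
    ext x
    constructor
    · rintro ⟨hx, hxn⟩
      refine ⟨hx, fun hcon => ?_⟩
      obtain ⟨n, hn⟩ := mem_iUnion.1 hcon
      have h1 := hat _ (h.mapsTo n (by positivity) hx) (by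
        rw [mem_closedBall_zero_iff]; exact le_of_lt hn)
      exact hxn ((h.tendsto_iff _ x).1 h1)
    · rintro ⟨hx, hxn⟩
      refine ⟨hx, fun hcon => hxn ?_⟩
      have h1 := (hcon.norm).eventually (gt_mem_nhds (by rwa [norm_zero] : ‖(0 : EuclideanSpace ℝ (Fin N))‖ < δ))
      exact mem_iUnion.2 (tendsto_natCast_atTop_atTop.eventually h1).exists
  rw [this]
  exact h.isCompact.inter_right (isOpen_iUnion fun n : ℕ => h.isOpen_setOf_norm_lt n δ).isClosed_compl

/-- If some point is not attracted, then some boundary point is not attracted. -/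
theorem nonattracted_inter_frontier_nonempty (h : IsInvariantFlow X F φ K M) (hFf : EqOn F f X)
    (hN : 2 ≤ N) (hs : LyapunovStable f X) {δ : ℝ} (hδ : 0 < δ)
    (hat : ∀ x ∈ X, x ∈ Metric.closedBall 0 δ → Tendsto (fun t => φ t x) atTop (𝓝 0))
    (hne : (nonattracted X φ).Nonempty) : (nonattracted X φ ∩ frontier X).Nonempty := by
  by_contra hcon
  rw [not_nonempty_iff_eq_empty] at hcon
  have hfrX : frontier X ⊆ X := h.isCompact.isClosed.frontier_subset
  have hfr : ∀ x ∈ frontier X, Tendsto (fun t => φ t x) atTop (𝓝 0) := by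
    intro x hx
    by_contra hx2
    exact (hcon.subset ⟨⟨hfrX hx, hx2⟩, hx⟩ : x ∈ (∅ : Set _))
  obtain ⟨T, hT, hT'⟩ := h.exists_uniform_time hFf hs
    (h.isCompact.of_isClosed_subset isClosed_frontier hfrX) hfrX hfr hδ
  -- The image of the interior under the time-T homeomorphism is bounded and open, with its boundary
  -- in the ball; hence it is in the ball and all its points are attracted.
  set e := h.isFlow.homeomorph h.lipschitz T
  have hO : IsOpen (e '' interior X) := e.isOpenMap _ isOpen_interior
  have hOX : e '' interior X ⊆ X := (image_mono interior_subset).trans (h.mapsTo T hT).image_subset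
  have hsub := subset_closedBall_of_frontier_subset hN hδ.le hO (h.isCompact.isBounded.subset hOX) (by
    rw [← e.image_frontier]
    rintro _ ⟨x, hx, rfl⟩
    rw [mem_closedBall_zero_iff]
    exact (hT' x (frontier_interior_subset hx) T le_rfl).le)
  obtain ⟨q, hq⟩ := hne
  have hqi : q ∈ interior X := by
    by_contra hqi
    exact (hcon.subset ⟨hq, ⟨subset_closure hq.1, hqi⟩⟩ : q ∈ (∅ : Set _))
  have h1 := h.mapsTo_nonattracted hT hq
  exact h1.2 (hat _ h1.1 (hsub (mem_image_of_mem e hqi)))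

/-- A ball on whose boundary the vector field points inwards is forward invariant. -/
theorem _root_.IsFlow.norm_le_of_inner_neg (h : IsFlow F φ) {δ : ℝ}
    (hin : ∀ p ∈ Metric.sphere 0 δ, inner ℝ (F p) p < 0) {x : EuclideanSpace ℝ (Fin N)}
    (hx : ‖x‖ ≤ δ) {t : ℝ} (ht : 0 ≤ t) : ‖φ t x‖ ≤ δ := by
  have hδ : 0 ≤ δ := (norm_nonneg x).trans hx
  have hd : ∀ s, HasDerivAt (fun s => ‖φ s x‖ ^ 2) (2 * inner ℝ (φ s x) (F (φ s x))) s :=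
    fun s => (h.deriv x s).norm_sq
  -- A strict barrier argument: the sign of the derivative of ‖φ s x‖² matters only at times when
  -- its value is δ².
  have := image_le_of_deriv_right_lt_deriv_boundary' (f := fun s => ‖φ s x‖ ^ 2)
    (f' := fun s => 2 * inner ℝ (φ s x) (F (φ s x))) (a := 0) (b := t) (B := fun _ => δ ^ 2)
    (B' := fun _ => 0)
    (fun s _ => (hd s).continuousAt.continuousWithinAt) (fun s _ => (hd s).hasDerivWithinAt)
    (by rw [h.zero]; gcongr) continuousOn_const (fun s _ => hasDerivWithinAt_const _ _ _)
    (fun s _ hs => by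
      have h1 : ‖φ s x‖ = δ := by
        rwa [sq_eq_sq₀ (norm_nonneg _) hδ] at hs
      have h2 := hin (φ s x) (by simpa using h1)
      rw [real_inner_comm]
      linarith) (right_mem_Icc.2 ht)
  exact (sq_le_sq₀ (norm_nonneg _) hδ).1 this

end IsInvariantFlow
end

/-! ### Weak gradients, zero traces and extension by zero -/

section
variable {N : ℕ}

/-- Cutting off a test function whose support does not meet the boundary of `U`. -/
theorem contDiff_indicator_of_tsupport_disjoint {U : Set (EuclideanSpace ℝ (Fin N))} (hU : IsOpen U)
    {φ : EuclideanSpace ℝ (Fin N) → ℝ} (hφ : ContDiff ℝ ∞ φ) (hφc : HasCompactSupport φ)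
    (hd : Disjoint (tsupport φ) (frontier U)) :
    ContDiff ℝ ∞ (U.indicator φ) ∧ HasCompactSupport (U.indicator φ) ∧
      tsupport (U.indicator φ) ⊆ U := by
  have hcl : tsupport φ ∩ closure U ⊆ U := by
    rintro x ⟨hx1, hx2⟩
    by_contra hx
    exact disjoint_left.1 hd hx1 (by rw [hU.frontier_eq]; exact ⟨hx2, hx⟩)
  have hts : tsupport (U.indicator φ) ⊆ tsupport φ ∩ closure U := by
    refine closure_minimal (fun x hx => ?_) ((isClosed_tsupport φ).inter isClosed_closure)
    rw [support_indicator] at hx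
    exact ⟨subset_closure hx.2, subset_closure hx.1⟩
  refine ⟨contDiff_iff_contDiffAt.2 fun x => ?_, ?_, hts.trans hcl⟩
  · by_cases hx : x ∈ U
    · refine hφ.contDiffAt.congr_of_eventuallyEq ?_
      filter_upwards [hU.mem_nhds hx] with y hy using indicator_of_mem hy φ
    · have hx2 : x ∉ tsupport (U.indicator φ) := fun h => hx (hcl (hts h))
      rw [notMem_tsupport_iff_eventuallyEq] at hx2
      exact contDiffAt_const.congr_of_eventuallyEq hx2
  · exact HasCompactSupport.of_support_subset_isCompact hφc.isCompact
      ((subset_closure.trans hts).trans inter_subset_left)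

theorem fderiv_indicator_of_mem {U : Set (EuclideanSpace ℝ (Fin N))} (hU : IsOpen U)
    {φ : EuclideanSpace ℝ (Fin N) → ℝ} {x : EuclideanSpace ℝ (Fin N)} (hx : x ∈ U) :
    fderiv ℝ (U.indicator φ) x = fderiv ℝ φ x := by
  refine Filter.EventuallyEq.fderiv_eq ?_
  filter_upwards [hU.mem_nhds hx] with y hy using indicator_of_mem hy φ

theorem HasZeroTraceOn.hasWeakGradient {D Γ : Set (EuclideanSpace ℝ (Fin N))} (hD : IsOpen D)
    {v : EuclideanSpace ℝ (Fin N) → ℝ} {G : EuclideanSpace ℝ (Fin N) → EuclideanSpace ℝ (Fin N)}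
    (h : HasZeroTraceOn D Γ v G) : HasWeakGradient D v G := by
  intro φ hφ hφc hφD
  refine h φ hφ hφc ?_
  rintro x ⟨hx1, hx2⟩
  rw [hD.frontier_eq] at hx2
  exact absurd (hφD hx1) hx2.2

theorem integratesByParts_indicator {U D : Set (EuclideanSpace ℝ (Fin N))} (hD : MeasurableSet D)
    (hDU : D ⊆ U) {v φ : EuclideanSpace ℝ (Fin N) → ℝ}
    {G : EuclideanSpace ℝ (Fin N) → EuclideanSpace ℝ (Fin N)} :
    IntegratesByParts U (D.indicator v) (D.indicator G) φ ↔ IntegratesByParts D v G φ := by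
  refine forall_congr' fun i => ?_
  have hUD : U ∩ D = D := inter_eq_self_of_subset_right hDU
  have h1 : ∫ x in U, D.indicator v x * fderiv ℝ φ x (EuclideanSpace.single i 1) =
      ∫ x in D, v x * fderiv ℝ φ x (EuclideanSpace.single i 1) := by
    nth_rw 2 [← hUD]
    rw [← setIntegral_indicator hD]
    congr 1; ext x
    by_cases hx : x ∈ D <;> simp [hx]
  have h2 : ∫ x in U, D.indicator G x i * φ x = ∫ x in D, G x i * φ x := by
    nth_rw 2 [← hUD]
    rw [← setIntegral_indicator hD]
    congr 1; ext x
    by_cases hx : x ∈ D <;> simp [hx]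
  rw [h1, h2]

theorem IntegratesByParts.congr_ae {D : Set (EuclideanSpace ℝ (Fin N))}
    {v w φ : EuclideanSpace ℝ (Fin N) → ℝ}
    {G H : EuclideanSpace ℝ (Fin N) → EuclideanSpace ℝ (Fin N)}
    (hvw : v =ᵐ[volume.restrict D] w) (hGH : G =ᵐ[volume.restrict D] H)
    (h : IntegratesByParts D v G φ) : IntegratesByParts D w H φ := by
  intro i
  have h1 : ∫ x in D, w x * fderiv ℝ φ x (EuclideanSpace.single i 1) =
      ∫ x in D, v x * fderiv ℝ φ x (EuclideanSpace.single i 1) := by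
    refine integral_congr_ae ?_
    filter_upwards [hvw] with x hx
    rw [hx]
  have h2 : ∫ x in D, H x i * φ x = ∫ x in D, G x i * φ x := by
    refine integral_congr_ae ?_
    filter_upwards [hGH] with x hx
    rw [hx]
  rw [h1, h2]
  exact h i

/-- A function whose trace on the sphere vanishes extends by zero into the ball. -/
theorem HasZeroTraceOn.hasWeakGradient_indicator {U Γ : Set (EuclideanSpace ℝ (Fin N))}
    (hU : IsOpen U) {δ : ℝ} (hδ : 0 < δ) (hΓ : Metric.sphere 0 δ ⊆ Γ)
    {v : EuclideanSpace ℝ (Fin N) → ℝ} {G : EuclideanSpace ℝ (Fin N) → EuclideanSpace ℝ (Fin N)}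
    (h : HasZeroTraceOn (U \ Metric.closedBall 0 δ) Γ v G) :
    HasWeakGradient U ((U \ Metric.closedBall 0 δ).indicator v)
      ((U \ Metric.closedBall 0 δ).indicator G) := by
  intro φ hφ hφc hφU
  rw [integratesByParts_indicator (hU.measurableSet.diff Metric.isClosed_closedBall.measurableSet)
    sdiff_subset]
  refine h φ hφ hφc ?_
  rintro x ⟨hx1, hx2⟩
  rcases frontier_diff_closedBall_subset hδ.ne' hx2 with h3 | h3
  · rw [hU.frontier_eq] at h3
    exact absurd (hφU hx1) h3.2
  · exact hΓ h3

/-- A function with a weak gradient on `U` that vanishes in the ball has zero trace on its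
boundary. -/
theorem HasWeakGradient.hasZeroTraceOn {U Γ : Set (EuclideanSpace ℝ (Fin N))}
    (hU : IsOpen U) {δ : ℝ} (hδU : Metric.closedBall 0 δ ⊆ U) (hΓ : Disjoint (frontier U) Γ)
    {v : EuclideanSpace ℝ (Fin N) → ℝ} {G : EuclideanSpace ℝ (Fin N) → EuclideanSpace ℝ (Fin N)}
    (h : HasWeakGradient U v G)
    (hv : ∀ᵐ x, x ∈ Metric.closedBall 0 δ → v x = 0)
    (hG : ∀ᵐ x, x ∈ Metric.closedBall 0 δ → G x = 0) :
    HasZeroTraceOn (U \ Metric.closedBall 0 δ) Γ v G := by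
  intro φ hφ hφc hφD
  have hD : MeasurableSet (U \ Metric.closedBall 0 δ) :=
    hU.measurableSet.diff Metric.isClosed_closedBall.measurableSet
  have hdis : Disjoint (tsupport φ) (frontier U) := by
    rw [disjoint_left]
    intro x hx1 hx2
    exact disjoint_left.1 hΓ hx2
      (hφD ⟨hx1, frontier_subset_frontier_diff hU Metric.isClosed_closedBall hδU hx2⟩)
  obtain ⟨h1, h2, h3⟩ := contDiff_indicator_of_tsupport_disjoint hU hφ hφc hdis
  have key := h _ h1 h2 h3
  have hv' : v =ᵐ[volume.restrict U] (U \ Metric.closedBall 0 δ).indicator v := by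
    rw [EventuallyEq, ae_restrict_iff' hU.measurableSet]
    filter_upwards [hv] with x hx hxU
    by_cases hxB : x ∈ Metric.closedBall 0 δ
    · rw [hx hxB, indicator_of_notMem (fun hh => hh.2 hxB)]
    · rw [indicator_of_mem (show x ∈ U \ Metric.closedBall 0 δ from ⟨hxU, hxB⟩)]
  have hG' : G =ᵐ[volume.restrict U] (U \ Metric.closedBall 0 δ).indicator G := by
    rw [EventuallyEq, ae_restrict_iff' hU.measurableSet]
    filter_upwards [hG] with x hx hxU
    by_cases hxB : x ∈ Metric.closedBall 0 δ
    · rw [hx hxB, indicator_of_notMem (fun hh => hh.2 hxB)]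
    · rw [indicator_of_mem (show x ∈ U \ Metric.closedBall 0 δ from ⟨hxU, hxB⟩)]
  have key2 := (integratesByParts_indicator hD sdiff_subset).1 (key.congr_ae hv' hG')
  intro i
  have := key2 i
  rw [setIntegral_congr_fun hD (g := fun x => v x * fderiv ℝ φ x (EuclideanSpace.single i 1))
    (fun x hx => by simp only [fderiv_indicator_of_mem hU hx.1]),
    setIntegral_congr_fun hD (f := fun x => G x i * U.indicator φ x) (g := fun x => G x i * φ x)
    (fun x hx => by simp only [indicator_of_mem hx.1])] at this
  exact this

/-- Integration by parts for Lipschitz functions, whose gradient exists almost everywhere. -/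
theorem LipschitzWith.hasWeakGradient {w : EuclideanSpace ℝ (Fin N) → ℝ} {C : ℝ≥0}
    (hw : LipschitzWith C w) (U : Set (EuclideanSpace ℝ (Fin N))) :
    HasWeakGradient U w (gradient w) := by
  intro φ hφ hφc hφU i
  obtain ⟨L, hL⟩ := hφ.lipschitzWith_of_hasCompactSupport hφc (by simp)
  have h1 := hw.integral_lineDeriv_mul_eq (μ := volume) hL hφc (EuclideanSpace.single i 1)
  have hz : ∀ x, x ∉ U → φ x = 0 := fun x hx => image_eq_zero_of_notMem_tsupport fun h => hx (hφU h)
  have hz' : ∀ x, x ∉ U → fderiv ℝ φ x = 0 := fun x hx =>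
    image_eq_zero_of_notMem_tsupport fun h => hx (hφU (tsupport_fderiv_subset ℝ h))
  rw [setIntegral_eq_integral_of_forall_compl_eq_zero (fun x hx => by rw [hz' x hx]; simp),
    setIntegral_eq_integral_of_forall_compl_eq_zero (fun x hx => by rw [hz x hx, mul_zero])]
  have h2 : ∫ x, gradient w x i * φ x =
      ∫ x, lineDeriv ℝ w x (EuclideanSpace.single i 1) * φ x := by
    refine integral_congr_ae ?_
    filter_upwards [hw.ae_differentiableAt] with x hx
    rw [gradient_apply, hx.lineDeriv_eq_fderiv]
  rw [h2, h1, ← integral_neg]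
  refine integral_congr_ae (Eventually.of_forall fun x => ?_)
  simp only
  rw [(hφ.differentiable (by simp) x).lineDeriv_eq_fderiv, map_neg]
  ring

theorem measurable_gradient (w : EuclideanSpace ℝ (Fin N) → ℝ) : Measurable (gradient w) :=
  (InnerProductSpace.toDual ℝ (EuclideanSpace ℝ (Fin N))).symm.continuous.measurable.comp
    (measurable_fderiv ℝ w)

theorem LipschitzWith.norm_gradient_le {w : EuclideanSpace ℝ (Fin N) → ℝ} {C : ℝ≥0}
    (hw : LipschitzWith C w) (x : EuclideanSpace ℝ (Fin N)) : ‖gradient w x‖ ≤ C := by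
  rw [gradient, LinearIsometryEquiv.norm_map]
  exact norm_fderiv_le_of_lipschitz ℝ hw

end

/-! ### Finite Dirichlet energy excludes logarithmic growth -/

/-- The function g - (b/2) log is decreasing, yet bounded below by (b/2) log s - C, which is
unbounded. -/
theorem false_of_deriv_le_of_log_le {g g' : ℝ → ℝ} {b C s₁ : ℝ} (hb : 0 < b) (hs₁ : 0 < s₁)
    (hd : ∀ s, s₁ ≤ s → HasDerivAt g (g' s) s) (hle : ∀ s, s₁ ≤ s → g' s ≤ b / 2 / s)
    (hlow : ∀ s, s₁ ≤ s → b * Real.log s - C ≤ g s) : False := by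
  have hd2 : ∀ s, s₁ ≤ s → HasDerivAt (fun s => g s - b / 2 * Real.log s) (g' s - b / 2 * s⁻¹) s :=
    fun s hs => (hd s hs).sub ((Real.hasDerivAt_log (hs₁.trans_le hs).ne').const_mul _)
  have hanti : AntitoneOn (fun s => g s - b / 2 * Real.log s) (Ici s₁) := by
    refine antitoneOn_of_deriv_nonpos (convex_Ici s₁)
      (fun s hs => (hd2 s hs).continuousAt.continuousWithinAt)
      (fun s hs => (hd2 s (interior_subset hs)).differentiableAt.differentiableWithinAt) fun s hs => ?_
    rw [(hd2 s (interior_subset hs)).deriv, ← div_eq_mul_inv]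
    linarith [hle s (interior_subset hs)]
  obtain ⟨s, hs1, hs2⟩ := ((Real.tendsto_log_atTop.eventually_gt_atTop
    ((g s₁ - b / 2 * Real.log s₁ + C) / (b / 2))).and (eventually_ge_atTop s₁)).exists
  rw [div_lt_iff₀ (by positivity)] at hs1
  have h1 := hanti (mem_Ici.2 le_rfl) hs2 hs2
  have h2 := hlow s hs2
  simp only at h1
  linarith

section
variable {N : ℕ}

/-- The derivative in the scale is s^(N-1) times the divergence in z of h(sz)z, an expression
against which a weak gradient can be tested. -/
theorem hasDerivAt_scaled_kernel {h : EuclideanSpace ℝ (Fin N) → ℝ} (hh : Differentiable ℝ h)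
    (hN : 1 ≤ N) (s : ℝ) (z : EuclideanSpace ℝ (Fin N)) :
    HasDerivAt (fun s : ℝ => s ^ N * h (s • z))
      (s ^ (N - 1) * (N * h (s • z) + fderiv ℝ h (s • z) (s • z))) s := by
  have h1 : HasDerivAt (fun s : ℝ => s • z) z s := by
    simpa using (hasDerivAt_id s).smul_const z
  have h2 := (hh (s • z)).hasFDerivAt.comp_hasDerivAt s h1
  have h3 := (hasDerivAt_pow N s).mul h2
  have e : s ^ (N - 1) * (N * h (s • z) + fderiv ℝ h (s • z) (s • z)) =
      N * s ^ (N - 1) * (h ∘ fun s => s • z) s + s ^ N * fderiv ℝ h (s • z) z := by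
    obtain ⟨k, rfl⟩ : ∃ k, N = k + 1 := ⟨N - 1, by omega⟩
    simp only [map_smul, smul_eq_mul, add_tsub_cancel_right, Function.comp]
    ring
  rw [e]
  exact h3

/-- Testing a weak gradient with the radial vector field `h(s(x-q))(x-q)`. -/
theorem HasWeakGradient.integral_radial {D : Set (EuclideanSpace ℝ (Fin N))}
    {v : EuclideanSpace ℝ (Fin N) → ℝ} {G : EuclideanSpace ℝ (Fin N) → EuclideanSpace ℝ (Fin N)}
    (hw : HasWeakGradient D v G) (hv : IntegrableOn v D) (hG : IntegrableOn G D)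
    {h : EuclideanSpace ℝ (Fin N) → ℝ} (hh : ContDiff ℝ ∞ h) (hhc : HasCompactSupport h)
    {s : ℝ} (hs : s ≠ 0) {q : EuclideanSpace ℝ (Fin N)}
    (hsupp : ∀ x, s • (x - q) ∈ tsupport h → x ∈ D) :
    ∫ x in D, v x * (N * h (s • (x - q)) + fderiv ℝ h (s • (x - q)) (s • (x - q))) =
      - ∫ x in D, h (s • (x - q)) * inner ℝ (G x) (x - q) := by
  set θ : EuclideanSpace ℝ (Fin N) → EuclideanSpace ℝ (Fin N) := fun x => s • (x - q) with hθ
  have hθs : ContDiff ℝ ∞ θ := by fun_prop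
  have hθd : ∀ x, HasFDerivAt θ (s • ContinuousLinearMap.id ℝ (EuclideanSpace ℝ (Fin N))) x :=
    fun x => ((hasFDerivAt_id x).sub_const q).const_smul s
  have hts : tsupport (fun x => h (θ x)) ⊆ θ ⁻¹' tsupport h := by
    refine closure_minimal (fun x hx => subset_closure hx) ((isClosed_tsupport h).preimage hθs.continuous)
  have hpc : IsCompact (θ ⁻¹' tsupport h) := by
    have e : θ ⁻¹' tsupport h = (fun y => q + s⁻¹ • y) '' tsupport h := by
      ext x
      constructor
      · intro hx
        exact ⟨θ x, hx, by simp [hθ, smul_smul, inv_mul_cancel₀ hs]⟩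
      · rintro ⟨y, hy, rfl⟩
        simpa [hθ, smul_smul, mul_inv_cancel₀ hs] using hy
    rw [e]
    exact hhc.isCompact.image (by fun_prop)
  -- The coordinates of the radial field; their i-th derivatives in direction i add up to its
  -- divergence.
  set φ : Fin N → EuclideanSpace ℝ (Fin N) → ℝ := fun i x => h (θ x) * (x - q) i with hφ
  have hcoord : ∀ i, ContDiff ℝ ∞ fun x : EuclideanSpace ℝ (Fin N) => (x - q) i := fun i =>
    (EuclideanSpace.proj (𝕜 := ℝ) i : EuclideanSpace ℝ (Fin N) →L[ℝ] ℝ).contDiff.comp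
      (contDiff_id.sub contDiff_const)
  have hφs : ∀ i, ContDiff ℝ ∞ (φ i) := fun i => (hh.comp hθs).mul (hcoord i)
  have hφt : ∀ i, tsupport (φ i) ⊆ θ ⁻¹' tsupport h := fun i =>
    (tsupport_mul_subset_left).trans hts
  have hφc : ∀ i, HasCompactSupport (φ i) := fun i =>
    HasCompactSupport.of_support_subset_isCompact hpc (subset_closure.trans (hφt i))
  have hφd : ∀ i x, fderiv ℝ (φ i) x (EuclideanSpace.single i 1) =
      h (θ x) + fderiv ℝ h (θ x) (s • ((x - q) i • EuclideanSpace.single i (1:ℝ))) := by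
    intro i x
    have h1 : HasFDerivAt (fun x => h (θ x)) _ x :=
      ((hh.differentiable (by simp)) (θ x)).hasFDerivAt.comp x (hθd x)
    have h2 : HasFDerivAt (fun x : EuclideanSpace ℝ (Fin N) => (x - q) i)
        (EuclideanSpace.proj (𝕜 := ℝ) i : EuclideanSpace ℝ (Fin N) →L[ℝ] ℝ) x :=
      (EuclideanSpace.proj (𝕜 := ℝ) i : EuclideanSpace ℝ (Fin N) →L[ℝ] ℝ).hasFDerivAt.comp x
        ((hasFDerivAt_id x).sub_const q)
    have h3 := (h1.mul h2).fderiv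
    have h4 : fderiv ℝ (φ i) x = _ := h3
    rw [h4]
    simp
    ring
  have hsum : ∀ y : EuclideanSpace ℝ (Fin N), ∑ i, y i • EuclideanSpace.single i (1:ℝ) = y := by
    intro y
    have := (EuclideanSpace.basisFun (Fin N) ℝ).sum_repr y
    simpa using this
  have hibp := fun i => hw (φ i) (hφs i) (hφc i) (fun x hx => hsupp x (hφt i hx)) i
  have hint1 : ∀ i, IntegrableOn (fun x => v x * fderiv ℝ (φ i) x (EuclideanSpace.single i 1)) D := by
    intro i
    have hc : Continuous fun x => fderiv ℝ (φ i) x (EuclideanSpace.single i 1) :=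
      ((hφs i).continuous_fderiv (by simp)).clm_apply continuous_const
    obtain ⟨B, hB⟩ := ((hφc i).fderiv_apply ℝ (EuclideanSpace.single i 1)).exists_bound_of_continuous hc
    exact hv.mul_bdd hc.aestronglyMeasurable (Eventually.of_forall hB)
  have hint2 : ∀ i, IntegrableOn (fun x => G x i * φ i x) D := by
    intro i
    obtain ⟨B, hB⟩ := (hφc i).exists_bound_of_continuous (hφs i).continuous
    have : IntegrableOn (fun x => G x i) D :=
      (EuclideanSpace.proj (𝕜 := ℝ) i : EuclideanSpace ℝ (Fin N) →L[ℝ] ℝ).integrable_comp hG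
    exact this.mul_bdd (hφs i).continuous.aestronglyMeasurable (Eventually.of_forall hB)
  calc ∫ x in D, v x * (N * h (θ x) + fderiv ℝ h (θ x) (θ x))
      = ∫ x in D, ∑ i, v x * fderiv ℝ (φ i) x (EuclideanSpace.single i 1) := by
        congr 1; ext x
        rw [← Finset.mul_sum]
        simp_rw [hφd]
        rw [Finset.sum_add_distrib, ← map_sum, ← Finset.smul_sum, hsum]
        simp [hθ]
    _ = ∑ i, ∫ x in D, v x * fderiv ℝ (φ i) x (EuclideanSpace.single i 1) :=
        integral_finsetSum _ fun i _ => hint1 i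
    _ = ∑ i, - ∫ x in D, G x i * φ i x := Finset.sum_congr rfl fun i _ => hibp i
    _ = - ∫ x in D, ∑ i, G x i * φ i x := by
        rw [Finset.sum_neg_distrib, integral_finsetSum _ fun i _ => hint2 i]
    _ = _ := by
        congr 2; ext x
        rw [PiLp.inner_apply, Finset.mul_sum]
        refine Finset.sum_congr rfl fun i _ => ?_
        simp [hφ]
        ring

end

section
variable {N : ℕ} {D : Set (EuclideanSpace ℝ (Fin N))} {v h : EuclideanSpace ℝ (Fin N) → ℝ}
  {G : EuclideanSpace ℝ (Fin N) → EuclideanSpace ℝ (Fin N)}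
  {P : Set (EuclideanSpace ℝ (Fin N))} {ν : Measure (EuclideanSpace ℝ (Fin N))} [IsFiniteMeasure ν]
  {R : ℝ}

/-- Differentiating the scaled averages of `v` in the scale. -/
theorem hasDerivAt_integral_scaled_kernel (hN : 1 ≤ N) (hv : IntegrableOn v D)
    (hh : ContDiff ℝ ∞ h) (hhc : HasCompactSupport h) {s : ℝ} (hs : 0 < s) :
    HasDerivAt (fun s : ℝ => ∫ p, v p.1 * (s ^ N * h (s • (p.1 - p.2))) ∂((volume.restrict D).prod ν))
      (∫ p, v p.1 * (s ^ (N - 1) * (N * h (s • (p.1 - p.2)) +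
        fderiv ℝ h (s • (p.1 - p.2)) (s • (p.1 - p.2)))) ∂((volume.restrict D).prod ν)) s := by
  have hv1 : Integrable (fun p : EuclideanSpace ℝ (Fin N) × EuclideanSpace ℝ (Fin N) => v p.1)
      ((volume.restrict D).prod ν) := Integrable.comp_fst hv ν
  set ψ : EuclideanSpace ℝ (Fin N) → ℝ := fun y => N * h y + fderiv ℝ h y y with hψ
  have hψc : Continuous ψ :=
    (continuous_const.mul hh.continuous).add ((hh.continuous_fderiv (by simp)).clm_apply continuous_id)
  have hψs : HasCompactSupport ψ := by
    refine HasCompactSupport.of_support_subset_isCompact hhc.isCompact fun y hy => ?_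
    by_contra hcon
    apply hy
    have h1 : fderiv ℝ h y = 0 :=
      image_eq_zero_of_notMem_tsupport fun hh' => hcon (tsupport_fderiv_subset ℝ hh')
    simp [hψ, h1, image_eq_zero_of_notMem_tsupport hcon]
  obtain ⟨B, hB⟩ := hψs.exists_bound_of_continuous hψc
  obtain ⟨B', hB'⟩ := hhc.exists_bound_of_continuous hh.continuous
  have hB0 : 0 ≤ B := (norm_nonneg _).trans (hB 0)
  have hk : ∀ s : ℝ, Continuous fun p : EuclideanSpace ℝ (Fin N) × EuclideanSpace ℝ (Fin N) =>
      s ^ N * h (s • (p.1 - p.2)) := fun s =>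
    continuous_const.mul (hh.continuous.comp (by fun_prop))
  have hk' : ∀ s : ℝ, Continuous fun p : EuclideanSpace ℝ (Fin N) × EuclideanSpace ℝ (Fin N) =>
      s ^ (N - 1) * ψ (s • (p.1 - p.2)) := fun s =>
    continuous_const.mul (hψc.comp (by fun_prop))
  refine (hasDerivAt_integral_of_dominated_loc_of_deriv_le (s := Icc 0 (2 * s))
    (bound := fun p : EuclideanSpace ℝ (Fin N) × EuclideanSpace ℝ (Fin N) => ‖v p.1‖ * ((2 * s) ^ (N - 1) * B))
    (F' := fun s (p : EuclideanSpace ℝ (Fin N) × EuclideanSpace ℝ (Fin N)) => v p.1 * (s ^ (N - 1) * ψ (s • (p.1 - p.2))))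
    (Icc_mem_nhds hs (by linarith)) (Eventually.of_forall fun s => ?_) ?_ ?_ ?_ ?_ ?_).2
  · exact hv1.aestronglyMeasurable.mul (hk s).aestronglyMeasurable
  · refine hv1.mul_bdd (c := s ^ N * B') (hk s).aestronglyMeasurable (Eventually.of_forall fun p => ?_)
    rw [norm_mul, Real.norm_of_nonneg (by positivity)]
    gcongr; exact hB' _
  · exact hv1.aestronglyMeasurable.mul (hk' s).aestronglyMeasurable
  · refine Eventually.of_forall fun p t ht => ?_
    rw [norm_mul, norm_mul, Real.norm_of_nonneg (pow_nonneg ht.1 _)]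
    gcongr
    · exact ht.1
    · exact ht.2
    · exact hB _
  · exact hv1.norm.mul_const _
  · refine Eventually.of_forall fun p t _ => ?_
    exact (hasDerivAt_scaled_kernel (hh.differentiable (by simp)) hN t (p.1 - p.2)).const_mul (v p.1)

theorem norm_sub_le_of_scaled_mem (hR : tsupport h ⊆ Metric.closedBall 0 R) {s : ℝ} (hs : 0 < s)
    {x q : EuclideanSpace ℝ (Fin N)} (hx : h (s • (x - q)) ≠ 0) : ‖x - q‖ ≤ R / s := by
  have h1 := hR (subset_tsupport _ hx)
  rw [mem_closedBall_zero_iff, norm_smul, Real.norm_of_nonneg hs.le] at h1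
  rw [le_div_iff₀ hs]; linarith

/-- The derivative of the scaled averages in the scale is controlled by the Dirichlet energy near
the support of the measure. -/
theorem deriv_scaled_average_le (hN : 2 ≤ N) (hw : HasWeakGradient D v G)
    (hv : IntegrableOn v D) (hG : MemLp G 2 (volume.restrict D)) [IsFiniteMeasure (volume.restrict D)]
    (hh : ContDiff ℝ ∞ h) (hhc : HasCompactSupport h) (hh0 : ∀ y, 0 ≤ h y) (hh1 : ∀ y, h y ≤ 1)
    (hR : tsupport h ⊆ Metric.closedBall 0 R) (hR0 : 0 < R) {s : ℝ} (hs : 0 < s)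
    (hsupp : ∀ᵐ q ∂ν, ∀ x, s • (x - q) ∈ tsupport h → x ∈ D) {L : ℝ} (hL : 0 < L) :
    ∫ p, v p.1 * (s ^ (N - 1) * (N * h (s • (p.1 - p.2)) +
        fderiv ℝ h (s • (p.1 - p.2)) (s • (p.1 - p.2)))) ∂((volume.restrict D).prod ν) ≤
      (R / 2 * (L * ∫ x in D, ‖G x‖ ^ 2 * (s ^ (N - 2) * ν.real (Metric.closedBall x (R / s)))) +
        R / 2 * (R ^ N * volume.real (Metric.closedBall (0 : EuclideanSpace ℝ (Fin N)) 1) *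
          ν.real univ / L)) / s := by
  set μ := (volume.restrict D).prod ν with hμ
  have hGi : IntegrableOn G D := hG.integrable one_le_two
  have hv1 : Integrable (fun p : EuclideanSpace ℝ (Fin N) × EuclideanSpace ℝ (Fin N) => v p.1) μ :=
    Integrable.comp_fst hv ν
  have hG1 : Integrable (fun p : EuclideanSpace ℝ (Fin N) × EuclideanSpace ℝ (Fin N) => G p.1) μ :=
    Integrable.comp_fst hGi ν
  have hG2 : Integrable (fun x => ‖G x‖ ^ 2) (volume.restrict D) := hG.integrable_norm_pow (by simp)
  have hG21 : Integrable (fun p : EuclideanSpace ℝ (Fin N) × EuclideanSpace ℝ (Fin N) =>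
      ‖G p.1‖ ^ 2) μ := Integrable.comp_fst hG2 ν
  have hN' : N - 1 = (N - 2) + 1 := by omega
  -- the set of pairs at distance at most `R / s`
  set A : Set (EuclideanSpace ℝ (Fin N) × EuclideanSpace ℝ (Fin N)) := {p | ‖p.1 - p.2‖ ≤ R / s} with hA
  have hAc : IsClosed A := isClosed_le (by fun_prop) continuous_const
  have hAm := hAc.measurableSet
  set k : EuclideanSpace ℝ (Fin N) × EuclideanSpace ℝ (Fin N) → ℝ :=
    fun p => h (s • (p.1 - p.2)) * inner ℝ (G p.1) (p.1 - p.2) with hk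
  have hkb : ∀ p, ‖k p‖ ≤ A.indicator (fun p => R / s * ‖G p.1‖) p := by
    intro p
    by_cases hp : h (s • (p.1 - p.2)) = 0
    · simp only [hk, hp, zero_mul, norm_zero]
      exact indicator_nonneg (fun p _ => by positivity) p
    · have h1 := norm_sub_le_of_scaled_mem hR hs hp
      rw [indicator_of_mem (show p ∈ A from h1), hk, norm_mul, Real.norm_of_nonneg (hh0 _)]
      calc h (s • (p.1 - p.2)) * ‖inner ℝ (G p.1) (p.1 - p.2)‖ ≤ 1 * (‖G p.1‖ * ‖p.1 - p.2‖) := by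
            gcongr
            · exact hh1 _
            · exact norm_inner_le_norm _ _
        _ ≤ 1 * (‖G p.1‖ * (R / s)) := by gcongr
        _ = R / s * ‖G p.1‖ := by ring
  have hkm : AEStronglyMeasurable k μ := by
    refine AEStronglyMeasurable.mul (hh.continuous.comp (by fun_prop)).aestronglyMeasurable ?_
    exact hG1.aestronglyMeasurable.inner (by fun_prop)
  have hki : Integrable k μ :=
    ((hG1.norm.const_mul (R / s)).indicator hAm).mono' hkm (Eventually.of_forall hkb)
  have hψi : Integrable (fun p : EuclideanSpace ℝ (Fin N) × EuclideanSpace ℝ (Fin N) =>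
      v p.1 * (N * h (s • (p.1 - p.2)) + fderiv ℝ h (s • (p.1 - p.2)) (s • (p.1 - p.2)))) μ := by
    set ψ : EuclideanSpace ℝ (Fin N) → ℝ := fun y => N * h y + fderiv ℝ h y y with hψ
    have hψc : Continuous ψ :=
      (continuous_const.mul hh.continuous).add ((hh.continuous_fderiv (by simp)).clm_apply continuous_id)
    have hψs : HasCompactSupport ψ := by
      refine HasCompactSupport.of_support_subset_isCompact hhc.isCompact fun y hy => ?_
      by_contra hcon
      apply hy
      have h1 : fderiv ℝ h y = 0 :=
        image_eq_zero_of_notMem_tsupport fun hh' => hcon (tsupport_fderiv_subset ℝ hh')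
      simp [hψ, h1, image_eq_zero_of_notMem_tsupport hcon]
    obtain ⟨B, hB⟩ := hψs.exists_bound_of_continuous hψc
    exact hv1.mul_bdd (hψc.comp (by fun_prop)).aestronglyMeasurable
      (Eventually.of_forall fun p => hB (s • (p.1 - p.2)))
  -- By Fubini the integral over x is taken first, and is integrated by parts against the radial
  -- field centred at q.
  have e1 : ∫ p, v p.1 * (s ^ (N - 1) * (N * h (s • (p.1 - p.2)) +
        fderiv ℝ h (s • (p.1 - p.2)) (s • (p.1 - p.2)))) ∂μ = - (s ^ (N - 1) * ∫ p, k p ∂μ) := by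
    rw [hμ, integral_prod_symm _ hki, ← mul_neg, ← integral_neg]
    have : ∀ p : EuclideanSpace ℝ (Fin N) × EuclideanSpace ℝ (Fin N),
        v p.1 * (s ^ (N - 1) * (N * h (s • (p.1 - p.2)) +
        fderiv ℝ h (s • (p.1 - p.2)) (s • (p.1 - p.2)))) = s ^ (N - 1) *
        (v p.1 * (N * h (s • (p.1 - p.2)) +
        fderiv ℝ h (s • (p.1 - p.2)) (s • (p.1 - p.2)))) := fun p => by ring
    simp_rw [this]
    rw [integral_const_mul, integral_prod_symm _ hψi]
    congr 1
    refine integral_congr_ae ?_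
    filter_upwards [hsupp] with q hq
    exact hw.integral_radial hv hGi hh hhc hs.ne' hq
  have e2 : |∫ p, k p ∂μ| ≤ ∫ p, A.indicator (fun p => R / s * ‖G p.1‖) p ∂μ := by
    rw [← Real.norm_eq_abs]
    refine (norm_integral_le_integral_norm (μ := μ) k).trans ?_
    exact integral_mono hki.norm ((hG1.norm.const_mul (R / s)).indicator hAm) hkb
  -- Every section of A at fixed q is a ball of radius R / s.
  have hμA : μ.real A ≤ R ^ N / s ^ N * volume.real (Metric.closedBall (0 : EuclideanSpace ℝ (Fin N)) 1) *
      ν.real univ := by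
    have h1 : μ.real A = ∫ q, (volume.restrict D).real (Metric.closedBall q (R / s)) ∂ν := by
      rw [← integral_indicator_one hAm, hμ, integral_prod_symm _ ((integrable_const _).indicator hAm)]
      refine integral_congr_ae (Eventually.of_forall fun q => ?_)
      simp only
      rw [← integral_indicator_one Metric.isClosed_closedBall.measurableSet]
      refine integral_congr_ae (Eventually.of_forall fun x => ?_)
      simp [indicator, hA, dist_eq_norm]
    have h2 : ∀ q, (volume.restrict D).real (Metric.closedBall q (R / s)) ≤
        R ^ N / s ^ N * volume.real (Metric.closedBall (0 : EuclideanSpace ℝ (Fin N)) 1) := by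
      intro q
      have h3 : (volume.restrict D).real (Metric.closedBall q (R / s)) ≤
          volume.real (Metric.closedBall q (R / s)) := by
        refine ENNReal.toReal_mono (measure_closedBall_lt_top).ne ?_
        exact Measure.restrict_apply_le _ _
      refine h3.trans (le_of_eq ?_)
      rw [Measure.real, Measure.addHaar_closedBall' _ _ (by positivity), ENNReal.toReal_mul,
        ENNReal.toReal_ofReal (by positivity), finrank_euclideanSpace_fin, div_pow]
      rfl
    rw [h1]
    calc _ ≤ ∫ q, R ^ N / s ^ N * volume.real (Metric.closedBall (0 : EuclideanSpace ℝ (Fin N)) 1) ∂ν := by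
          refine integral_mono_of_nonneg (Eventually.of_forall fun q => by positivity)
            (integrable_const _) (Eventually.of_forall h2)
      _ = _ := by rw [integral_const, smul_eq_mul]; ring
  have hGA : ∫ p, A.indicator (fun p => ‖G p.1‖ ^ 2) p ∂μ =
      ∫ x in D, ‖G x‖ ^ 2 * ν.real (Metric.closedBall x (R / s)) := by
    rw [hμ, integral_prod _ (hG21.indicator hAm)]
    refine integral_congr_ae (Eventually.of_forall fun x => ?_)
    simp only
    rw [← integral_indicator_one Metric.isClosed_closedBall.measurableSet, ← integral_const_mul]
    congr 1; ext q
    by_cases hq : q ∈ Metric.closedBall x (R / s)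
    · rw [indicator_of_mem hq, indicator_of_mem]
      · simp
      · rw [Metric.mem_closedBall, dist_comm, dist_eq_norm] at hq; exact hq
    · rw [indicator_of_notMem hq, indicator_of_notMem]
      · simp
      · rw [Metric.mem_closedBall, dist_comm, dist_eq_norm] at hq; exact hq
  -- Young's inequality 2‖G‖ ≤ (L/s)‖G‖² + s/L. With these weights both terms are of order 1/s in
  -- the end, and L remains free to make the second one small.
  have e3 : ∫ p, A.indicator (fun p => R / s * ‖G p.1‖) p ∂μ ≤
      R / s * ((L / s) / 2 * ∫ x in D, ‖G x‖ ^ 2 * ν.real (Metric.closedBall x (R / s))) +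
      R / s * ((s / L) / 2 * μ.real A) := by
    have hi1 : Integrable (fun p => R / s * ((L / s) / 2 * A.indicator (fun p => ‖G p.1‖ ^ 2) p)) μ :=
      ((hG21.indicator hAm).const_mul _).const_mul _
    have hi2 : Integrable (fun p => R / s * ((s / L) / 2 *
        A.indicator (1 : EuclideanSpace ℝ (Fin N) × EuclideanSpace ℝ (Fin N) → ℝ) p)) μ :=
      (((integrable_const (1:ℝ)).indicator hAm).const_mul _).const_mul _
    calc _ ≤ ∫ p, (R / s * ((L / s) / 2 * A.indicator (fun p => ‖G p.1‖ ^ 2) p) +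
          R / s * ((s / L) / 2 *
        A.indicator (1 : EuclideanSpace ℝ (Fin N) × EuclideanSpace ℝ (Fin N) → ℝ) p)) ∂μ := by
          refine integral_mono ((hG1.norm.const_mul (R / s)).indicator hAm) (hi1.add hi2) fun p => ?_
          by_cases hp : p ∈ A
          · simp only [indicator_of_mem hp, Pi.one_apply, mul_one, ← mul_add]
            gcongr
            have h1 : 0 ≤ (L / s * ‖G p.1‖ - 1) ^ 2 := sq_nonneg _
            have h2 : s / L = (L / s)⁻¹ := by rw [inv_div]
            have hl : 0 < L / s := by positivity
            rw [h2]
            have h3 : 0 ≤ (L / s)⁻¹ * (L / s * ‖G p.1‖ - 1) ^ 2 := by positivity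
            have h4 : (L / s)⁻¹ * (L / s * ‖G p.1‖ - 1) ^ 2 =
              L / s * ‖G p.1‖ ^ 2 - 2 * ‖G p.1‖ + (L / s)⁻¹ := by
              field_simp
              ring
            linarith
          · simp [indicator_of_notMem hp]
      _ = _ := by
          rw [integral_add hi1 hi2, integral_const_mul, integral_const_mul, integral_const_mul,
            integral_const_mul, hGA, integral_indicator_one hAm]
  set J := ∫ x in D, ‖G x‖ ^ 2 * ν.real (Metric.closedBall x (R / s)) with hJ
  have hJ' : ∫ x in D, ‖G x‖ ^ 2 * (s ^ (N - 2) * ν.real (Metric.closedBall x (R / s))) =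
      s ^ (N - 2) * J := by
    rw [hJ, ← integral_const_mul]
    congr 1; ext x; ring
  rw [e1, hJ']
  calc - (s ^ (N - 1) * ∫ p, k p ∂μ) ≤ s ^ (N - 1) * |∫ p, k p ∂μ| := by
        rw [← mul_neg]; gcongr; exact neg_le_abs _
    _ ≤ s ^ (N - 1) * (R / s * ((L / s) / 2 * J) + R / s * ((s / L) / 2 *
        (R ^ N / s ^ N * volume.real (Metric.closedBall (0 : EuclideanSpace ℝ (Fin N)) 1) * ν.real univ))) := by
        gcongr
        refine e2.trans (e3.trans ?_)
        gcongr
    _ = _ := by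
        have : s ^ N = s ^ (N - 2) * s ^ 2 := by rw [← pow_add]; congr 1; omega
        rw [hN', pow_succ, this]
        field_simp
end

section
variable {N : ℕ} {D : Set (EuclideanSpace ℝ (Fin N))} {v h : EuclideanSpace ℝ (Fin N) → ℝ}
  {G : EuclideanSpace ℝ (Fin N) → EuclideanSpace ℝ (Fin N)}
  {P : Set (EuclideanSpace ℝ (Fin N))} {ν : Measure (EuclideanSpace ℝ (Fin N))} [IsFiniteMeasure ν]
  {R : ℝ}

theorem setIntegral_scaled_kernel {s : ℝ} (hs : 0 < s) {q : EuclideanSpace ℝ (Fin N)}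
    (hsupp : ∀ x, s • (x - q) ∈ tsupport h → x ∈ D) :
    ∫ x in D, s ^ N * h (s • (x - q)) = ∫ x, h x := by
  rw [setIntegral_eq_integral_of_forall_compl_eq_zero]
  · rw [integral_const_mul, integral_sub_right_eq_self (fun x => h (s • x)) q,
      Measure.integral_comp_smul, finrank_euclideanSpace_fin, abs_of_pos (by positivity), smul_eq_mul,
      ← mul_assoc, mul_inv_cancel₀ (by positivity), one_mul]
  · intro x hx
    rw [image_eq_zero_of_notMem_tsupport (fun hh => hx (hsupp x hh)), mul_zero]

/-- A measure of codimension-two growth charges the energy of an `L²` field less and less at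
small scales off its support. -/
theorem tendsto_energy_near (hG : MemLp G 2 (volume.restrict D)) (hP : IsClosed P)
    (hνP : ∀ᵐ q ∂ν, q ∈ P) {C : ℝ} (hC : ∀ x r, 0 < r → ν.real (Metric.closedBall x r) ≤ C * r ^ (N - 2))
    (hDP : ∀ᵐ x ∂(volume.restrict D), x ∉ P) (hR : 0 < R) :
    Tendsto (fun s : ℝ => ∫ x in D, ‖G x‖ ^ 2 * (s ^ (N - 2) * ν.real (Metric.closedBall x (R / s))))
      atTop (𝓝 0) := by
  have hG2 : Integrable (fun x => ‖G x‖ ^ 2) (volume.restrict D) := hG.integrable_norm_pow (by simp)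
  have h0 : (0 : ℝ) = ∫ x in D, (0 : ℝ) := by simp
  rw [h0]
  -- The growth bound on ν dominates the integrand by a multiple of ‖G‖². Away from the closed set P
  -- the ball about x eventually misses P and the integrand vanishes.
  refine tendsto_integral_filter_of_dominated_convergence (fun x => ‖G x‖ ^ 2 * (C * R ^ (N - 2)))
    ?_ ?_ (hG2.mul_const _) ?_
  · filter_upwards with s
    refine hG2.aestronglyMeasurable.mul (aestronglyMeasurable_const.mul ?_)
    refine Measurable.aestronglyMeasurable ?_
    have hm : MeasurableSet {p : EuclideanSpace ℝ (Fin N) × EuclideanSpace ℝ (Fin N) |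
        dist p.2 p.1 ≤ R / s} := (isClosed_le (by fun_prop) continuous_const).measurableSet
    exact (measurable_measure_prodMk_left hm).ennreal_toReal
  · filter_upwards [eventually_gt_atTop 0] with s hs
    refine Eventually.of_forall fun x => ?_
    rw [Real.norm_of_nonneg (by positivity)]
    refine mul_le_mul_of_nonneg_left ?_ (by positivity)
    calc s ^ (N - 2) * ν.real (Metric.closedBall x (R / s)) ≤ s ^ (N - 2) * (C * (R / s) ^ (N - 2)) := by
          gcongr; exact hC x _ (by positivity)
      _ = C * R ^ (N - 2) := by rw [div_pow]; field_simp
  · filter_upwards [hDP] with x hx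
    obtain ⟨ε, hε, hεP⟩ := Metric.isOpen_iff.1 hP.isOpen_compl x hx
    refine tendsto_const_nhds.congr' ?_
    filter_upwards [eventually_gt_atTop 0, eventually_gt_atTop (R / ε)] with s hs hs'
    have : ν (Metric.closedBall x (R / s)) = 0 := by
      rw [measure_eq_zero_iff_ae_notMem]
      filter_upwards [hνP] with q hq hqx
      refine hεP (show q ∈ Metric.ball x ε from ?_) hq
      rw [Metric.mem_closedBall] at hqx
      rw [div_lt_iff₀ hε] at hs'
      refine Metric.mem_ball.2 (hqx.trans_lt ?_)
      rw [div_lt_iff₀ hs]; linarith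
    simp [Measure.real, this]

/-- A function with square integrable weak gradient cannot grow logarithmically towards a set
that carries a measure of codimension-two growth and satisfies an interior cone condition. -/
theorem HasWeakGradient.false_of_log_growth (hN : 2 ≤ N)
    [IsFiniteMeasure (volume.restrict D)] (hw : HasWeakGradient D v G)
    (hv : IntegrableOn v D) (hG : MemLp G 2 (volume.restrict D)) (hP : IsClosed P)
    (hν : ν ≠ 0) (hνP : ∀ᵐ q ∂ν, q ∈ P) {C : ℝ}
    (hC : ∀ x r, 0 < r → ν.real (Metric.closedBall x r) ≤ C * r ^ (N - 2))
    {e : EuclideanSpace ℝ (Fin N)} {κ ρ : ℝ} (hκ : 0 < κ) (hρ : 0 < ρ)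
    (hcone : ∀ q ∈ P, ∀ τ ∈ Ioo 0 ρ, ∀ y ∈ Metric.closedBall e κ, q + τ • y ∈ D)
    {A c η : ℝ} (hA : 0 < A) (hc : 0 < c) (hη : 0 < η)
    (hlow : ∀ᵐ x ∂(volume.restrict D), ∀ q ∈ P, ∀ n : ℕ, Real.exp (A * n) * dist x q ≤ η → c * n ≤ v x) :
    False := by
  -- At a point of P the distance to q = x is zero, so `hlow` would bound v from below by c * n for
  -- every n.
  have hDP : ∀ᵐ x ∂(volume.restrict D), x ∉ P := by
    filter_upwards [hlow] with x hx hxP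
    obtain ⟨n, hn⟩ := exists_nat_gt (v x / c)
    have := hx x hxP n (by simp [hη.le])
    rw [div_lt_iff₀ hc] at hn
    linarith
  let B : ContDiffBump e := ⟨κ / 2, κ, by positivity, by linarith⟩
  set h : EuclideanSpace ℝ (Fin N) → ℝ := fun y => B y with hh
  set R := ‖e‖ + κ with hR
  have hR0 : 0 < R := by positivity
  have hts : tsupport h = Metric.closedBall e κ := B.tsupport_eq
  have htR : tsupport h ⊆ Metric.closedBall 0 R := by
    rw [hts]
    refine Metric.closedBall_subset_closedBall' ?_
    rw [dist_zero_right, hR]; linarith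
  have hsupp : ∀ s, 1 / ρ < s → ∀ q ∈ P, ∀ x, s • (x - q) ∈ tsupport h → x ∈ D := by
    intro s hs q hq x hx
    have hs0 : 0 < s := lt_trans (by positivity) hs
    have := hcone q hq s⁻¹ ⟨by positivity, by rw [inv_lt_comm₀ hs0 hρ, ← one_div]; exact hs⟩ _ (hts ▸ hx)
    rwa [smul_smul, inv_mul_cancel₀ hs0.ne', one_smul, add_sub_cancel] at this
  set I := ∫ x, h x with hI
  have hI0 : 0 < I := B.integral_pos
  set m := ν.real univ with hm
  have hm0 : 0 < m := haveI : NeZero ν := ⟨hν⟩; measureReal_univ_pos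
  -- The slope in log s of the lower bound for the averages. L is then chosen so that the constant
  -- term of Young's inequality contributes at most b/4, and s₁ so that the energy term contributes
  -- less than b/4: together they stay below the slope b/2.
  set b := m * I * c / A with hb
  have hb0 : 0 < b := by positivity
  set W := R / 2 * (R ^ N * volume.real (Metric.closedBall (0 : EuclideanSpace ℝ (Fin N)) 1) * m) with hW
  have hW0 : 0 ≤ W := by positivity
  set L := 4 * W / b + 1 with hL
  have hL0 : 0 < L := by positivity
  have hWL : W / L ≤ b / 4 := by
    rw [div_le_iff₀ hL0, hL]
    have : b / 4 * (4 * W / b + 1) = W + b / 4 := by field_simp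
    linarith
  have hev := (tendsto_energy_near hG hP hνP hC hDP hR0).eventually
    (gt_mem_nhds (show (0 : ℝ) < b / 4 / (R / 2 * L) by positivity))
  obtain ⟨s₁, hs₁⟩ := eventually_atTop.1 (((hev.and (eventually_gt_atTop 0)).and
    (eventually_gt_atTop (1 / ρ))).and (eventually_gt_atTop (R / η)))
  have hs₁0 : 0 < s₁ := (hs₁ s₁ le_rfl).1.1.2
  have hv1 : Integrable (fun p : EuclideanSpace ℝ (Fin N) × EuclideanSpace ℝ (Fin N) => v p.1)
      ((volume.restrict D).prod ν) := Integrable.comp_fst hv ν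
  refine false_of_deriv_le_of_log_le hb0 hs₁0
    (C := m * I * c * (1 - Real.log (η / R) / A))
    (fun s hs => hasDerivAt_integral_scaled_kernel (ν := ν) (by omega) hv B.contDiff B.hasCompactSupport
      (hs₁0.trans_le hs)) (fun s hs => ?_) (fun s hs => ?_)
  · obtain ⟨⟨⟨h1, h2⟩, h3⟩, h4⟩ := hs₁ s hs
    refine (deriv_scaled_average_le hN hw hv hG B.contDiff B.hasCompactSupport
      (fun y => B.nonneg) (fun y => B.le_one) htR hR0 h2 ?_ hL0).trans ?_
    · filter_upwards [hνP] with q hq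
      exact hsupp s h3 q hq
    · gcongr
      rw [lt_div_iff₀ (by positivity)] at h1
      have e1 : R / 2 * (R ^ N * volume.real (Metric.closedBall (0 : EuclideanSpace ℝ (Fin N)) 1) *
          ν.real univ / L) = W / L := by rw [hW]; ring
      rw [e1]
      linarith
  · obtain ⟨⟨⟨h1, h2⟩, h3⟩, h4⟩ := hs₁ s hs
    have hki : Integrable (fun p : EuclideanSpace ℝ (Fin N) × EuclideanSpace ℝ (Fin N) =>
        v p.1 * (s ^ N * h (s • (p.1 - p.2)))) ((volume.restrict D).prod ν) := by
      refine hv1.mul_bdd (c := s ^ N) (continuous_const.mul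
        (B.continuous.comp (by fun_prop))).aestronglyMeasurable (Eventually.of_forall fun p => ?_)
      rw [norm_mul, Real.norm_of_nonneg (by positivity), Real.norm_of_nonneg B.nonneg]
      exact mul_le_of_le_one_right (by positivity) B.le_one
    set a := c * (Real.log (η * s / R) / A - 1) with ha
    have hq : ∀ q ∈ P, a * I ≤ ∫ x in D, v x * (s ^ N * h (s • (x - q))) := by
      intro q hq
      rw [hI, ← setIntegral_scaled_kernel (D := D) h2 (hsupp s h3 q hq), ← integral_const_mul]
      have hkb : ∀ x, ‖s ^ N * h (s • (x - q))‖ ≤ s ^ N := fun x => by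
        rw [norm_mul, Real.norm_of_nonneg (by positivity), Real.norm_of_nonneg B.nonneg]
        exact mul_le_of_le_one_right (by positivity) B.le_one
      have hkm : AEStronglyMeasurable (fun x => s ^ N * h (s • (x - q))) (volume.restrict D) :=
        (continuous_const.mul (B.continuous.comp (by fun_prop))).aestronglyMeasurable
      refine integral_mono_ae ((Integrable.of_bound hkm _ (Eventually.of_forall hkb)).const_mul _)
        (hv.mul_bdd hkm (Eventually.of_forall hkb)) ?_
      filter_upwards [hlow] with x hx
      by_cases hx0 : h (s • (x - q)) = 0
      · simp [hx0]
      · have hd := norm_sub_le_of_scaled_mem htR h2 hx0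
        have hpos : 0 ≤ s ^ N * h (s • (x - q)) := mul_nonneg (by positivity) B.nonneg
        refine mul_le_mul_of_nonneg_right ?_ hpos
        have hy1 : 1 ≤ η * s / R := by
          rw [le_div_iff₀ hR0]; rw [div_lt_iff₀ hη] at h4; linarith
        have hlog : 0 ≤ Real.log (η * s / R) / A := div_nonneg (Real.log_nonneg hy1) hA.le
        have hfl := Nat.floor_le hlog
        have hfl' := Nat.lt_floor_add_one (Real.log (η * s / R) / A)
        -- The largest admissible n: on the support of the kernel dist x q ≤ R / s, and exp(A n) ≤ η
        -- s / R.
        refine le_trans ?_ (hx q hq ⌊Real.log (η * s / R) / A⌋₊ ?_)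
        · rw [ha]; gcongr; linarith
        · have h5 : Real.exp (A * ⌊Real.log (η * s / R) / A⌋₊) ≤ η * s / R := by
            rw [← Real.le_log_iff_exp_le (by positivity)]
            rw [le_div_iff₀ hA] at hfl; linarith
          rw [dist_eq_norm]
          calc _ ≤ η * s / R * (R / s) := by gcongr
            _ = η := by field_simp
    rw [integral_prod_symm _ hki]
    calc b * Real.log s - m * I * c * (1 - Real.log (η / R) / A) = ∫ q, a * I ∂ν := by
          rw [integral_const, smul_eq_mul, ha, mul_div_right_comm,
            Real.log_mul (by positivity) (by positivity), hb]
          ring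
      _ ≤ _ := by
          refine integral_mono_ae (integrable_const _) hki.integral_prod_right ?_
          filter_upwards [hνP] with q hqP
          exact hq q hqP
end

/-! ### Lower bounds along trajectories, and measures on arcs -/

section
variable {N : ℕ} {F : EuclideanSpace ℝ (Fin N) → EuclideanSpace ℝ (Fin N)}
  {φ : ℝ → EuclideanSpace ℝ (Fin N) → EuclideanSpace ℝ (Fin N)} {K M : ℝ≥0}

namespace IsFlow

/-- A property that holds almost everywhere holds at almost every time along almost every
trajectory. -/
theorem ae_ae_comp (h : IsFlow F φ) (hF : LipschitzWith K F) (hM : ∀ x, ‖F x‖ ≤ M)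
    {p : EuclideanSpace ℝ (Fin N) → Prop} (hp : ∀ᵐ x, p x) (t : ℝ) :
    ∀ᵐ x, ∀ᵐ s ∂(volume.restrict (Ioc 0 t)), p (φ s x) := by
  set Z := toMeasurable volume {x | ¬ p x} with hZ
  have hZm : MeasurableSet Z := measurableSet_toMeasurable _ _
  have hZ0 : volume Z = 0 := by rw [hZ, measure_toMeasurable]; exact hp
  set g : EuclideanSpace ℝ (Fin N) → ℝ≥0∞ := Z.indicator 1 with hg
  have hgm : Measurable g := measurable_one.indicator hZm
  have hcomp : Measurable fun q : EuclideanSpace ℝ (Fin N) × ℝ => g (φ q.2 q.1) :=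
    hgm.comp ((h.continuous_uncurry hF hM).comp continuous_swap).measurable
  have h1 := h.setLIntegral_lintegral_comp_le hF hM (t := t) hgm (A := univ) (B := univ) MeasurableSet.univ
    (fun s _ => mapsTo_univ _ _)
  rw [Measure.restrict_univ, hg, lintegral_indicator_one hZm, hZ0, mul_zero, mul_zero,
    nonpos_iff_eq_zero, lintegral_eq_zero_iff hcomp.lintegral_prod_right'] at h1
  filter_upwards [h1] with x hx
  have h2 := (lintegral_eq_zero_iff (hcomp.comp measurable_prodMk_left)).1 hx
  filter_upwards [h2] with s hs
  by_contra hcon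
  have : φ s x ∈ Z := subset_toMeasurable _ _ hcon
  simp [hg, this] at hs

/-- Along trajectories in `D`, a positive function whose derivative along the flow is at most `-c`
is bounded below by `c` times the elapsed time. -/
theorem ae_mul_le (h : IsFlow F φ) (hF : LipschitzWith K F) (hM : ∀ x, ‖F x‖ ≤ M)
    {D : Set (EuclideanSpace ℝ (Fin N))} (hD : IsOpen D) (hDb : Bornology.IsBounded D)
    {v w : EuclideanSpace ℝ (Fin N) → ℝ} {G : EuclideanSpace ℝ (Fin N) → EuclideanSpace ℝ (Fin N)}
    (hvm : Measurable v) (hGm : Measurable G)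
    (hw : HasWeakGradient D v G) (hv : IntegrableOn v D) (hG : IntegrableOn G D)
    (hFG : ∀ᵐ x ∂(volume.restrict D), inner ℝ (F x) (G x) = - w x)
    (hv0 : ∀ᵐ x ∂(volume.restrict D), 0 < v x) {c t : ℝ} (ht : 0 ≤ t) :
    ∀ᵐ x, (∀ s ∈ Icc 0 t, φ s x ∈ D ∧ c ≤ w (φ s x)) → c * t ≤ v x := by
  rw [ae_restrict_iff' hD.measurableSet] at hFG hv0
  filter_upwards [h.ae_sub_eq_integral hF hM hD hDb hvm hGm hw hv hG ht, h.ae_ae_comp hF hM hFG t,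
    (h.quasiMeasurePreserving hF t).ae hv0] with x h1 h2 h3 hx
  obtain ⟨h4, h5⟩ := h1 fun s hs => (hx s hs).1
  have h6 := h3 (hx t ⟨ht, le_rfl⟩).1
  have hFi : IntegrableOn (fun s => inner ℝ (F (φ s x)) (G (φ s x))) (Ioc 0 t) := by
    refine Integrable.mono' (h4.norm.const_mul (M : ℝ)) ?_ (Eventually.of_forall fun s => ?_)
    · exact ((hF.continuous.comp (h.continuous_left x)).aestronglyMeasurable).inner h4.aestronglyMeasurable
    · refine (norm_inner_le_norm _ _).trans ?_
      gcongr
      exact hM _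
  have h7 : ∫ s in Ioc 0 t, inner ℝ (F (φ s x)) (G (φ s x)) ≤ ∫ s in Ioc 0 t, -c := by
    refine integral_mono_ae hFi (integrable_const _) ?_
    filter_upwards [h2, ae_restrict_mem measurableSet_Ioc] with s hs hs'
    have := hx s (Ioc_subset_Icc_self hs')
    rw [hs this.1]
    linarith [this.2]
  rw [← h5, setIntegral_const, Real.volume_real_Ioc_of_le ht, smul_eq_mul] at h7
  linarith

end IsFlow

/-- A point in the plane, and a short arc of a nonconstant trajectory in space, carry a measure of
codimension-two growth. -/
theorem IsFlow.exists_measure_arc (hN : N = 2 ∨ N = 3) (h : IsFlow F φ) (hF : LipschitzWith K F)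
    {p : EuclideanSpace ℝ (Fin N)} (hp : N = 3 → F p ≠ 0) {ρ : ℝ} (hρ : 0 < ρ) :
    ∃ T, 0 < T ∧ (∀ t ∈ Icc 0 T, dist (φ t p) p < ρ) ∧
      ∃ ν : Measure (EuclideanSpace ℝ (Fin N)), IsFiniteMeasure ν ∧ ν ≠ 0 ∧
        (∀ᵐ q ∂ν, q ∈ (fun t => φ t p) '' Icc 0 T) ∧
        ∃ C, ∀ x r, 0 < r → ν.real (Metric.closedBall x r) ≤ C * r ^ (N - 2) := by
  have hcont := h.continuous_left p
  have hev1 : ∀ᶠ t in 𝓝 (0:ℝ), dist (φ t p) p < ρ := by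
    refine (hcont.dist continuous_const).continuousAt.eventually (gt_mem_nhds ?_)
    simp only
    rw [h.zero, dist_self]; exact hρ
  rcases hN with rfl | rfl
  -- In the plane r^(N-2) = 1, and a Dirac mass at p suffices.
  · obtain ⟨ε, hε, hε'⟩ := Metric.eventually_nhds_iff.1 hev1
    have hT : ∀ t ∈ Icc 0 (ε / 2), dist (φ t p) p < ρ := fun t ht => hε' (by
      rw [Real.dist_eq, sub_zero, abs_of_nonneg ht.1]; linarith [ht.2])
    refine ⟨ε / 2, by positivity, hT, Measure.dirac p, inferInstance, Measure.dirac_ne_zero, ?_, 1,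
      fun x r _ => by simp⟩
    rw [ae_dirac_eq]
    exact ⟨0, ⟨le_rfl, by positivity⟩, h.zero p⟩
  · have hFp : 0 < ‖F p‖ := norm_pos_iff.2 (hp rfl)
    -- On a short arc the velocity keeps at least half of its component along F p. Two points of the
    -- arc in a ball of radius r are thus at most 4r/‖F p‖ apart in time, which bounds the
    -- pushforward of Lebesgue measure linearly in r.
    have hev2 : ∀ᶠ t in 𝓝 (0:ℝ), ‖F p‖ ^ 2 / 2 < inner ℝ (F p) (F (φ t p)) := by
      refine (continuous_const.inner (hF.continuous.comp hcont)).continuousAt.eventually (lt_mem_nhds ?_)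
      simp only [Function.comp]
      rw [h.zero, real_inner_self_eq_norm_sq]
      have : 0 < ‖F p‖ ^ 2 := by positivity
      linarith
    obtain ⟨ε, hε, hε'⟩ := Metric.eventually_nhds_iff.1 (hev1.and hev2)
    have hT : ∀ t ∈ Icc 0 (ε / 2), dist (φ t p) p < ρ ∧ ‖F p‖ ^ 2 / 2 < inner ℝ (F p) (F (φ t p)) :=
      fun t ht => hε' (by rw [Real.dist_eq, sub_zero, abs_of_nonneg ht.1]; linarith [ht.2])
    set T := ε / 2 with hTdef
    have hT0 : 0 < T := by positivity
    have hm : Measurable fun t => φ t p := hcont.measurable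
    refine ⟨T, hT0, fun t ht => (hT t ht).1, (volume.restrict (Icc 0 T)).map (fun t => φ t p),
      inferInstance, ?_, ?_, 4 / ‖F p‖, fun x r hr => ?_⟩
    · rw [Ne, Measure.map_eq_zero_iff hm.aemeasurable, Measure.restrict_eq_zero, Real.volume_Icc]
      simpa using hT0
    · refine (ae_map_iff hm.aemeasurable (isCompact_Icc.image hcont).isClosed.measurableSet).2 ?_
      filter_upwards [ae_restrict_mem measurableSet_Icc] with t ht using mem_image_of_mem _ ht
    · have hd : ∀ t, HasDerivAt (fun t => inner ℝ (F p) (φ t p)) (inner ℝ (F p) (F (φ t p))) t := by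
        intro t
        simpa using (hasDerivAt_const t (F p)).inner ℝ (h.deriv p t)
      have hmv : ∀ a ∈ Icc 0 T, ∀ b ∈ Icc 0 T, a ≤ b →
          ‖F p‖ ^ 2 / 2 * (b - a) ≤ inner ℝ (F p) (φ b p) - inner ℝ (F p) (φ a p) :=
        (convex_Icc 0 T).mul_sub_le_image_sub_of_le_deriv
          (fun t _ => (hd t).continuousAt.continuousWithinAt)
          (fun t _ => (hd t).differentiableAt.differentiableWithinAt) (fun t ht => by
            rw [(hd t).deriv]; exact (hT t (interior_subset ht)).2.le)
      have hclose : ∀ a ∈ Icc 0 T, ∀ b ∈ Icc 0 T, a ≤ b → φ a p ∈ Metric.closedBall x r →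
          φ b p ∈ Metric.closedBall x r → b - a ≤ 4 / ‖F p‖ * r := by
        intro a ha b hb hab hax hbx
        have h1 := hmv a ha b hb hab
        rw [← inner_sub_right] at h1
        have h2 := (h1.trans (real_inner_le_norm _ _))
        have h3 : ‖φ b p - φ a p‖ ≤ 2 * r := by
          rw [← dist_eq_norm]
          refine (dist_triangle_right _ _ x).trans ?_
          rw [Metric.mem_closedBall] at hax hbx
          linarith
        have h4 : ‖F p‖ ^ 2 / 2 * (b - a) ≤ ‖F p‖ * (2 * r) := h2.trans (by gcongr)
        rw [div_mul_eq_mul_div, le_div_iff₀ hFp]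
        nlinarith
      have hset : volume ((fun t => φ t p) ⁻¹' Metric.closedBall x r ∩ Icc 0 T) ≤
          ENNReal.ofReal (4 / ‖F p‖ * r) := by
        refine (Real.volume_le_diam _).trans (Metric.ediam_le fun a ha b hb => ?_)
        rw [edist_dist]
        refine ENNReal.ofReal_le_ofReal ?_
        rw [Real.dist_eq, abs_le]
        rcases le_total a b with hab | hab
        · have := hclose a ha.2 b hb.2 hab ha.1 hb.1
          constructor <;> linarith
        · have := hclose b hb.2 a ha.2 hab hb.1 ha.1
          constructor <;> linarith
      rw [Measure.real, Measure.map_apply hm Metric.isClosed_closedBall.measurableSet,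
        Measure.restrict_apply (hm Metric.isClosed_closedBall.measurableSet)]
      refine (ENNReal.toReal_mono ENNReal.ofReal_ne_top hset).trans ?_
      rw [ENNReal.toReal_ofReal (by positivity)]
      simp

end

/-! ### From solvability to global attraction -/

section
variable {N : ℕ} {X : Set (EuclideanSpace ℝ (Fin N))}
  {f F : EuclideanSpace ℝ (Fin N) → EuclideanSpace ℝ (Fin N)}
  {φ : ℝ → EuclideanSpace ℝ (Fin N) → EuclideanSpace ℝ (Fin N)} {K M : ℝ≥0}

theorem LipschitzWith.max_norm_sub (δ : ℝ) :
    LipschitzWith 1 fun x : EuclideanSpace ℝ (Fin N) => max (‖x‖ - δ) 0 := by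
  refine LipschitzWith.max_const (LipschitzWith.of_dist_le_mul fun x y => ?_) 0
  rw [Real.dist_eq, NNReal.coe_one, one_mul, dist_eq_norm, sub_sub_sub_cancel_right]
  exact abs_norm_sub_norm_le x y

theorem ae_mem_closedBall_gradient_eq_zero [Nontrivial (EuclideanSpace ℝ (Fin N))] (δ : ℝ) :
    ∀ᵐ x : EuclideanSpace ℝ (Fin N), x ∈ Metric.closedBall 0 δ →
      gradient (fun x : EuclideanSpace ℝ (Fin N) => max (‖x‖ - δ) 0) x = 0 := by
  have h1 : ∀ᵐ x : EuclideanSpace ℝ (Fin N), x ∉ Metric.sphere 0 δ :=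
    measure_eq_zero_iff_ae_notMem.1 (Measure.addHaar_sphere volume 0 δ)
  filter_upwards [h1] with x hx hxb
  have hlt : ‖x‖ < δ := by
    rw [mem_sphere_zero_iff_norm] at hx
    rw [mem_closedBall_zero_iff] at hxb
    exact lt_of_le_of_ne hxb hx
  have h2 : (fun x : EuclideanSpace ℝ (Fin N) => max (‖x‖ - δ) 0) =ᶠ[𝓝 x] fun _ => 0 := by
    filter_upwards [continuous_norm.continuousAt.eventually (gt_mem_nhds hlt)] with y hy
    exact max_eq_right (by linarith)
  rw [h2.gradient.eq_of_nhds, gradient_fun_const]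

/-- This is the right-hand side used for the converse: zero on the ball, and at least η wherever ‖x‖
≥ δ + η. -/
theorem memKoopmanDomain_max_norm_sub [Nontrivial (EuclideanSpace ℝ (Fin N))]
    {U : Set (EuclideanSpace ℝ (Fin N))} (hU : IsOpen U) (hUb : Bornology.IsBounded U) {δ : ℝ}
    (hδU : Metric.closedBall 0 δ ⊆ U)
    (hΓ : Disjoint (frontier U) (outflowBoundary f (U \ Metric.closedBall 0 δ))) :
    MemKoopmanDomain f (U \ Metric.closedBall 0 δ) fun x => max (‖x‖ - δ) 0 := by
  have hDm : MeasurableSet (U \ Metric.closedBall 0 δ) :=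
    hU.measurableSet.diff Metric.isClosed_closedBall.measurableSet
  have hlip := LipschitzWith.max_norm_sub (N := N) δ
  have : IsFiniteMeasure (volume.restrict (U \ Metric.closedBall 0 δ)) :=
    ⟨by rw [Measure.restrict_apply_univ]; exact (hUb.subset sdiff_subset).measure_lt_top⟩
  obtain ⟨B, hB⟩ := hUb.exists_norm_le
  refine ⟨gradient fun x => max (‖x‖ - δ) 0, ⟨?_, ?_, ?_⟩, ?_⟩
  · refine MemLp.of_bound hlip.continuous.aestronglyMeasurable (B + |δ|) ?_
    filter_upwards [ae_restrict_mem hDm] with x hx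
    have hxB := hB x hx.1
    rw [Real.norm_of_nonneg (le_max_right _ _)]
    refine max_le ?_ (add_nonneg ((norm_nonneg x).trans hxB) (abs_nonneg δ))
    linarith [neg_abs_le δ]
  · refine MemLp.of_bound (measurable_gradient _).aestronglyMeasurable 1
      (Eventually.of_forall fun x => ?_)
    simpa using hlip.norm_gradient_le x
  · exact hlip.hasWeakGradient _
  · refine (hlip.hasWeakGradient U).hasZeroTraceOn hU hδU hΓ (Eventually.of_forall fun x hx => ?_)
      (ae_mem_closedBall_gradient_eq_zero δ)
    rw [mem_closedBall_zero_iff] at hx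
    exact max_eq_right (by linarith)

theorem HasWeakGradient.congr_ae {D : Set (EuclideanSpace ℝ (Fin N))}
    {v w : EuclideanSpace ℝ (Fin N) → ℝ} {G H : EuclideanSpace ℝ (Fin N) → EuclideanSpace ℝ (Fin N)}
    (h : HasWeakGradient D v G)
    (hvw : v =ᵐ[volume.restrict D] w) (hGH : G =ᵐ[volume.restrict D] H) :
    HasWeakGradient D w H :=
  fun ψ hψ hψc hψD => (h ψ hψ hψc hψD).congr_ae hvw hGH

namespace IsInvariantFlow

/-- A square integrable weak solution with positive values rules out trajectories that are not
attracted to `0`. -/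
theorem nonattracted_eq_empty (h : IsInvariantFlow X F φ K M) (hFf : EqOn F f X)
    (hN : N = 2 ∨ N = 3) (hX : HasC1Boundary X) (hfX : N = 3 → ∀ x ∈ frontier X, f x ≠ 0)
    (hs : LyapunovStable f X) {δ : ℝ} (hδ : 0 < δ)
    (hat : ∀ x ∈ X, x ∈ Metric.closedBall 0 δ → Tendsto (fun t => φ t x) atTop (𝓝 0))
    {v : EuclideanSpace ℝ (Fin N) → ℝ} {G : EuclideanSpace ℝ (Fin N) → EuclideanSpace ℝ (Fin N)}
    (hv : MemLp v 2 (volume.restrict (interior X \ Metric.closedBall 0 δ)))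
    (hG : MemLp G 2 (volume.restrict (interior X \ Metric.closedBall 0 δ)))
    (hw : HasWeakGradient (interior X \ Metric.closedBall 0 δ) v G)
    (hfG : ∀ᵐ x ∂(volume.restrict (interior X \ Metric.closedBall 0 δ)),
      inner ℝ (f x) (G x) = - max (‖x‖ - δ) 0)
    (hv0 : ∀ᵐ x ∂(volume.restrict (interior X \ Metric.closedBall 0 δ)), 0 < v x) :
    nonattracted X φ = ∅ := by
  set D := interior X \ Metric.closedBall (0 : EuclideanSpace ℝ (Fin N)) δ with hD
  have hDo : IsOpen D := isOpen_interior.sdiff Metric.isClosed_closedBall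
  have hDm := hDo.measurableSet
  have hDX : D ⊆ X := sdiff_subset.trans interior_subset
  have hDb : Bornology.IsBounded D := h.isCompact.isBounded.subset hDX
  have : IsFiniteMeasure (volume.restrict D) :=
    ⟨by rw [Measure.restrict_apply_univ]; exact hDb.measure_lt_top⟩
  by_contra hne
  obtain ⟨p, hpS, hpX⟩ := h.nonattracted_inter_frontier_nonempty hFf (by omega) hs hδ hat
    (nonempty_iff_ne_empty.2 hne)
  -- measurable representatives
  set v' := hv.1.mk v with hv'
  set G' := hG.1.mk G with hG'
  have hvv : v =ᵐ[volume.restrict D] v' := hv.1.ae_eq_mk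
  have hGG : G =ᵐ[volume.restrict D] G' := hG.1.ae_eq_mk
  have hv'L : MemLp v' 2 (volume.restrict D) := (memLp_congr_ae hvv).1 hv
  have hG'L : MemLp G' 2 (volume.restrict D) := (memLp_congr_ae hGG).1 hG
  have hv'i : IntegrableOn v' D := hv'L.integrable one_le_two
  have hG'i : IntegrableOn G' D := hG'L.integrable one_le_two
  have hw' := hw.congr_ae hvv hGG
  have hFG : ∀ᵐ x ∂(volume.restrict D), inner ℝ (F x) (G' x) = - max (‖x‖ - δ) 0 := by
    filter_upwards [hfG, hGG, ae_restrict_mem hDm] with x h1 h2 hx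
    rw [← h2, hFf (hDX hx), h1]
  have hv'0 : ∀ᵐ x ∂(volume.restrict D), 0 < v' x := by
    filter_upwards [hv0, hvv] with x h1 h2
    rwa [← h2]
  -- the gap between the ball and the trajectories that are not attracted
  obtain ⟨q₀, hq₀, hq₀min⟩ := (h.isCompact_nonattracted hδ hat).exists_isMinOn ⟨p, hpS⟩
    continuous_norm.continuousOn
  have hq₀δ : δ < ‖q₀‖ := by
    by_contra hcon
    exact hq₀.2 (hat q₀ hq₀.1 (mem_closedBall_zero_iff.2 (not_lt.1 hcon)))
  set η := (‖q₀‖ - δ) / 2 with hη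
  have hη0 : 0 < η := by rw [hη]; linarith
  have hgap : ∀ q ∈ nonattracted X φ, δ + 2 * η ≤ ‖q‖ := by
    intro q hq
    have : ‖q₀‖ ≤ ‖q‖ := hq₀min hq
    rw [hη]; linarith
  obtain ⟨n, hn⟩ := hX p hpX
  obtain ⟨ρ₁, hρ₁, hcone⟩ := hn.exists_cone
  obtain ⟨T, hT, hTp, ν, hνf, hν0, hνP, C, hC⟩ := h.isFlow.exists_measure_arc hN h.lipschitz (p := p)
    (fun h3 => by rw [hFf hpS.1]; exact hfX h3 p hpX) hρ₁
  have hPS : (fun t => φ t p) '' Icc 0 T ⊆ nonattracted X φ := by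
    rintro _ ⟨t, ht, rfl⟩
    exact h.mapsTo_nonattracted ht.1 hpS
  -- If exp((K + 1)n) · dist x q ≤ η, then x stays within η of the trajectory of q up to time n,
  -- hence at norm at least δ + η, where the right-hand side is at least η. The rate is K + 1
  -- because A must be positive even if K = 0.
  refine hw'.false_of_log_growth (P := (fun t => φ t p) '' Icc 0 T) (by omega) hv'i hG'L
    (isCompact_Icc.image (h.isFlow.continuous_left p)).isClosed hν0 hνP hC (e := -n) (κ := 1 / 4)
    (ρ := min ρ₁ η) (by norm_num) (lt_min hρ₁ hη0) ?_ (A := K + 1) (c := η) (η := η) (by positivity)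
    hη0 hη0 ?_
  · intro q hq τ hτ y hy
    refine ⟨?_, fun hcon => ?_⟩
    · obtain ⟨t, ht, rfl⟩ := hq
      exact hcone _ (hPS (mem_image_of_mem _ ht)).1 (hTp t ht) τ hτ.1 (hτ.2.trans_le (min_le_left _ _)) y hy
    -- The displacement τ • y is shorter than 2η, the gap between the ball and the points that are
    -- not attracted.
    · have h1 := hgap q (hPS hq)
      have h2 : ‖y‖ ≤ 2 := by
        rw [Metric.mem_closedBall, dist_eq_norm, sub_neg_eq_add] at hy
        have := norm_le_norm_add_norm_sub' y (-n)
        rw [norm_neg, hn.1, sub_neg_eq_add] at this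
        linarith
      have h3 : ‖τ • y‖ < η * 2 := by
        rw [norm_smul, Real.norm_of_nonneg hτ.1.le]
        calc τ * ‖y‖ ≤ τ * 2 := by have := hτ.1; gcongr
          _ < η * 2 := by have := hτ.2.trans_le (min_le_right _ _); gcongr
      rw [mem_closedBall_zero_iff] at hcon
      have h4 := norm_sub_le (q + τ • y) (τ • y)
      rw [add_sub_cancel_right] at h4
      linarith
  · have hlow : ∀ᵐ x, ∀ n : ℕ, (∀ s ∈ Icc 0 (n : ℝ), φ s x ∈ D ∧ η ≤ max (‖φ s x‖ - δ) 0) →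
        η * n ≤ v' x :=
      ae_all_iff.2 fun n => h.isFlow.ae_mul_le h.lipschitz h.bound hDo hDb
        hv.1.stronglyMeasurable_mk.measurable hG.1.stronglyMeasurable_mk.measurable hw' hv'i hG'i hFG
        hv'0 (Nat.cast_nonneg n)
    filter_upwards [ae_restrict_of_ae hlow, ae_restrict_mem hDm] with x hx hxD q hq n hxq
    refine hx n fun s hs => ?_
    have hsq := hgap _ (h.mapsTo_nonattracted hs.1 (hPS hq))
    have hd : dist (φ s x) (φ s q) ≤ η := by
      refine (h.isFlow.dist_le_of_nonneg h.lipschitz hs.1 x q).trans (le_trans ?_ hxq)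
      have h0 := hs.1
      have h1 := hs.2
      gcongr
      linarith
    have hnorm : δ + η ≤ ‖φ s x‖ := by
      rw [dist_eq_norm] at hd
      have := norm_sub_norm_le (φ s q) (φ s x)
      rw [norm_sub_rev] at this
      linarith
    refine ⟨⟨h.mapsTo_interior hs.1 hxD.1, fun hcon => ?_⟩, le_max_of_le_left (by linarith)⟩
    rw [mem_closedBall_zero_iff] at hcon
    linarith

end IsInvariantFlow
end

/-! ### Pulling weak gradients back through the flow -/

theorem memLp_two_iff_lintegral_sq_lt_top {α V : Type*} [MeasurableSpace α] [NormedAddCommGroup V]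
    {μ : Measure α} {g : α → V} (hg : AEStronglyMeasurable g μ) :
    MemLp g 2 μ ↔ ∫⁻ x, ‖g x‖ₑ ^ 2 ∂μ < ⊤ := by
  rw [MemLp, and_iff_right hg,
    eLpNorm_lt_top_iff_lintegral_rpow_enorm_lt_top two_ne_zero ENNReal.ofNat_ne_top]
  simp

theorem sq_lintegral_le {α : Type*} [MeasurableSpace α] {μ : Measure α} {a : α → ℝ≥0∞}
    (ha : AEMeasurable a μ) : (∫⁻ x, a x ∂μ) ^ 2 ≤ μ univ * ∫⁻ x, a x ^ 2 ∂μ := by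
  have h1 := ENNReal.lintegral_mul_le_Lp_mul_Lq μ Real.HolderConjugate.two_two ha
    (aemeasurable_const (b := (1 : ℝ≥0∞)))
  simp only [Pi.mul_apply, mul_one, ENNReal.one_rpow, lintegral_const, one_mul] at h1
  calc (∫⁻ x, a x ∂μ) ^ 2 ≤ ((∫⁻ x, a x ^ (2:ℝ) ∂μ) ^ (1 / (2:ℝ)) * μ univ ^ (1 / (2:ℝ))) ^ 2 := by
        gcongr
    _ = _ := by
        rw [mul_pow, ← ENNReal.rpow_natCast, ← ENNReal.rpow_natCast, ← ENNReal.rpow_mul,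
          ← ENNReal.rpow_mul, mul_comm]
        simp

theorem eq_zero_of_forall_le_const_mul {a c : ℝ≥0∞} (hc : c ≠ ⊤) (h : ∀ ε, 0 < ε → a ≤ c * ε) :
    a = 0 := by
  have h1 : Tendsto (fun ε => c * ε) (𝓝[>] 0) (𝓝 (c * 0)) :=
    (ENNReal.Tendsto.const_mul tendsto_id (Or.inr hc)).mono_left nhdsWithin_le_nhds
  rw [mul_zero] at h1
  exact nonpos_iff_eq_zero.1 (ge_of_tendsto h1 (eventually_mem_nhdsWithin.mono h))

section
variable {N : ℕ} {F : EuclideanSpace ℝ (Fin N) → EuclideanSpace ℝ (Fin N)}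
  {φ : ℝ → EuclideanSpace ℝ (Fin N) → EuclideanSpace ℝ (Fin N)} {K M : ℝ≥0}

theorem gradient_comp_eq_adjoint {u : EuclideanSpace ℝ (Fin N) → ℝ}
    {Φ : EuclideanSpace ℝ (Fin N) → EuclideanSpace ℝ (Fin N)} {x : EuclideanSpace ℝ (Fin N)}
    (hu : DifferentiableAt ℝ u (Φ x)) (hΦ : DifferentiableAt ℝ Φ x) :
    gradient (fun y => u (Φ y)) x =
      ContinuousLinearMap.adjoint (fderiv ℝ Φ x) (gradient u (Φ x)) := by
  refine ext_inner_right ℝ fun y => ?_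
  rw [ContinuousLinearMap.adjoint_inner_left, inner_gradient_left (𝕜 := ℝ), inner_gradient_left (𝕜 := ℝ)]
  have := (hu.hasFDerivAt.comp x hΦ.hasFDerivAt).fderiv
  rw [show (fun y => u (Φ y)) = u ∘ Φ from rfl, this]
  rfl

/-- The pullback of the vector field `H`, viewed as a gradient, under the time-`s` map of `φ`. -/
noncomputable def pullbackGradient (φ : ℝ → EuclideanSpace ℝ (Fin N) → EuclideanSpace ℝ (Fin N))
    (H : EuclideanSpace ℝ (Fin N) → EuclideanSpace ℝ (Fin N)) (s : ℝ) (x : EuclideanSpace ℝ (Fin N)) :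
    EuclideanSpace ℝ (Fin N) :=
  ContinuousLinearMap.adjoint (fderiv ℝ (φ s) x) (H (φ s x))

namespace IsFlow

/-- The bound holds at every x: where φ_s is not differentiable, `fderiv` is zero by default. -/
theorem norm_pullbackGradient_le (h : IsFlow F φ) (hF : LipschitzWith K F)
    (H : EuclideanSpace ℝ (Fin N) → EuclideanSpace ℝ (Fin N)) {s T : ℝ} (hs : |s| ≤ T)
    (x : EuclideanSpace ℝ (Fin N)) :
    ‖pullbackGradient φ H s x‖ ≤ (Real.exp (K * T)).toNNReal * ‖H (φ s x)‖ := by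
  refine (ContinuousLinearMap.le_opNorm _ _).trans ?_
  gcongr
  rw [LinearIsometryEquiv.norm_map]
  refine (norm_fderiv_le_of_lipschitz ℝ (h.lipschitzWith hF s)).trans ?_
  rw [NNReal.coe_le_coe]
  gcongr

theorem measurable_pullbackGradient (h : IsFlow F φ) (hF : LipschitzWith K F) (hM : ∀ x, ‖F x‖ ≤ M)
    {H : EuclideanSpace ℝ (Fin N) → EuclideanSpace ℝ (Fin N)} (hH : Measurable H) :
    Measurable fun p : EuclideanSpace ℝ (Fin N) × ℝ => pullbackGradient φ H p.2 p.1 := by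
  have hc := h.continuous_uncurry hF hM
  have h1 : Measurable fun p : ℝ × EuclideanSpace ℝ (Fin N) => fderiv ℝ (φ p.1) p.2 :=
    measurable_fderiv_with_param ℝ hc
  have h2 : Measurable fun p : EuclideanSpace ℝ (Fin N) × ℝ =>
      ContinuousLinearMap.adjoint (fderiv ℝ (φ p.2) p.1) :=
    (ContinuousLinearMap.adjoint (𝕜 := ℝ) (E := EuclideanSpace ℝ (Fin N))
      (F := EuclideanSpace ℝ (Fin N))).continuous.measurable.comp (h1.comp measurable_swap)
  have h3 : Measurable fun p : EuclideanSpace ℝ (Fin N) × ℝ => H (φ p.2 p.1) :=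
    hH.comp (hc.comp continuous_swap).measurable
  exact ((isBoundedBilinearMap_apply (𝕜 := ℝ) (E := EuclideanSpace ℝ (Fin N))
    (F := EuclideanSpace ℝ (Fin N))).continuous.comp_stronglyMeasurable
    (h2.stronglyMeasurable.prodMk h3.stronglyMeasurable)).measurable

/-- Chain rule for weak gradients under the flow. -/
theorem hasWeakGradient_comp (h : IsFlow F φ) (hF : LipschitzWith K F) (hM : ∀ x, ‖F x‖ ≤ M)
    {U : Set (EuclideanSpace ℝ (Fin N))} (hU : IsOpen U) (hUb : Bornology.IsBounded U)
    {w : EuclideanSpace ℝ (Fin N) → ℝ} {H : EuclideanSpace ℝ (Fin N) → EuclideanSpace ℝ (Fin N)}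
    (hwm : Measurable w) (hHm : Measurable H) (hw : HasWeakGradient U w H) (hwi : IntegrableOn w U)
    (hHi : IntegrableOn H U) {s : ℝ} (hsU : MapsTo (φ s) U U) :
    HasWeakGradient U (fun x => w (φ s x)) (pullbackGradient φ H s) := by
  intro ψ hψ hψc hψU i
  have hφc := h.continuous_right hF s
  set L := (Real.exp (K * |s|)).toNNReal with hL
  have hUm := hU.measurableSet
  set A := tsupport ψ with hA
  have hAc : IsCompact A := hψc
  obtain ⟨B, hB⟩ := hψc.exists_bound_of_continuous hψ.continuous
  have hdc : Continuous fun x => fderiv ℝ ψ x (EuclideanSpace.single i 1) :=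
    (hψ.continuous_fderiv (by simp)).clm_apply continuous_const
  obtain ⟨B', hB'⟩ := (hψc.fderiv_apply ℝ (EuclideanSpace.single i 1)).exists_bound_of_continuous hdc
  have hd0 : ∀ x ∉ A, fderiv ℝ ψ x (EuclideanSpace.single i 1) = 0 := fun x hx => by
    rw [image_eq_zero_of_notMem_tsupport fun hh => hx (tsupport_fderiv_subset ℝ hh)]; rfl
  have hGm : Measurable (pullbackGradient φ H s) := by
    have h1 : Measurable fun x : EuclideanSpace ℝ (Fin N) => (x, s) := measurable_id.prodMk measurable_const
    have h2 := h.measurable_pullbackGradient hF hM hHm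
    have h3 : pullbackGradient φ H s = (fun p : EuclideanSpace ℝ (Fin N) × ℝ =>
      pullbackGradient φ H p.2 p.1) ∘ fun x => (x, s) := funext fun x => rfl
    rw [h3]
    exact h2.comp h1
  have hcoord : ∀ y : EuclideanSpace ℝ (Fin N), ‖y i‖ ≤ ‖y‖ := fun y => PiLp.norm_apply_le y i
  have hwφ : IntegrableOn (fun x => w (φ s x)) U := by
    refine ⟨(hwm.comp hφc.measurable).aestronglyMeasurable, ?_⟩
    refine (h.setLIntegral_comp_le hF le_rfl hwm.enorm hUm hsU).trans_lt ?_
    exact ENNReal.mul_lt_top (ENNReal.pow_lt_top ENNReal.coe_lt_top) hwi.hasFiniteIntegral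
  have hHφ : IntegrableOn (fun x => H (φ s x)) U := by
    refine ⟨(hHm.comp hφc.measurable).aestronglyMeasurable, ?_⟩
    refine (h.setLIntegral_comp_le hF le_rfl hHm.enorm hUm hsU).trans_lt ?_
    exact ENNReal.mul_lt_top (ENNReal.pow_lt_top ENNReal.coe_lt_top) hHi.hasFiniteIntegral
  have hGφ : IntegrableOn (pullbackGradient φ H s) U :=
    (hHφ.norm.const_mul (L : ℝ)).mono' hGm.aestronglyMeasurable
      (Eventually.of_forall fun x => h.norm_pullbackGradient_le hF H le_rfl x)
  have hGi : IntegrableOn (fun x => pullbackGradient φ H s x i) U :=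
    (EuclideanSpace.proj (𝕜 := ℝ) i : EuclideanSpace ℝ (Fin N) →L[ℝ] ℝ).integrable_comp hGφ
  have i1 : IntegrableOn (fun x => w (φ s x) * fderiv ℝ ψ x (EuclideanSpace.single i 1)) U :=
    hwφ.mul_bdd hdc.aestronglyMeasurable (Eventually.of_forall hB')
  have i2 : IntegrableOn (fun x => pullbackGradient φ H s x i * ψ x) U :=
    hGi.mul_bdd hψ.continuous.aestronglyMeasurable (Eventually.of_forall hB)
  set I₁ := ∫ x in U, w (φ s x) * fderiv ℝ ψ x (EuclideanSpace.single i 1)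
  set I₂ := ∫ x in U, pullbackGradient φ H s x i * ψ x
  set c : ℝ≥0∞ := ((L : ℝ≥0∞) ^ N) * (ENNReal.ofReal B' + L * ENNReal.ofReal B) with hc
  have hctop : c ≠ ⊤ := by rw [hc]; finiteness
  -- Approximate w by a smooth u on the compact image of the support of ψ. Then u ∘ φ_s is Lipschitz
  -- and integrates by parts with its almost everywhere gradient, and the error is at most c * ε by
  -- volume distortion.
  have key : ∀ ε : ℝ≥0∞, 0 < ε → ‖I₁ + I₂‖ₑ ≤ c * ε := by
    intro ε hε
    obtain ⟨u, hu, huc, hu1, hu2⟩ := hw.exists_approx hU hUb hwi hHi (hAc.image hφc)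
      ((image_mono hψU).trans hsU.image_subset) hε
    obtain ⟨Lu, hLu⟩ := hu.lipschitzWith_of_hasCompactSupport huc (by simp)
    have hlip := hLu.comp (h.lipschitzWith hF s)
    have h1 := hlip.hasWeakGradient U ψ hψ hψc hψU i
    set g := gradient (fun x => u (φ s x)) with hg
    have hum : Measurable u := hu.continuous.measurable
    have hgum := measurable_gradient u
    have hgm : Measurable g := measurable_gradient _
    have j1 : IntegrableOn (fun x => u (φ s x) * fderiv ℝ ψ x (EuclideanSpace.single i 1)) U := by
      refine Integrable.integrableOn ((Continuous.integrable_of_hasCompactSupport ?_ ?_))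
      · exact (hu.continuous.comp hφc).mul hdc
      · exact HasCompactSupport.mul_left (hψc.fderiv_apply ℝ (EuclideanSpace.single i 1))
    have j2 : IntegrableOn (fun x => g x i * ψ x) U := by
      refine Integrable.integrableOn ?_
      refine (hψ.continuous.integrable_of_hasCompactSupport hψc).bdd_mul
        (c := ((Lu * L : ℝ≥0) : ℝ)) ?_
        (Eventually.of_forall fun x => (hcoord _).trans (hlip.norm_gradient_le x))
      exact ((EuclideanSpace.proj (𝕜 := ℝ) i : EuclideanSpace ℝ (Fin N) →L[ℝ] ℝ).continuous.measurable.comp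
        hgm).aestronglyMeasurable
    have e : I₁ + I₂ =
        ∫ x in U, ((w (φ s x) - u (φ s x)) * fderiv ℝ ψ x (EuclideanSpace.single i 1) +
          (pullbackGradient φ H s x i - g x i) * ψ x) := by
      have h2 : (∫ x in U, u (φ s x) * fderiv ℝ ψ x (EuclideanSpace.single i 1)) +
          ∫ x in U, g x i * ψ x = 0 := by
        rw [← eq_neg_iff_add_eq_zero]; exact h1
      simp_rw [sub_mul]
      have h3 := integral_add (i1.sub j1) (i2.sub j2)
      simp only [Pi.sub_apply] at h3
      rw [h3, integral_sub i1 j1, integral_sub i2 j2]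
      linarith
    have hpt : ∀ᵐ x ∂(volume.restrict U),
        ‖(w (φ s x) - u (φ s x)) * fderiv ℝ ψ x (EuclideanSpace.single i 1) +
          (pullbackGradient φ H s x i - g x i) * ψ x‖ₑ ≤
        A.indicator (fun x => ENNReal.ofReal B' * ‖u (φ s x) - w (φ s x)‖ₑ +
          L * ENNReal.ofReal B * ‖gradient u (φ s x) - H (φ s x)‖ₑ) x := by
      filter_upwards [ae_restrict_of_ae (h.lipschitzWith hF s).ae_differentiableAt] with x hx
      by_cases hxA : x ∈ A
      · rw [indicator_of_mem hxA]
        refine (enorm_add_le _ _).trans (add_le_add ?_ ?_)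
        · rw [enorm_mul, mul_comm, ← enorm_neg (w _ - u _), neg_sub]
          gcongr
          rw [← ofReal_norm]
          exact ENNReal.ofReal_le_ofReal (hB' x)
        · rw [enorm_mul, mul_comm]
          have h3 : ‖pullbackGradient φ H s x i - g x i‖ₑ ≤ L * ‖gradient u (φ s x) - H (φ s x)‖ₑ := by
            rw [← enorm_neg, neg_sub, hg,
              gradient_comp_eq_adjoint (hu.differentiable (by simp) _) hx, pullbackGradient,
              ← PiLp.sub_apply, ← map_sub]
            refine le_trans ?_ (show ENNReal.ofReal (L * ‖gradient u (φ s x) - H (φ s x)‖) ≤ _ from ?_)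
            · rw [← ofReal_norm]
              refine ENNReal.ofReal_le_ofReal ((hcoord _).trans ?_)
              refine (ContinuousLinearMap.le_opNorm _ _).trans ?_
              gcongr
              rw [LinearIsometryEquiv.norm_map]
              exact norm_fderiv_le_of_lipschitz ℝ (h.lipschitzWith hF s)
            · rw [ENNReal.ofReal_mul L.coe_nonneg, ofReal_norm, ENNReal.ofReal_coe_nnreal]
          calc ‖ψ x‖ₑ * ‖pullbackGradient φ H s x i - g x i‖ₑ ≤
                ENNReal.ofReal B * (L * ‖gradient u (φ s x) - H (φ s x)‖ₑ) := by
                gcongr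
                rw [← ofReal_norm]
                exact ENNReal.ofReal_le_ofReal (hB x)
            _ = _ := by ring
      · rw [indicator_of_notMem hxA, hd0 x hxA, image_eq_zero_of_notMem_tsupport hxA]
        simp
    have hAm : MeasurableSet A := (isClosed_tsupport ψ).measurableSet
    have hφA := (hAc.image hφc).isClosed.measurableSet
    rw [e]
    calc _ ≤ _ := enorm_integral_le_lintegral_enorm _
      _ ≤ _ := lintegral_mono_ae hpt
      _ ≤ ∫⁻ x, A.indicator (fun x => ENNReal.ofReal B' * ‖u (φ s x) - w (φ s x)‖ₑ +
          L * ENNReal.ofReal B * ‖gradient u (φ s x) - H (φ s x)‖ₑ) x := setLIntegral_le_lintegral _ _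
      _ = ENNReal.ofReal B' * (∫⁻ x in A, ‖u (φ s x) - w (φ s x)‖ₑ) +
          L * ENNReal.ofReal B * ∫⁻ x in A, ‖gradient u (φ s x) - H (φ s x)‖ₑ := by
          rw [lintegral_indicator hAm, lintegral_add_left, lintegral_const_mul, lintegral_const_mul]
          · exact ((hgum.sub hHm).comp hφc.measurable).enorm
          · exact ((hum.sub hwm).comp hφc.measurable).enorm
          · exact (((hum.sub hwm).comp hφc.measurable).enorm).const_mul _
      _ ≤ ENNReal.ofReal B' * ((L : ℝ≥0∞) ^ N * ε) + L * ENNReal.ofReal B * ((L : ℝ≥0∞) ^ N * ε) := by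
          gcongr
          · exact (h.setLIntegral_comp_le hF le_rfl (hum.sub hwm).enorm hφA (mapsTo_image _ _)).trans
              (by gcongr; exact hu1)
          · exact (h.setLIntegral_comp_le hF le_rfl (hgum.sub hHm).enorm hφA (mapsTo_image _ _)).trans
              (by gcongr; exact hu2)
      _ = c * ε := by rw [hc]; ring
  have hz : ‖I₁ + I₂‖ₑ = 0 := eq_zero_of_forall_le_const_mul hctop key
  exact eq_neg_of_add_eq_zero_left (enorm_eq_zero.1 hz)

end IsFlow
end

/-! ### Averages along the flow -/

/-- The primitive is continuous and vanishes at rational times, so it is zero on (0, 1); almost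
everywhere its derivative is q. With rational times only, countably many null sets have to be
discarded. -/
theorem ae_eq_zero_of_integral_rat_eq_zero {q : ℝ → ℝ} (hq : IntegrableOn q (Ioc 0 1))
    (h : ∀ t : ℚ, 0 ≤ t → t ≤ 1 → ∫ s in Ioc 0 (t : ℝ), q s = 0) :
    ∀ᵐ s ∂(volume.restrict (Ioc 0 1)), q s = 0 := by
  have hqi : IntervalIntegrable q volume 0 1 :=
    (intervalIntegrable_iff_integrableOn_Ioc_of_le zero_le_one).2 hq
  have hcont : ContinuousOn (fun t => ∫ s in (0:ℝ)..t, q s) (Ioo 0 1) := by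
    have h1 := intervalIntegral.continuousOn_primitive_interval' hqi (left_mem_uIcc)
    rw [uIcc_of_le zero_le_one] at h1
    exact h1.mono Ioo_subset_Icc_self
  have hzero : ∀ t ∈ Ioo (0:ℝ) 1, ∫ s in (0:ℝ)..t, q s = 0 := by
    intro t ht
    by_contra hne
    have hopen := hcont.isOpen_inter_preimage isOpen_Ioo (isOpen_compl_singleton (x := (0:ℝ)))
    obtain ⟨r, hr⟩ := Rat.denseRange_cast.exists_mem_open hopen ⟨t, ht, hne⟩
    refine hr.2 ?_
    simp only [mem_singleton_iff]
    rw [intervalIntegral.integral_of_le hr.1.1.le]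
    exact h r (by exact_mod_cast hr.1.1.le) (by exact_mod_cast hr.1.2.le)
  have h1 := hqi.ae_hasDerivAt_integral
  have hne1 : ∀ᵐ s : ℝ, s ≠ 1 := (measure_eq_zero_iff_ae_notMem.1 (Real.volume_singleton (a := 1))).mono
    fun s hs => hs
  rw [ae_restrict_iff' measurableSet_Ioc]
  filter_upwards [h1, hne1] with s hs hs1 hsI
  have hsI' : s ∈ Ioo (0:ℝ) 1 := ⟨hsI.1, lt_of_le_of_ne hsI.2 hs1⟩
  have h2 := hs (by rw [uIcc_of_le zero_le_one]; exact Ioo_subset_Icc_self hsI') 0 left_mem_uIcc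
  refine h2.unique ((hasDerivAt_const s (0:ℝ)).congr_of_eventuallyEq ?_)
  filter_upwards [isOpen_Ioo.mem_nhds hsI'] with t ht using hzero t ht

namespace IsFlow
variable {N : ℕ} {F : EuclideanSpace ℝ (Fin N) → EuclideanSpace ℝ (Fin N)}
  {φ : ℝ → EuclideanSpace ℝ (Fin N) → EuclideanSpace ℝ (Fin N)} {K M : ℝ≥0}
  {U : Set (EuclideanSpace ℝ (Fin N))} {T : ℝ}
  {w : EuclideanSpace ℝ (Fin N) → ℝ} {H : EuclideanSpace ℝ (Fin N) → EuclideanSpace ℝ (Fin N)}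

theorem measurable_comp_uncurry (h : IsFlow F φ) (hF : LipschitzWith K F) (hM : ∀ x, ‖F x‖ ≤ M)
    {β : Type*} [MeasurableSpace β] {g : EuclideanSpace ℝ (Fin N) → β} (hg : Measurable g) :
    Measurable fun p : EuclideanSpace ℝ (Fin N) × ℝ => g (φ p.2 p.1) :=
  hg.comp ((h.continuous_uncurry hF hM).comp continuous_swap).measurable

theorem integrable_comp_prod {V : Type*} [NormedAddCommGroup V] [MeasurableSpace V] [BorelSpace V]
    [SecondCountableTopology V] (h : IsFlow F φ) (hF : LipschitzWith K F)
    (hM : ∀ x, ‖F x‖ ≤ M) (hU : MeasurableSet U) (hsU : ∀ s ∈ Icc 0 T, MapsTo (φ s) U U)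
    {g : EuclideanSpace ℝ (Fin N) → V} (hg : Measurable g) (hgi : IntegrableOn g U) :
    Integrable (fun p : EuclideanSpace ℝ (Fin N) × ℝ => g (φ p.2 p.1))
      ((volume.restrict U).prod (volume.restrict (Ioc 0 T))) := by
  have hm := h.measurable_comp_uncurry hF hM hg
  refine ⟨hm.aestronglyMeasurable, ?_⟩
  rw [hasFiniteIntegral_iff_enorm, lintegral_prod _ hm.enorm.aemeasurable]
  refine (h.setLIntegral_lintegral_comp_le hF hM hg.enorm hU hsU).trans_lt ?_
  exact ENNReal.mul_lt_top ENNReal.ofReal_lt_top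
    (ENNReal.mul_lt_top (ENNReal.pow_lt_top ENNReal.coe_lt_top) hgi.hasFiniteIntegral)

theorem integrable_pullbackGradient_prod (h : IsFlow F φ) (hF : LipschitzWith K F)
    (hM : ∀ x, ‖F x‖ ≤ M) (hU : MeasurableSet U) (hsU : ∀ s ∈ Icc 0 T, MapsTo (φ s) U U)
    (hHm : Measurable H) (hHi : IntegrableOn H U) :
    Integrable (fun p : EuclideanSpace ℝ (Fin N) × ℝ => pullbackGradient φ H p.2 p.1)
      ((volume.restrict U).prod (volume.restrict (Ioc 0 T))) := by
  refine ((h.integrable_comp_prod hF hM hU hsU hHm hHi).norm.const_mul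
    ((Real.exp (K * T)).toNNReal : ℝ)).mono'
    (h.measurable_pullbackGradient hF hM hHm).aestronglyMeasurable ?_
  rw [Measure.prod_restrict]
  filter_upwards [ae_restrict_mem (hU.prod measurableSet_Ioc)] with p hp
  exact h.norm_pullbackGradient_le hF H (by rw [abs_of_pos hp.2.1]; exact hp.2.2) p.1

/-- Averaging along the flow commutes with weak differentiation. -/
theorem hasWeakGradient_integral_comp (h : IsFlow F φ) (hF : LipschitzWith K F)
    (hM : ∀ x, ‖F x‖ ≤ M) (hU : IsOpen U) (hUb : Bornology.IsBounded U)
    (hsU : ∀ s ∈ Icc 0 T, MapsTo (φ s) U U) (hwm : Measurable w) (hHm : Measurable H)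
    (hw : HasWeakGradient U w H) (hwi : IntegrableOn w U) (hHi : IntegrableOn H U) :
    HasWeakGradient U (fun x => ∫ s in Ioc 0 T, w (φ s x))
      (fun x => ∫ s in Ioc 0 T, pullbackGradient φ H s x) := by
  intro ψ hψ hψc hψU i
  have hUm := hU.measurableSet
  obtain ⟨B, hB⟩ := hψc.exists_bound_of_continuous hψ.continuous
  have hdc : Continuous fun x => fderiv ℝ ψ x (EuclideanSpace.single i 1) :=
    (hψ.continuous_fderiv (by simp)).clm_apply continuous_const
  obtain ⟨B', hB'⟩ := (hψc.fderiv_apply ℝ (EuclideanSpace.single i 1)).exists_bound_of_continuous hdc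
  have hwp := h.integrable_comp_prod hF hM hUm hsU hwm hwi
  have hGp := h.integrable_pullbackGradient_prod hF hM hUm hsU hHm hHi
  have hGpi : Integrable (fun p : EuclideanSpace ℝ (Fin N) × ℝ => pullbackGradient φ H p.2 p.1 i)
      ((volume.restrict U).prod (volume.restrict (Ioc 0 T))) :=
    (EuclideanSpace.proj (𝕜 := ℝ) i : EuclideanSpace ℝ (Fin N) →L[ℝ] ℝ).integrable_comp hGp
  have i1 : Integrable (fun p : EuclideanSpace ℝ (Fin N) × ℝ =>
      w (φ p.2 p.1) * fderiv ℝ ψ p.1 (EuclideanSpace.single i 1))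
      ((volume.restrict U).prod (volume.restrict (Ioc 0 T))) :=
    hwp.mul_bdd (hdc.comp continuous_fst).aestronglyMeasurable (Eventually.of_forall fun p => hB' p.1)
  have i2 : Integrable (fun p : EuclideanSpace ℝ (Fin N) × ℝ =>
      pullbackGradient φ H p.2 p.1 i * ψ p.1)
      ((volume.restrict U).prod (volume.restrict (Ioc 0 T))) :=
    hGpi.mul_bdd (hψ.continuous.comp continuous_fst).aestronglyMeasurable
      (Eventually.of_forall fun p => hB p.1)
  calc ∫ x in U, (∫ s in Ioc 0 T, w (φ s x)) * fderiv ℝ ψ x (EuclideanSpace.single i 1)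
      = ∫ x in U, ∫ s in Ioc 0 T, w (φ s x) * fderiv ℝ ψ x (EuclideanSpace.single i 1) := by
        simp_rw [integral_mul_const]
    _ = ∫ s in Ioc 0 T, ∫ x in U, w (φ s x) * fderiv ℝ ψ x (EuclideanSpace.single i 1) :=
        integral_integral_swap i1
    _ = ∫ s in Ioc 0 T, - ∫ x in U, pullbackGradient φ H s x i * ψ x := by
        refine setIntegral_congr_fun measurableSet_Ioc fun s hs => ?_
        exact h.hasWeakGradient_comp hF hM hU hUb hwm hHm hw hwi hHi
          (hsU s (Ioc_subset_Icc_self hs)) ψ hψ hψc hψU i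
    _ = - ∫ x in U, ∫ s in Ioc 0 T, pullbackGradient φ H s x i * ψ x := by
        rw [integral_neg]
        exact congrArg Neg.neg (integral_integral_swap i2).symm
    _ = - ∫ x in U, (∫ s in Ioc 0 T, pullbackGradient φ H s x) i * ψ x := by
        congr 1
        refine integral_congr_ae ?_
        filter_upwards [hGp.prod_right_ae] with x hx
        rw [integral_mul_const]
        congr 1
        exact (EuclideanSpace.proj (𝕜 := ℝ) i : EuclideanSpace ℝ (Fin N) →L[ℝ] ℝ).integral_comp_comm hx

/-- Cauchy–Schwarz in time, then Tonelli and volume distortion. The integrand b is kept general to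
cover both the average and its gradient. -/
theorem memLp_integral_comp {V W : Type*} [NormedAddCommGroup V] [MeasurableSpace V] [BorelSpace V]
    [SecondCountableTopology V] [NormedAddCommGroup W] [NormedSpace ℝ W]
    (h : IsFlow F φ) (hF : LipschitzWith K F)
    (hM : ∀ x, ‖F x‖ ≤ M) (hU : MeasurableSet U) (hsU : ∀ s ∈ Icc 0 T, MapsTo (φ s) U U)
    {g : EuclideanSpace ℝ (Fin N) → V} (hg : Measurable g) (hg2 : MemLp g 2 (volume.restrict U))
    {b : EuclideanSpace ℝ (Fin N) × ℝ → W} (hb : StronglyMeasurable b) {c : ℝ≥0}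
    (hbg : ∀ x, ∀ s ∈ Icc 0 T, ‖b (x, s)‖ ≤ c * ‖g (φ s x)‖) :
    MemLp (fun x => ∫ s in Ioc 0 T, b (x, s)) 2 (volume.restrict U) := by
  rw [memLp_two_iff_lintegral_sq_lt_top hb.integral_prod_right'.aestronglyMeasurable]
  rw [memLp_two_iff_lintegral_sq_lt_top hg2.1] at hg2
  have hgm : Measurable fun x => ‖g x‖ₑ ^ 2 := hg.enorm.pow_const 2
  have hpt : ∀ x, ‖∫ s in Ioc 0 T, b (x, s)‖ₑ ^ 2 ≤
      ENNReal.ofReal T * (c : ℝ≥0∞) ^ 2 * ∫⁻ s in Ioc 0 T, ‖g (φ s x)‖ₑ ^ 2 := by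
    intro x
    have hgx : Measurable fun s => ‖g (φ s x)‖ₑ := (hg.comp (h.continuous_left x).measurable).enorm
    calc ‖∫ s in Ioc 0 T, b (x, s)‖ₑ ^ 2 ≤ (∫⁻ s in Ioc 0 T, (c : ℝ≥0∞) * ‖g (φ s x)‖ₑ) ^ 2 := by
          gcongr
          refine (enorm_integral_le_lintegral_enorm _).trans
            (setLIntegral_mono (hgx.const_mul _) fun s hs => ?_)
          have h1 := ENNReal.ofReal_le_ofReal (hbg x s (Ioc_subset_Icc_self hs))
          rwa [ofReal_norm, ENNReal.ofReal_mul c.coe_nonneg, ofReal_norm, ENNReal.ofReal_coe_nnreal] at h1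
      _ ≤ (volume.restrict (Ioc 0 T)) univ * ∫⁻ s in Ioc 0 T, ((c : ℝ≥0∞) * ‖g (φ s x)‖ₑ) ^ 2 :=
          sq_lintegral_le (hgx.const_mul _).aemeasurable
      _ = _ := by
          simp_rw [mul_pow]
          rw [lintegral_const_mul _ (hgx.pow_const 2), Measure.restrict_apply_univ, Real.volume_Ioc,
            sub_zero, mul_assoc]
  refine (lintegral_mono hpt).trans_lt ?_
  rw [lintegral_const_mul']
  · refine ENNReal.mul_lt_top (by finiteness) ?_
    refine (h.setLIntegral_lintegral_comp_le hF hM hgm hU hsU).trans_lt ?_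
    exact ENNReal.mul_lt_top ENNReal.ofReal_lt_top
      (ENNReal.mul_lt_top (ENNReal.pow_lt_top ENNReal.coe_lt_top) hg2)
  · finiteness

end IsFlow

/-! ### The equation and the sign of the average -/

namespace IsFlow
variable {N : ℕ} {F : EuclideanSpace ℝ (Fin N) → EuclideanSpace ℝ (Fin N)}
  {φ : ℝ → EuclideanSpace ℝ (Fin N) → EuclideanSpace ℝ (Fin N)} {K M : ℝ≥0}
  {U : Set (EuclideanSpace ℝ (Fin N))} {T : ℝ}
  {w q : EuclideanSpace ℝ (Fin N) → ℝ} {G : EuclideanSpace ℝ (Fin N) → EuclideanSpace ℝ (Fin N)}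

/-- Moving the window [0, T] by t drops [0, t] and adds [T, T + t], where w vanishes along the
trajectory. -/
theorem integral_comp_sub_integral_comp (h : IsFlow F φ) (hF : LipschitzWith K F) (hT : 0 ≤ T)
    {x : EuclideanSpace ℝ (Fin N)} (hx : ∀ s, T ≤ s → w (φ s x) = 0) {t : ℝ} (ht : 0 ≤ t)
    (hi : IntegrableOn (fun s => w (φ s x)) (Ioc 0 (T + t))) :
    (∫ s in Ioc 0 T, w (φ s (φ t x))) - ∫ s in Ioc 0 T, w (φ s x) = - ∫ s in Ioc 0 t, w (φ s x) := by
  simp_rw [← h.add hF]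
  rw [← intervalIntegral.integral_of_le hT, ← intervalIntegral.integral_of_le hT,
    ← intervalIntegral.integral_of_le ht,
    intervalIntegral.integral_comp_add_right (fun s => w (φ s x)) t, zero_add]
  have hint : ∀ a b, 0 ≤ a → a ≤ b → b ≤ T + t → IntervalIntegrable (fun s => w (φ s x)) volume a b :=
    fun a b ha hab hb => (intervalIntegrable_iff_integrableOn_Ioc_of_le hab).2
      (hi.mono_set (Ioc_subset_Ioc ha hb))
  have h1 := intervalIntegral.integral_add_adjacent_intervals (hint 0 t le_rfl ht (by linarith))
    (hint t (T + t) ht (by linarith) le_rfl)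
  have h2 := intervalIntegral.integral_add_adjacent_intervals (hint 0 T le_rfl hT (by linarith))
    (hint T (T + t) hT (by linarith) le_rfl)
  have h3 : ∫ s in T..(T + t), w (φ s x) = 0 := by
    rw [intervalIntegral.integral_of_le (by linarith)]
    exact setIntegral_eq_zero_of_forall_eq_zero fun s hs => hx s hs.1.le
  linarith

/-- By Fubini there are times s n → 0 with q ∘ φ_{s n} = 0 almost everywhere on U. Transport by
φ_{-s n} carries this back to y itself: although U need not be backward invariant, φ_{-s n} y is in
the open set U for large n. -/
theorem ae_eq_zero_of_ae_ae_comp (h : IsFlow F φ) (hF : LipschitzWith K F) (hM : ∀ x, ‖F x‖ ≤ M)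
    (hU : IsOpen U) (hq : Measurable q)
    (hqs : ∀ᵐ x ∂(volume.restrict U), ∀ᵐ s ∂(volume.restrict (Ioc (0:ℝ) 1)), q (φ s x) = 0) :
    ∀ᵐ x ∂(volume.restrict U), q x = 0 := by
  have hm : MeasurableSet {p : EuclideanSpace ℝ (Fin N) × ℝ | q (φ p.2 p.1) = 0} :=
    (h.measurable_comp_uncurry hF hM hq) (measurableSet_singleton 0)
  have h1 := (Measure.ae_ae_comm (p := fun x s => q (φ s x) = 0) hm).1 hqs
  have h2 : ∀ n : ℕ, ∃ s ∈ Ioc (0:ℝ) (1 / (n + 1)), ∀ᵐ x ∂(volume.restrict U), q (φ s x) = 0 := by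
    intro n
    have hn : (0:ℝ) < 1 / (n + 1) := by positivity
    have hsub : Ioc (0:ℝ) (1 / (n + 1)) ⊆ Ioc 0 1 :=
      Ioc_subset_Ioc_right ((div_le_one (by positivity)).2 (by simp))
    have h3 := ae_restrict_of_ae_restrict_of_subset hsub h1
    have : (ae (volume.restrict (Ioc (0:ℝ) (1 / (n + 1))))).NeBot := by
      rw [ae_neBot, Ne, Measure.restrict_eq_zero, Real.volume_Ioc]
      simpa using hn
    obtain ⟨s, hs1, hs2⟩ := (h3.and (ae_restrict_mem measurableSet_Ioc)).exists
    exact ⟨s, hs2, hs1⟩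
  choose s hs hsq using h2
  have hs0 : Tendsto s atTop (𝓝 0) :=
    squeeze_zero (fun n => (hs n).1.le) (fun n => (hs n).2) tendsto_one_div_add_atTop_nhds_zero_nat
  have h4 : ∀ᵐ y, ∀ n, φ (-s n) y ∈ U → q y = 0 := by
    refine ae_all_iff.2 fun n => ?_
    have h5 := (h.quasiMeasurePreserving hF (-s n)).ae ((ae_restrict_iff' hU.measurableSet).1 (hsq n))
    filter_upwards [h5] with y hy hyU
    simpa only [h.apply_neg hF] using hy hyU
  rw [ae_restrict_iff' hU.measurableSet]
  filter_upwards [h4] with y hy hyU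
  have h6 : Tendsto (fun n => φ (-s n) y) atTop (𝓝 y) := by
    have h7 := ((h.continuous_left y).tendsto 0).comp (by simpa using hs0.neg : Tendsto (fun n => -s n) atTop (𝓝 0))
    rwa [h.zero] at h7
  obtain ⟨n, hn⟩ := (h6.eventually (hU.mem_nhds hyU)).exists
  exact hy n hn

/-- The average of `w` along the flow solves `F · ∇v = -w`, if `w` vanishes at late times. -/
theorem ae_inner_eq_neg (h : IsFlow F φ) (hF : LipschitzWith K F) (hM : ∀ x, ‖F x‖ ≤ M)
    (hU : IsOpen U) (hUb : Bornology.IsBounded U) (hT : 0 ≤ T)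
    (hsU : ∀ s, 0 ≤ s → MapsTo (φ s) U U) (hwm : Measurable w) (hwi : IntegrableOn w U)
    (hwT : ∀ x ∈ U, ∀ s, T ≤ s → w (φ s x) = 0)
    (hGm : Measurable G) (hG : IntegrableOn G U)
    (hv : IntegrableOn (fun x => ∫ s in Ioc 0 T, w (φ s x)) U)
    (hvG : HasWeakGradient U (fun x => ∫ s in Ioc 0 T, w (φ s x)) G) :
    ∀ᵐ x ∂(volume.restrict U), inner ℝ (F x) (G x) = - w x := by
  have hUm := hU.measurableSet
  have hvm : Measurable fun x => ∫ s in Ioc 0 T, w (φ s x) :=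
    (h.measurable_comp_uncurry hF hM hwm).stronglyMeasurable.integral_prod_right'.measurable
  have hqm : Measurable fun x => inner ℝ (F x) (G x) + w x :=
    (hF.continuous.measurable.inner hGm).add hwm
  have hwx := (h.integrable_comp_prod hF hM hUm (T := T + 1)
    (fun s hs => hsU s hs.1) hwm hwi).prod_right_ae
  have hac : ∀ t, 0 ≤ t → ∀ᵐ x ∂(volume.restrict U), IntegrableOn (fun s => G (φ s x)) (Ioc 0 t) ∧
      (∫ s in Ioc 0 T, w (φ s (φ t x))) - ∫ s in Ioc 0 T, w (φ s x) =
        ∫ s in Ioc 0 t, inner ℝ (F (φ s x)) (G (φ s x)) := by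
    intro t ht
    rw [ae_restrict_iff' hUm]
    filter_upwards [h.ae_sub_eq_integral hF hM hU hUb hvm hGm hvG hv hG ht] with x hx hxU
    exact hx fun s hs => hsU s hs.1 hxU
  have hrat : ∀ᵐ x ∂(volume.restrict U), ∀ t : ℚ, 0 ≤ t →
      (∫ s in Ioc 0 T, w (φ s (φ t x))) - ∫ s in Ioc 0 T, w (φ s x) =
        ∫ s in Ioc 0 (t : ℝ), inner ℝ (F (φ s x)) (G (φ s x)) := by
    refine ae_all_iff.2 fun t => ?_
    by_cases ht : 0 ≤ t
    · filter_upwards [hac t (by exact_mod_cast ht)] with x hx _ using hx.2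
    · exact Eventually.of_forall fun x ht' => absurd ht' ht
  -- The increment of the average up to time t is the integral of F·G along the trajectory, and by
  -- the shifted window also minus the integral of w. So F·G + w has integral zero over [0, t] for
  -- all rational t in [0, 1].
  have key : ∀ᵐ x ∂(volume.restrict U), inner ℝ (F x) (G x) + w x = 0 := by
    refine h.ae_eq_zero_of_ae_ae_comp hF hM hU hqm ?_
    filter_upwards [hwx, hac 1 zero_le_one, hrat, ae_restrict_mem hUm] with x h1 h2 h3 hxU
    have hFi : IntegrableOn (fun s => inner ℝ (F (φ s x)) (G (φ s x))) (Ioc 0 1) := by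
      refine Integrable.mono' (h2.1.norm.const_mul (M : ℝ)) ?_ (Eventually.of_forall fun s => ?_)
      · exact ((hF.continuous.comp (h.continuous_left x)).aestronglyMeasurable).inner
          h2.1.aestronglyMeasurable
      · refine (norm_inner_le_norm _ _).trans ?_
        gcongr
        exact hM _
    have hwI : IntegrableOn (fun s => w (φ s x)) (Ioc 0 (T + 1)) := h1
    have hwI1 : IntegrableOn (fun s => w (φ s x)) (Ioc 0 1) :=
      hwI.mono_set (Ioc_subset_Ioc_right (by linarith))
    refine ae_eq_zero_of_integral_rat_eq_zero (hFi.add hwI1) fun t ht0 ht1 => ?_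
    have ht0' : (0:ℝ) ≤ t := by exact_mod_cast ht0
    have ht1' : (t:ℝ) ≤ 1 := by exact_mod_cast ht1
    have e1 := h3 t ht0
    rw [h.integral_comp_sub_integral_comp hF hT (hwT x hxU) ht0'
      (hwI.mono_set (Ioc_subset_Ioc_right (by linarith)))] at e1
    have e2 := integral_add (hFi.mono_set (Ioc_subset_Ioc_right ht1'))
      (hwI1.mono_set (Ioc_subset_Ioc_right ht1'))
    rw [e2, ← e1]
    ring
  filter_upwards [key] with x hx
  linarith

/-- The average of `w` along the flow is positive where `w` is. -/
theorem ae_integral_comp_pos (h : IsFlow F φ) (hF : LipschitzWith K F) (hM : ∀ x, ‖F x‖ ≤ M)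
    {D : Set (EuclideanSpace ℝ (Fin N))} (hU : IsOpen U) (hD : IsOpen D) (hDU : D ⊆ U) (hT : 0 < T)
    (hsU : ∀ s, 0 ≤ s → MapsTo (φ s) U U) (hwm : Measurable w) (hwi : IntegrableOn w U)
    (hw0 : ∀ᵐ x, 0 ≤ w x) (hw : ∀ᵐ x, x ∈ D → 0 < w x) :
    ∀ᵐ x ∂(volume.restrict D), 0 < ∫ s in Ioc 0 T, w (φ s x) := by
  have hwx := ae_restrict_of_ae_restrict_of_subset hDU (h.integrable_comp_prod hF hM hU.measurableSet (T := T)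
    (fun s hs => hsU s hs.1) hwm hwi).prod_right_ae
  filter_upwards [hwx, ae_restrict_of_ae (h.ae_ae_comp hF hM hw0 T),
    ae_restrict_of_ae (h.ae_ae_comp hF hM hw T), ae_restrict_mem hD.measurableSet] with x h1 h2 h3 hxD
  rw [integral_pos_iff_support_of_nonneg_ae h2 h1]
  have hev : ∀ᶠ s in 𝓝 (0:ℝ), φ s x ∈ D :=
    (h.continuous_left x).continuousAt.eventually (hD.mem_nhds (by simpa only [h.zero] using hxD))
  obtain ⟨ε, hε, hε'⟩ := Metric.eventually_nhds_iff.1 hev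
  have hεT : 0 < min (ε / 2) T := lt_min (by positivity) hT
  have hsub : Ioc 0 (min (ε / 2) T) ⊆ Ioc 0 T := Ioc_subset_Ioc_right (min_le_right _ _)
  -- For a short initial time the trajectory is still in the open set D, where w > 0.
  have h4 : (volume.restrict (Ioc 0 T)) (Ioc 0 (min (ε / 2) T)) ≤
      (volume.restrict (Ioc 0 T)) (Function.support fun s => w (φ s x)) := by
    refine measure_mono_ae ?_
    filter_upwards [h3] with s hs hsI
    have hsI' : s ∈ Ioc 0 (min (ε / 2) T) := hsI
    refine (hs (hε' ?_)).ne'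
    rw [Real.dist_eq, sub_zero, abs_of_pos hsI'.1]
    linarith [hsI'.2.trans (min_le_left _ _)]
  refine lt_of_lt_of_le ?_ h4
  rw [Measure.restrict_apply measurableSet_Ioc, inter_eq_left.2 hsub, Real.volume_Ioc]
  simpa using hεT

end IsFlow

/-! ### From global attraction to solvability -/

section
variable {N : ℕ} {X : Set (EuclideanSpace ℝ (Fin N))}
  {f F : EuclideanSpace ℝ (Fin N) → EuclideanSpace ℝ (Fin N)}
  {φ : ℝ → EuclideanSpace ℝ (Fin N) → EuclideanSpace ℝ (Fin N)} {K M : ℝ≥0}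

/-- If `0` attracts all of `X`, the average of a positive element of the domain of the Koopman
generator along the flow solves the Koopman equation. -/
theorem IsInvariantFlow.exists_solvesKoopman (h : IsInvariantFlow X F φ K M) (hFf : EqOn F f X)
    (hs : LyapunovStable f X) (hat : ∀ x ∈ X, Tendsto (fun t => φ t x) atTop (𝓝 0))
    {δ : ℝ} (hδ : 0 < δ) (hδX : Metric.closedBall 0 δ ⊆ interior X)
    (hin : ∀ p ∈ Metric.sphere 0 δ, inner ℝ (F p) p < 0)
    (hout : Metric.sphere 0 δ ⊆ outflowBoundary f (interior X \ Metric.closedBall 0 δ))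
    (hΓ : Disjoint (frontier (interior X)) (outflowBoundary f (interior X \ Metric.closedBall 0 δ)))
    {v₀ : EuclideanSpace ℝ (Fin N) → ℝ}
    (hv₀ : MemKoopmanDomain f (interior X \ Metric.closedBall 0 δ) v₀)
    (hpos : ∀ᵐ x ∂(volume.restrict (interior X \ Metric.closedBall 0 δ)), 0 < v₀ x) :
    ∃ v : EuclideanSpace ℝ (Fin N) → ℝ,
      SolvesKoopman f (interior X \ Metric.closedBall 0 δ) v (fun x => - v₀ x) ∧
      ∀ᵐ x ∂(volume.restrict (interior X \ Metric.closedBall 0 δ)), 0 < v x := by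
  set U := interior X with hU
  have hUo : IsOpen U := isOpen_interior
  have hUm := hUo.measurableSet
  have hUb : Bornology.IsBounded U := h.isCompact.isBounded.subset interior_subset
  have hUf : IsFiniteMeasure (volume.restrict U) :=
    ⟨by rw [Measure.restrict_apply_univ]; exact hUb.measure_lt_top⟩
  set D := U \ Metric.closedBall (0 : EuclideanSpace ℝ (Fin N)) δ with hD
  have hDo : IsOpen D := hUo.sdiff Metric.isClosed_closedBall
  have hDm := hDo.measurableSet
  have hDU : D ⊆ U := sdiff_subset
  obtain ⟨T', hT', hlate⟩ := h.exists_uniform_time hFf hs h.isCompact subset_rfl hat hδ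
  -- The extra unit makes the averaging time positive, as positivity of the average requires.
  set T := T' + 1 with hTdef
  have hT : 0 < T := by linarith
  have hsU : ∀ s, 0 ≤ s → MapsTo (φ s) U U := fun s hs => h.mapsTo_interior hs
  obtain ⟨G₀, ⟨hv, hG, -⟩, htr⟩ := hv₀
  set v' := hv.1.mk v₀ with hv'
  set G' := hG.1.mk G₀ with hG'
  have hvv : v₀ =ᵐ[volume.restrict D] v' := hv.1.ae_eq_mk
  have hGG : G₀ =ᵐ[volume.restrict D] G' := hG.1.ae_eq_mk
  have htr' : HasZeroTraceOn D (outflowBoundary f D) v' G' :=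
    fun ψ hψ hψc hψD => (htr ψ hψ hψc hψD).congr_ae hvv hGG
  set w := D.indicator v' with hw
  set H := D.indicator G' with hH
  have hwm : Measurable w := hv.1.stronglyMeasurable_mk.measurable.indicator hDm
  have hHm : Measurable H := hG.1.stronglyMeasurable_mk.measurable.indicator hDm
  have hrr : (volume.restrict U).restrict D = volume.restrict D := by
    rw [Measure.restrict_restrict hDm, inter_eq_left.2 hDU]
  have hwL : MemLp w 2 (volume.restrict U) := by
    rw [hw, memLp_indicator_iff_restrict hDm, hrr]
    exact (memLp_congr_ae hvv).1 hv
  have hHL : MemLp H 2 (volume.restrict U) := by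
    rw [hH, memLp_indicator_iff_restrict hDm, hrr]
    exact (memLp_congr_ae hGG).1 hG
  have hwi : IntegrableOn w U := hwL.integrable one_le_two
  have hHi : IntegrableOn H U := hHL.integrable one_le_two
  -- The zero trace on the sphere allows extension by zero without a jump, so that w has a weak
  -- gradient on all of U.
  have hwH : HasWeakGradient U w H := htr'.hasWeakGradient_indicator hUo hδ hout
  have hDball : ∀ x : EuclideanSpace ℝ (Fin N), ‖x‖ ≤ δ → x ∉ D := fun x hx hxD =>
    hxD.2 (mem_closedBall_zero_iff.2 hx)
  -- The ball is forward invariant, so the average and its gradient vanish in it; this yields the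
  -- zero trace on the sphere.
  have hflowball : ∀ x ∈ Metric.closedBall (0 : EuclideanSpace ℝ (Fin N)) δ, ∀ s ∈ Ioc 0 T, φ s x ∉ D :=
    fun x hx s hs => hDball _ (h.isFlow.norm_le_of_inner_neg hin (mem_closedBall_zero_iff.1 hx) hs.1.le)
  have hwT : ∀ x ∈ U, ∀ s, T ≤ s → w (φ s x) = 0 := fun x hx s hs =>
    indicator_of_notMem (hDball _ (hlate x (interior_subset hx) s (by linarith)).le) _
  have hVG := h.isFlow.hasWeakGradient_integral_comp h.lipschitz h.bound hUo hUb (T := T)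
    (fun s hs => hsU s hs.1) hwm hHm hwH hwi hHi
  have hvL : MemLp (fun x => ∫ s in Ioc 0 T, w (φ s x)) 2 (volume.restrict U) :=
    h.isFlow.memLp_integral_comp h.lipschitz h.bound hUm (fun s hs => hsU s hs.1) hwm hwL
      (h.isFlow.measurable_comp_uncurry h.lipschitz h.bound hwm).stronglyMeasurable (c := 1)
      fun x s _ => by simp
  have hGm := (h.isFlow.measurable_pullbackGradient h.lipschitz h.bound hHm).stronglyMeasurable
  have hGL : MemLp (fun x => ∫ s in Ioc 0 T, pullbackGradient φ H s x) 2 (volume.restrict U) :=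
    h.isFlow.memLp_integral_comp h.lipschitz h.bound hUm (fun s hs => hsU s hs.1) hHm hHL hGm
      fun x s hs => h.isFlow.norm_pullbackGradient_le h.lipschitz H
        (by rw [abs_of_nonneg hs.1]; exact hs.2) x
  have htrace : HasZeroTraceOn D (outflowBoundary f D) (fun x => ∫ s in Ioc 0 T, w (φ s x))
      (fun x => ∫ s in Ioc 0 T, pullbackGradient φ H s x) := by
    refine hVG.hasZeroTraceOn hUo hδX hΓ (Eventually.of_forall fun x hx => ?_)
      (Eventually.of_forall fun x hx => ?_)
    · exact setIntegral_eq_zero_of_forall_eq_zero fun s hs =>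
        indicator_of_notMem (hflowball x hx s hs) _
    · refine setIntegral_eq_zero_of_forall_eq_zero fun s hs => ?_
      rw [pullbackGradient, hH, indicator_of_notMem (hflowball x hx s hs), map_zero]
  have hmono : volume.restrict D ≤ volume.restrict U := Measure.restrict_mono_set _ hDU
  refine ⟨fun x => ∫ s in Ioc 0 T, w (φ s x), ⟨fun x => ∫ s in Ioc 0 T, pullbackGradient φ H s x,
    ⟨hvL.mono_measure hmono, hGL.mono_measure hmono, htrace.hasWeakGradient hDo⟩, htrace, ?_⟩, ?_⟩
  · have h1 := h.isFlow.ae_inner_eq_neg h.lipschitz h.bound hUo hUb hT.le hsU hwm hwi hwT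
      hGm.integral_prod_right'.measurable (hGL.integrable one_le_two) (hvL.integrable one_le_two) hVG
    filter_upwards [ae_restrict_of_ae_restrict_of_subset hDU h1, hvv, ae_restrict_mem hDm] with x h2 h3 hx
    rw [← hFf (interior_subset (hDU hx)), h2, h3, hw, indicator_of_mem hx]
  · have hpos' : ∀ᵐ x, x ∈ D → 0 < w x := by
      rw [← ae_restrict_iff' hDm]
      filter_upwards [hpos, hvv, ae_restrict_mem hDm] with x h1 h2 hx
      rwa [hw, indicator_of_mem hx, ← h2]
    refine h.isFlow.ae_integral_comp_pos h.lipschitz h.bound hUo hDo hDU hT hsU hwm hwi ?_ hpos'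
    filter_upwards [hpos'] with x hx
    by_cases hxD : x ∈ D
    · exact (hx hxD).le
    · rw [hw, indicator_of_notMem hxD]

end

/-! ### The equivalence -/

theorem mainTheorem7 {N : ℕ} (hN : N = 2 ∨ N = 3)
    (X : Set (EuclideanSpace ℝ (Fin N))) (hXcompact : IsCompact X) (hXreg : HasC1Boundary X)
    (f : EuclideanSpace ℝ (Fin N) → EuclideanSpace ℝ (Fin N))
    (K : ℝ≥0) (hf : LipschitzOnWith K f X)
    (hflow : ∀ x ∈ X, ∃ γ, IsTrajectory f X γ ∧ γ 0 = x)
    (hf0 : f 0 = 0)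
    (hfX : N = 3 → ∀ x ∈ frontier X, f x ≠ 0)
    (δ : ℝ) (hδ : 0 < δ) (hδX : Metric.closedBall 0 δ ⊆ interior X)
    (hstable : LyapunovStable f X) (hattr : Attracts f X (Metric.closedBall 0 δ))
    (hout : Metric.sphere 0 δ ⊆ outflowBoundary f (interior X \ Metric.closedBall 0 δ)) :
    GloballyAsymptoticallyStable f X ↔
      ∀ v₀ : EuclideanSpace ℝ (Fin N) → ℝ,
        MemKoopmanDomain f (interior X \ Metric.closedBall 0 δ) v₀ →
        (∀ᵐ x ∂(volume.restrict (interior X \ Metric.closedBall 0 δ)), 0 < v₀ x) →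
        ∃ v : EuclideanSpace ℝ (Fin N) → ℝ,
          SolvesKoopman f (interior X \ Metric.closedBall 0 δ) v (fun x => - v₀ x) ∧
          ∀ᵐ x ∂(volume.restrict (interior X \ Metric.closedBall 0 δ)), 0 < v x := by
  obtain ⟨F, φ, L, M, h, hFf⟩ := exists_isInvariantFlow hXcompact hf hflow
  have hΓ : Disjoint (frontier (interior X))
      (outflowBoundary f (interior X \ Metric.closedBall 0 δ)) :=
    disjoint_left.2 fun p hp =>
      notMem_outflowBoundary_of_mem_frontier hXcompact.isClosed hXreg hflow hδX hp
  constructor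
  · rintro ⟨-, hall⟩ v₀ hv₀ hpos
    refine h.exists_solvesKoopman hFf hstable (fun x hx => (h.attracts_iff hFf).1 hall x hx hx) hδ hδX
      (fun p hp => ?_) hout hΓ hv₀ hpos
    -- The outward normal of D at the sphere points towards 0, so outflow from D is inflow into the
    -- ball.
    obtain ⟨-, n, hn, hfn⟩ := hout hp
    rw [hFf (interior_subset (hδX (Metric.sphere_subset_closedBall hp)))]
    exact inner_neg_of_isOutwardNormal_diff_closedBall hδ hp hn hfn
  · intro hsol
    have : Nontrivial (EuclideanSpace ℝ (Fin N)) :=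
      Module.nontrivial_of_finrank_pos (R := ℝ) (by rw [finrank_euclideanSpace_fin]; omega)
    have hDm : MeasurableSet (interior X \ Metric.closedBall 0 δ) :=
      isOpen_interior.measurableSet.diff Metric.isClosed_closedBall.measurableSet
    -- Solvability for the single right-hand side max(‖x‖ - δ, 0) already gives global attraction.
    obtain ⟨v, ⟨G, ⟨hv, hG, hw⟩, -, hfG⟩, hv0⟩ := hsol _
      (memKoopmanDomain_max_norm_sub isOpen_interior
        (hXcompact.isBounded.subset interior_subset) hδX hΓ) (by
      filter_upwards [ae_restrict_mem hDm] with x hx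
      have h1 := hx.2
      rw [mem_closedBall_zero_iff, not_le] at h1
      exact lt_max_of_lt_left (sub_pos.2 h1))
    have hempty := h.nonattracted_eq_empty hFf hN hXreg hfX hstable hδ
      ((h.attracts_iff hFf).1 hattr) hv hG hw hfG hv0
    refine ⟨hstable, (h.attracts_iff hFf).2 fun x hx _ => ?_⟩
    by_contra hcon
    exact (hempty.subset ⟨hx, hcon⟩ : x ∈ (∅ : Set _))
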